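/- Let $k$ be a field. Let $\Delta^+=\{(x,y)\in\mathbb R^2 : x+y>0\}$ with the product order; a persistence module $M$ over $\Delta^+$ is a functor from $\Delta^+$ to $k$-vector spaces, and for $s\in\mathbb R_{\ge 0}^2$ one puts $M[s](p)=M(p+s)$. For $s=(s_1,s_2)$ with $s_1,s_2>0$ put $s_x=(s_1,0)$, $s_y=(0,s_2)$. A Mayer–Vietoris system over $\mathbb R$ is a family $(S_i)_{i\in\mathbb Z}$ of persistence modules over $\Delta^+$ with morphisms $\delta_{i+1}^s:S_{i+1}[s]\to S_i$ for all $i\in\mathbb Z$ and $s\in\mathbb R_{>0}^2$, such that all sequences $S_{i+1}[s]\to S_i\to S_i[s_x]\oplus S_i[s_y]\to S_i[s]\to S_{i-1}$ are exact (the outer maps are $\delta_{i+1}^s$ and $\delta_i^s$, the middle ones are $z\mapsto(\tau z,-\tau z)$ and $(z,z')\mapsto\tau z+\tau z'$, with $\tau$ the structure maps), and such that $\delta_i^{s'}\circ\tau=\delta_i^{s}$ for $s\le s'$, with $\tau:S_i[s]\to S_i[s']$. A morphism of Mayer–Vietoris systems is a family of morphisms of persistence modules which commutes with the maps $\delta$.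 For $F$ in the derived category of sheaves of $k$-vector spaces on $\mathbb R$, let $\Psi(F)$ be the Mayer–Vietoris system with $\Psi(F)_n(x,y)=\operatorname{Hom}_k\big(H^n(]-x,y[,F),k\big)$, where $H^n$ is hypercohomology, with the duals of the restriction maps as structure maps, and with $\delta_{n+1}^s$ at $(x,y)$ the dual of the Mayer–Vietoris connecting map $H^n(]-x,y[,F)\to H^{n+1}(]-x-s_1,y+s_2[,F)$ of the covering $]-x-s_1,y+s_2[\;=\;]-x-s_1,y[\;\cup\;]-x,y+s_2[$. For a locally closed $Z\subseteq\mathbb R$ let $k_Z$ be the constant sheaf on $Z$ extended by zero. For a product $B\subseteq\mathbb R^2$ of two intervals, let $k^B$ be the persistence module over $\Delta^+$ which is $k$ at the points of $B\cap\Delta^+$ and $0$ elsewhere, with the identity of $k$ as structure map between any two comparable points of $B\cap\Delta^+$. For real numbers $a,b$ let $$B_d^{[a,b]}=\,]-\infty,-a]\times]-\infty,b],\quad B_v^{[a,b[}=\,]-b,-a]\times\mathbb R,\quad B_h^{]a,b]}=\mathbb R\times\,]a,b],\quad B_b^{]a,b[}=\,]-b,\infty[\times]a,\infty[ .$$ For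 $i\in\mathbb Z$ and $B$ one of the last three (where $a<b$, or $a\le b$ for the last one), let $S_i^B$ be the Mayer–Vietoris system which is $k^B$ in degree $i$ and $0$ in all other degrees, with $\delta=0$. For $B=B_d^{[a,b]}$ with $a<b$, put $B^\dagger=\,]-a,\infty[\times]b,\infty[$, and let $S_i^B$ be the Mayer–Vietoris system which is $k^B$ in degree $i$, $k^{B^\dagger}$ in degree $i+1$ and $0$ in all other degrees, where $\delta_{i+1}^s:k^{B^\dagger}[s]\to k^B$ is the identity of $k$ at every $p\in B\cap\Delta^+$ with $p+s\in B^\dagger$ and $0$ at the other points, and all other $\delta$ are $0$. Then, for all real numbers $a,b$ and all $i\in\mathbb Z$, there are isomorphisms of Mayer–Vietoris systems 1. $\Psi(k_{]a,b[}[-i])\cong S_i^{B_d^{[a,b]}}$ if $a<b$; 2. $\Psi(k_{]a,b]}[-i])\cong S_i^{B_v^{[a,b[}}$ if $a<b$; 3. $\Psi(k_{[a,b[}[-i])\cong S_i^{B_h^{]a,b]}}$ if $a<b$; 4. $\Psi(k_{[a,b]}[-i])\cong S_i^{B_b^{]a,b[}}$ if $a\le b$. So closed ends of the interval become open boundary lines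 of the block, and open ends become closed ones. -/

import Mathlib

open CategoryTheory TopologicalSpace Limits Opposite Topology
open scoped NNReal

universe v u w

noncomputable section

namespace MayerVietoris

/-! ### The half-plane `Δ⁺` and persistence modules over it -/

/-- `Δ⁺ = {(x, y) ∈ ℝ² | x + y > 0}`, with the product order. -/
abbrev DeltaPlus : Type := {p : ℝ × ℝ // 0 < p.1 + p.2}

/-- The translate `p + s` of a point `p ∈ Δ⁺` by a vector `s` with non-negative coordinates. -/
def DeltaPlus.add (p : DeltaPlus) (s : ℝ≥0 × ℝ≥0) : DeltaPlus :=
  ⟨(p.1.1 + s.1, p.1.2 + s.2), by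
    have h := p.2
    have h₁ := s.1.2
    have h₂ := s.2.2
    change 0 < p.1.1 + (s.1 : ℝ) + (p.1.2 + (s.2 : ℝ))
    linarith [s.1.coe_nonneg, s.2.coe_nonneg]⟩

lemma DeltaPlus.le_add (p : DeltaPlus) (s : ℝ≥0 × ℝ≥0) : p ≤ p.add s :=
  ⟨le_add_of_nonneg_right s.1.coe_nonneg, le_add_of_nonneg_right s.2.coe_nonneg⟩

lemma DeltaPlus.add_le_add {p q : DeltaPlus} (h : p ≤ q) {s t : ℝ≥0 × ℝ≥0} (hst : s ≤ t) :
    p.add s ≤ q.add t :=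
  ⟨_root_.add_le_add h.1 (NNReal.coe_le_coe.2 hst.1),
    _root_.add_le_add h.2 (NNReal.coe_le_coe.2 hst.2)⟩

/-- The vectors `s = (s₁, s₂)` with `s₁ > 0` and `s₂ > 0`, with the product order. -/
abbrev PosVec : Type := {s : ℝ≥0 × ℝ≥0 // 0 < s.1 ∧ 0 < s.2}

/-- `s_x = (s₁, 0)`. -/
def PosVec.x (s : PosVec) : ℝ≥0 × ℝ≥0 := (s.1.1, 0)

/-- `s_y = (0, s₂)`. -/
def PosVec.y (s : PosVec) : ℝ≥0 × ℝ≥0 := (0, s.1.2)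

lemma PosVec.x_le (s : PosVec) : s.x ≤ s.1 := ⟨le_rfl, zero_le⟩

lemma PosVec.y_le (s : PosVec) : s.y ≤ s.1 := ⟨zero_le, le_rfl⟩

/-- Persistence modules over `Δ⁺`: functors from the poset `Δ⁺` to `k`-vector spaces. -/
abbrev Pers (k : Type u) [Field k] := DeltaPlus ⥤ ModuleCat.{v} k

section Pers

variable {k : Type u} [Field k]

/-- The order-preserving translation `p ↦ p + s` of `Δ⁺`, as a functor. -/
def translation (s : ℝ≥0 × ℝ≥0) : DeltaPlus ⥤ DeltaPlus :=
  Monotone.functor (f := fun p ↦ p.add s) fun _ _ h ↦ DeltaPlus.add_le_add h le_rfl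

/-- The shifted persistence module `M[s]`, with `M[s](p) = M(p + s)`. -/
abbrev Pers.shift (M : Pers.{v} k) (s : ℝ≥0 × ℝ≥0) : Pers.{v} k := translation s ⋙ M

/-- The translation morphism `M[s] ⟶ M[t]` for `s ≤ t`, given by the structure maps of `M`. -/
def Pers.shiftMap (M : Pers.{v} k) {s t : ℝ≥0 × ℝ≥0} (h : s ≤ t) : M.shift s ⟶ M.shift t where
  app p := M.map (homOfLE (DeltaPlus.add_le_add (le_refl p) h))
  naturality p q f := by
    change M.map _ ≫ M.map _ = M.map _ ≫ M.map _
    rw [← M.map_comp, ← M.map_comp]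
    rfl

/-- The value at `p` of the first map `M ⟶ M[s_x] ⊕ M[s_y]`, `z ↦ (τ z, -τ z)`. -/
def Pers.first (M : Pers.{v} k) (s : PosVec) (p : DeltaPlus) :
    M.obj p →ₗ[k] M.obj (p.add s.x) × M.obj (p.add s.y) :=
  (M.map (homOfLE (p.le_add s.x))).hom.prod (-(M.map (homOfLE (p.le_add s.y))).hom)

/-- The value at `p` of the second map `M[s_x] ⊕ M[s_y] ⟶ M[s]`, `(z, z') ↦ τ z + τ z'`. -/
def Pers.second (M : Pers.{v} k) (s : PosVec) (p : DeltaPlus) :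
    M.obj (p.add s.x) × M.obj (p.add s.y) →ₗ[k] M.obj (p.add s.1) :=
  (M.map (homOfLE (DeltaPlus.add_le_add (le_refl p) s.x_le))).hom.coprod
    (M.map (homOfLE (DeltaPlus.add_le_add (le_refl p) s.y_le))).hom

end Pers

/-! ### Mayer-Vietoris systems -/

/-- A Mayer-Vietoris system over `ℝ`: persistence modules `S_i`, `i ∈ ℤ`, with morphisms
`δ : S_{i+1}[s] ⟶ S_i`, such that all the sequences
`S_{i+1}[s] ⟶ S_i ⟶ S_i[s_x] ⊕ S_i[s_y] ⟶ S_i[s] ⟶ S_{i-1}` are exact and such that the `δ` for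
`s ≤ s'` are compatible. (The last exactness is written in degree `i + 1`.) -/
structure MVSystem (k : Type u) [Field k] where
  /-- the persistence module in degree `i` -/
  obj : ℤ → Pers.{v} k
  /-- the connecting morphism `S_{i+1}[s] ⟶ S_i` -/
  δ : ∀ (i : ℤ) (s : PosVec), (obj (i + 1)).shift s.1 ⟶ obj i
  exact_first : ∀ (i : ℤ) (s : PosVec) (p : DeltaPlus),
    Function.Exact ((δ i s).app p).hom ((obj i).first s p)
  exact_middle : ∀ (i : ℤ) (s : PosVec) (p : DeltaPlus),
    Function.Exact ((obj i).first s p) ((obj i).second s p)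
  exact_second : ∀ (i : ℤ) (s : PosVec) (p : DeltaPlus),
    Function.Exact ((obj (i + 1)).second s p) ((δ i s).app p).hom
  δ_comp : ∀ (i : ℤ) (s t : PosVec) (h : s ≤ t),
    (obj (i + 1)).shiftMap (s := s.1) (t := t.1) h ≫ δ i t = δ i s

namespace MVSystem

variable {k : Type u} [Field k]

/-- Morphisms of Mayer-Vietoris systems: families of morphisms of persistence modules which
commute with the connecting morphisms. -/
@[ext]
structure Hom (S T : MVSystem.{v} k) where
  /-- the component in degree `i` -/
  app : ∀ i : ℤ, S.obj i ⟶ T.obj i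
  comm : ∀ (i : ℤ) (s : PosVec),
    Functor.whiskerLeft (translation s.1) (app (i + 1)) ≫ T.δ i s = S.δ i s ≫ app i

instance : Category (MVSystem.{v} k) where
  Hom S T := Hom S T
  id S :=
    { app := fun i ↦ 𝟙 (S.obj i)
      comm := fun i s ↦ by
        rw [Functor.whiskerLeft_id', Category.comp_id]
        exact Category.id_comp _ }
  comp f g :=
    { app := fun i ↦ f.app i ≫ g.app i
      comm := fun i s ↦ by
        rw [Functor.whiskerLeft_comp, Category.assoc, g.comm i s, ← Category.assoc, f.comm i s,
          Category.assoc] }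
  id_comp f := Hom.ext (funext fun _ ↦ Category.id_comp _)
  comp_id f := Hom.ext (funext fun _ ↦ Category.comp_id _)
  assoc f g h := Hom.ext (funext fun _ ↦ Category.assoc _ _ _)

end MVSystem

/-! ### Block modules -/

section BlockModule

variable (k : Type u) [Field k]

/-- The vector space `k` if the proposition `P` holds and `0` otherwise. -/
abbrev KIf (P : Prop) : Type (max u v) := PLift P → ULift.{v} k

/-- The map between two such spaces which is the identity of `k` if both `P` and `Q` hold, and
`0` otherwise. -/
def idIf (P Q : Prop) : KIf.{v} k P →ₗ[k] KIf.{v} k Q := by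
  classical
  exact
  { toFun := fun f _ ↦ if hP : P then f ⟨hP⟩ else 0
    map_add' := fun f g ↦ by
      funext _
      by_cases hP : P <;> simp [hP]
    map_smul' := fun c f ↦ by
      funext _
      by_cases hP : P <;> simp [hP] }

variable {k}

lemma idIf_pos {P Q : Prop} (hP : P) (f : KIf.{v} k P) (h : PLift Q) :
    idIf.{v} k P Q f h = f ⟨hP⟩ := by simp [idIf, hP]

lemma idIf_neg {P Q : Prop} (hP : ¬ P) (f : KIf.{v} k P) (h : PLift Q) :
    idIf.{v} k P Q f h = 0 := by simp [idIf, hP]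

lemma idIf_self (P : Prop) : idIf.{v} k P P = LinearMap.id :=
  LinearMap.ext fun f ↦ funext fun h ↦ idIf_pos h.down f h

lemma idIf_comp {P Q R : Prop} (h : P → R → Q) :
    idIf.{v} k Q R ∘ₗ idIf.{v} k P Q = idIf.{v} k P R := by
  refine LinearMap.ext fun f ↦ funext fun hR ↦ ?_
  rw [LinearMap.comp_apply]
  by_cases hP : P
  · rw [idIf_pos (h hP hR.down), idIf_pos hP, idIf_pos hP]
  · rw [idIf_neg hP]
    by_cases hQ : Q
    · rw [idIf_pos hQ, idIf_neg hP]
    · rw [idIf_neg hQ]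

lemma KIf.eq_zero {P : Prop} (h : ¬ P) (f : KIf.{v} k P) : f = 0 := funext fun a ↦ (h a.down).elim

lemma exact_first_of {A B C E : Prop} (h : A → (E ↔ (¬ B ∧ ¬ C))) :
    Function.Exact (idIf.{v} k E A) ((idIf.{v} k A B).prod (-idIf.{v} k A C)) := by
  intro f
  by_cases hA : A
  · by_cases hE : E
    · obtain ⟨hB, hC⟩ := (h hA).1 hE
      refine ⟨fun _ ↦ ⟨fun _ ↦ f ⟨hA⟩, funext fun a ↦ idIf_pos hE _ _⟩, fun _ ↦ ?_⟩
      exact Prod.ext (KIf.eq_zero hB _) (KIf.eq_zero hC _)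
    · constructor
      · intro hf
        refine ⟨0, funext fun a ↦ ?_⟩
        rw [idIf_neg hE]
        by_cases hB : B
        · have := congrFun (congrArg Prod.fst hf) ⟨hB⟩
          exact (idIf_pos hA f ⟨hB⟩).symm.trans this |>.symm
        · have hC : C := by by_contra hC; exact hE ((h hA).2 ⟨hB, hC⟩)
          have := congrFun (congrArg Prod.snd hf) ⟨hC⟩
          have h' : -(idIf.{v} k A C f ⟨hC⟩) = 0 := this
          rw [idIf_pos hA, neg_eq_zero] at h'
          exact h'.symm
      · rintro ⟨g, rfl⟩
        rw [KIf.eq_zero hE g, map_zero, map_zero]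
  · rw [KIf.eq_zero hA f, map_zero]
    exact ⟨fun _ ↦ ⟨0, map_zero _⟩, fun _ ↦ rfl⟩

lemma exact_middle_of {A B C D : Prop} (h : B → C → A ∧ D) (h' : B → ¬ C → (A ↔ ¬ D))
    (h'' : C → ¬ B → (A ↔ ¬ D)) :
    Function.Exact ((idIf.{v} k A B).prod (-idIf.{v} k A C))
      ((idIf.{v} k B D).coprod (idIf.{v} k C D)) := by
  rintro ⟨f, g⟩
  rw [LinearMap.coprod_apply]
  by_cases hB : B <;> by_cases hC : C
  · obtain ⟨hA, hD⟩ := h hB hC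
    constructor
    · intro hfg
      have h0 := congrFun hfg ⟨hD⟩
      rw [Pi.add_apply, idIf_pos hB, idIf_pos hC] at h0
      refine ⟨fun _ ↦ f ⟨hB⟩, Prod.ext (funext fun _ ↦ idIf_pos hA _ _) (funext fun a ↦ ?_)⟩
      change -(idIf.{v} k A C _ _) = _
      rw [idIf_pos hA]
      exact neg_eq_of_add_eq_zero_right h0
    · rintro ⟨e, he⟩
      obtain ⟨rfl, rfl⟩ := Prod.mk.inj he
      funext a
      change idIf.{v} k B D (idIf.{v} k A B e) a + idIf.{v} k C D (-(idIf.{v} k A C e)) a = 0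
      rw [idIf_pos hB, idIf_pos hC, Pi.neg_apply, idIf_pos hA, idIf_pos hA, add_neg_cancel]
  · rw [KIf.eq_zero hC g, map_zero, add_zero]
    have hAD := h' hB hC
    by_cases hD : D
    · have hA : ¬ A := fun hA ↦ hAD.1 hA hD
      constructor
      · intro hf
        refine ⟨0, Prod.ext ?_ (KIf.eq_zero hC _)⟩
        rw [map_zero]
        funext a
        exact ((idIf_pos hB f ⟨hD⟩).symm.trans (congrFun hf ⟨hD⟩)).symm
      · rintro ⟨e, he⟩
        obtain ⟨rfl, -⟩ := Prod.mk.inj he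
        rw [KIf.eq_zero hA e, map_zero, map_zero]
    · have hA : A := hAD.2 hD
      exact ⟨fun _ ↦ ⟨fun _ ↦ f ⟨hB⟩, Prod.ext (funext fun _ ↦ idIf_pos hA _ _)
        (KIf.eq_zero hC _ |>.trans (KIf.eq_zero hC _).symm)⟩, fun _ ↦ KIf.eq_zero hD _⟩
  · rw [KIf.eq_zero hB f, map_zero, zero_add]
    have hAD := h'' hC hB
    by_cases hD : D
    · have hA : ¬ A := fun hA ↦ hAD.1 hA hD
      constructor
      · intro hf
        refine ⟨0, Prod.ext (KIf.eq_zero hB _) ?_⟩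
        rw [map_zero]
        funext a
        exact ((idIf_pos hC g ⟨hD⟩).symm.trans (congrFun hf ⟨hD⟩)).symm
      · rintro ⟨e, he⟩
        obtain ⟨-, rfl⟩ := Prod.mk.inj he
        rw [KIf.eq_zero hA e, map_zero, map_zero]
    · have hA : A := hAD.2 hD
      refine ⟨fun _ ↦ ⟨fun _ ↦ -g ⟨hC⟩, Prod.ext
        (KIf.eq_zero hB _ |>.trans (KIf.eq_zero hB _).symm) (funext fun a ↦ ?_)⟩,
        fun _ ↦ KIf.eq_zero hD _⟩
      change -(idIf.{v} k A C _ _) = _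
      rw [idIf_pos hA, neg_neg]
  · rw [KIf.eq_zero hB f, KIf.eq_zero hC g, map_zero, map_zero, add_zero]
    exact ⟨fun _ ↦ ⟨0, map_zero _⟩, fun _ ↦ rfl⟩

lemma exact_second_of {B C D E : Prop} (h : D → (¬ E ↔ (B ∨ C))) :
    Function.Exact ((idIf.{v} k B D).coprod (idIf.{v} k C D)) (idIf.{v} k D E) := by
  intro f
  by_cases hD : D
  · by_cases hE : E
    · have hB : ¬ B := fun hB ↦ (h hD).2 (Or.inl hB) hE
      have hC : ¬ C := fun hC ↦ (h hD).2 (Or.inr hC) hE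
      constructor
      · intro hf
        refine ⟨0, ?_⟩
        rw [map_zero]
        funext a
        exact ((idIf_pos hD f ⟨hE⟩).symm.trans (congrFun hf ⟨hE⟩)).symm
      · rintro ⟨⟨g, g'⟩, rfl⟩
        rw [KIf.eq_zero hB g, KIf.eq_zero hC g']
        exact (congrArg _ (map_zero _)).trans (map_zero _)
    · refine ⟨fun _ ↦ ?_, fun _ ↦ KIf.eq_zero hE _⟩
      rcases (h hD).1 hE with hB | hC
      · refine ⟨(fun _ ↦ f ⟨hD⟩, 0), ?_⟩
        rw [LinearMap.coprod_apply, map_zero, add_zero]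
        exact funext fun _ ↦ idIf_pos hB _ _
      · refine ⟨(0, fun _ ↦ f ⟨hD⟩), ?_⟩
        rw [LinearMap.coprod_apply, map_zero, zero_add]
        exact funext fun _ ↦ idIf_pos hC _ _
  · rw [KIf.eq_zero hD f, map_zero]
    exact ⟨fun _ ↦ ⟨0, map_zero _⟩, fun _ ↦ rfl⟩

variable (k)

/-- The persistence module `k^B` over `Δ⁺` of an order-convex subset `B` of `ℝ²`: it is `k` at the
points of `B` and `0` elsewhere, its structure map from `p` to `q` is the identity of `k` if `p`
and `q` lie in `B` and it is `0` otherwise. -/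
def blockModule (B : Set (ℝ × ℝ)) (hB : B.OrdConnected) : Pers.{max u v} k where
  obj p := ModuleCat.of k (KIf.{v} k (p.1 ∈ B))
  map {p q} _ := ModuleCat.ofHom (idIf.{v} k (p.1 ∈ B) (q.1 ∈ B))
  map_id p := by rw [idIf_self]; rfl
  map_comp {p q r} f g := by
    rw [← ModuleCat.ofHom_comp, idIf_comp fun hp hr ↦ hB.out hp hr ⟨leOfHom f, leOfHom g⟩]

/-- The set-theoretic conditions on a family `(D i)_{i ∈ ℤ}` of subsets of `ℝ²` under which the
persistence modules `k^{D i}` form a Mayer-Vietoris system. -/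
structure IsMVFamily (D : ℤ → Set (ℝ × ℝ)) : Prop where
  ordConnected : ∀ i, (D i).OrdConnected
  first : ∀ (i : ℤ) (s : PosVec) (p : DeltaPlus), p.1 ∈ D i →
    ((p.add s.1).1 ∈ D (i + 1) ↔ ((p.add s.x).1 ∉ D i ∧ (p.add s.y).1 ∉ D i))
  middle : ∀ (i : ℤ) (s : PosVec) (p : DeltaPlus), (p.add s.x).1 ∈ D i → (p.add s.y).1 ∈ D i →
    p.1 ∈ D i ∧ (p.add s.1).1 ∈ D i
  middle_x : ∀ (i : ℤ) (s : PosVec) (p : DeltaPlus), (p.add s.x).1 ∈ D i → (p.add s.y).1 ∉ D i →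
    (p.1 ∈ D i ↔ (p.add s.1).1 ∉ D i)
  middle_y : ∀ (i : ℤ) (s : PosVec) (p : DeltaPlus), (p.add s.y).1 ∈ D i → (p.add s.x).1 ∉ D i →
    (p.1 ∈ D i ↔ (p.add s.1).1 ∉ D i)
  second : ∀ (i : ℤ) (s : PosVec) (p : DeltaPlus), (p.add s.1).1 ∈ D (i + 1) →
    (p.1 ∉ D i ↔ ((p.add s.x).1 ∈ D (i + 1) ∨ (p.add s.y).1 ∈ D (i + 1)))
  natural : ∀ (i : ℤ) (s : PosVec) (p q : DeltaPlus), p ≤ q → (p.add s.1).1 ∈ D (i + 1) →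
    q.1 ∈ D i → ((q.add s.1).1 ∈ D (i + 1) ↔ p.1 ∈ D i)
  compatible : ∀ (i : ℤ) (s t : PosVec) (p : DeltaPlus), s ≤ t → (p.add s.1).1 ∈ D (i + 1) →
    p.1 ∈ D i → (p.add t.1).1 ∈ D (i + 1)

lemma idIf_comm {P Q Q' R : Prop} (h : P → R → (Q ↔ Q')) :
    idIf.{v} k Q R ∘ₗ idIf.{v} k P Q = idIf.{v} k Q' R ∘ₗ idIf.{v} k P Q' := by
  refine LinearMap.ext fun f ↦ funext fun hR ↦ ?_
  rw [LinearMap.comp_apply, LinearMap.comp_apply]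
  by_cases hP : P
  · have := h hP hR.down
    by_cases hQ : Q
    · rw [idIf_pos hQ, idIf_pos (this.1 hQ), idIf_pos hP, idIf_pos hP]
    · rw [idIf_neg hQ, idIf_neg (fun h ↦ hQ (this.2 h))]
  · rw [KIf.eq_zero hP f, map_zero, map_zero, map_zero, map_zero]

/-- The Mayer-Vietoris system `(k^{D i})_i` of such a family, whose connecting morphism
`k^{D (i + 1)}[s] ⟶ k^{D i}` is the identity of `k` at the points `p ∈ D i` such that
`p + s ∈ D (i + 1)` and is `0` at the other points of `Δ⁺`. -/
def familySystem (D : ℤ → Set (ℝ × ℝ)) (hD : IsMVFamily D) : MVSystem.{max u v} k where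
  obj i := blockModule.{v} k (D i) (hD.ordConnected i)
  δ i s :=
    { app := fun p ↦ ModuleCat.ofHom (idIf.{v} k ((p.add s.1).1 ∈ D (i + 1)) (p.1 ∈ D i))
      naturality := fun p q f ↦ ModuleCat.hom_ext
        (idIf_comm k fun hp hq ↦ hD.natural i s p q (leOfHom f) hp hq) }
  exact_first i s p := exact_first_of (hD.first i s p)
  exact_middle i s p := exact_middle_of (hD.middle i s p) (hD.middle_x i s p) (hD.middle_y i s p)
  exact_second i s p := exact_second_of (hD.second i s p)
  δ_comp i s t h := NatTrans.ext (funext fun p ↦ ModuleCat.hom_ext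
    (idIf_comp fun hs hp ↦ hD.compatible i s t p h hs hp))

end BlockModule

/-! ### Blocks -/

/-- The half-line `⟨a, ∞[`, which contains `a` if and only if `c` is true. -/
def upRay (a : ℝ) (c : Bool) : Set ℝ := {x | a < x ∨ (c = true ∧ x = a)}

/-- The half-line `]-∞, a⟩`, which contains `a` if and only if `c` is true. -/
def downRay (a : ℝ) (c : Bool) : Set ℝ := {x | x < a ∨ (c = true ∧ x = a)}

lemma isUpperSet_upRay (a : ℝ) (c : Bool) : IsUpperSet (upRay a c) := by
  rintro x y hxy (h | ⟨h, rfl⟩)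
  · exact Or.inl (h.trans_le hxy)
  · rcases hxy.eq_or_lt with rfl | h'
    · exact Or.inr ⟨h, rfl⟩
    · exact Or.inl h'

lemma isLowerSet_downRay (a : ℝ) (c : Bool) : IsLowerSet (downRay a c) := by
  rintro x y hxy (h | ⟨h, rfl⟩)
  · exact Or.inl (hxy.trans_lt h)
  · rcases hxy.eq_or_lt with rfl | h'
    · exact Or.inr ⟨h, rfl⟩
    · exact Or.inl h'

lemma mem_upRay_not_iff (a : ℝ) (c : Bool) (x : ℝ) : x ∈ upRay a (!c) ↔ x ∉ downRay a c := by
  rcases lt_trichotomy x a with h | rfl | h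
  · simp [upRay, downRay, h, h.ne, h.le]
  · cases c <;> simp [upRay, downRay]
  · simp [upRay, downRay, h, h.ne', h.le]

/-- The interval `⟨a, b⟩` of `ℝ` with `b ∈ ℝ ∪ {+∞}`; `ca` and `cb` say whether it contains its
(finite) end points. -/
def segment (a : ℝ) (b : WithTop ℝ) (ca cb : Bool) : Set ℝ :=
  {x | x ∈ upRay a ca ∧ ((x : WithTop ℝ) < b ∨ (cb = true ∧ (x : WithTop ℝ) = b))}

/-- Blocks; the Boolean parameters say which of the boundary lines belong to the block. -/
inductive Block : Type
  /-- the birth block `⟨a, ∞[ × ⟨b, ∞[` -/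
  | birth (a b : ℝ) (ca cb : Bool)
  /-- the birth block `]-∞, ∞[ × ]-∞, ∞[` -/
  | plane
  /-- the death block `]-∞, a⟩ × ]-∞, b⟩` -/
  | death (a b : ℝ) (ca cb : Bool)
  /-- the horizontal block `ℝ × ⟨a, b⟩` -/
  | horizontal (a : ℝ) (b : WithTop ℝ) (ca cb : Bool)
  /-- the vertical block `⟨a, b⟩ × ℝ` -/
  | vertical (a : ℝ) (b : WithTop ℝ) (ca cb : Bool)

/-- The subset of `ℝ²` given by a block. -/
def Block.toSet : Block → Set (ℝ × ℝ)
  | .birth a b ca cb => upRay a ca ×ˢ upRay b cb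
  | .plane => Set.univ
  | .death a b ca cb => downRay a ca ×ˢ downRay b cb
  | .horizontal a b ca cb => Set.univ ×ˢ segment a b ca cb
  | .vertical a b ca cb => segment a b ca cb ×ˢ Set.univ

/-- The family of subsets of `ℝ²` which is `B` in degree `j` and empty in the other degrees. -/
def single (j : ℤ) (B : Set (ℝ × ℝ)) (i : ℤ) : Set (ℝ × ℝ) := {p | i = j ∧ p ∈ B}

/-- The family of subsets of `ℝ²` which is `B` in degree `j`, `B'` in degree `j + 1` and empty in
the other degrees. -/
def double (j : ℤ) (B B' : Set (ℝ × ℝ)) (i : ℤ) : Set (ℝ × ℝ) :=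
  {p | (i = j ∧ p ∈ B) ∨ (i = j + 1 ∧ p ∈ B')}

lemma add_fst (p : DeltaPlus) (s : ℝ≥0 × ℝ≥0) : (p.add s).1.1 = p.1.1 + s.1 := rfl
lemma add_snd (p : DeltaPlus) (s : ℝ≥0 × ℝ≥0) : (p.add s).1.2 = p.1.2 + s.2 := rfl

lemma isMVFamily_single (j : ℤ) (B : Set (ℝ × ℝ)) (hB : B.OrdConnected)
    (h : ∀ (s : PosVec) (p : DeltaPlus),
      (p.1 ∈ B → (p.add s.x).1 ∈ B ∨ (p.add s.y).1 ∈ B) ∧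
      ((p.add s.1).1 ∈ B → (p.add s.x).1 ∈ B ∨ (p.add s.y).1 ∈ B) ∧
      ((p.add s.x).1 ∈ B → (p.add s.y).1 ∈ B → p.1 ∈ B ∧ (p.add s.1).1 ∈ B) ∧
      ((p.add s.x).1 ∈ B → (p.add s.y).1 ∉ B → (p.1 ∈ B ↔ (p.add s.1).1 ∉ B)) ∧
      ((p.add s.y).1 ∈ B → (p.add s.x).1 ∉ B → (p.1 ∈ B ↔ (p.add s.1).1 ∉ B))) :
    IsMVFamily (single j B) := by
  have hmem : ∀ (i : ℤ) (q : ℝ × ℝ), q ∈ single j B i ↔ i = j ∧ q ∈ B := fun _ _ ↦ Iff.rfl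
  constructor
  · intro i
    refine ⟨fun x hx y hy z hz ↦ ⟨hx.1, hB.out hx.2 hy.2 hz⟩⟩
  · intro i s p hp
    have hj : i = j := hp.1
    have := (h s p).1 hp.2
    simp only [hmem, hj, true_and]
    subst hj
    simp only [add_eq_left, one_ne_zero, false_and, false_iff]
    tauto
  · intro i s p hp hq
    exact ⟨⟨hp.1, ((h s p).2.2.1 hp.2 hq.2).1⟩, ⟨hp.1, ((h s p).2.2.1 hp.2 hq.2).2⟩⟩
  · intro i s p hp hq
    obtain ⟨rfl, hp⟩ := hp
    simp only [hmem, true_and] at hq ⊢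
    exact (h s p).2.2.2.1 hp hq
  · intro i s p hp hq
    obtain ⟨rfl, hp⟩ := hp
    simp only [hmem, true_and] at hq ⊢
    exact (h s p).2.2.2.2 hp hq
  · intro i s p hp
    obtain ⟨rfl, hp⟩ := hp
    have := (h s p).2.1 hp
    have hi : ¬ (i = i + 1) := by omega
    simp only [hmem, true_and, hi, false_and, not_false_iff, true_iff]
    exact this
  · intro i s p q _ hp hq
    have := hp.1
    have := hq.1
    omega
  · intro i s t p _ hp hq
    have := hp.1
    have := hq.1
    omega

lemma isMVFamily_double (j : ℤ) (X Y : Set ℝ) (hX : IsLowerSet X) (hY : IsLowerSet Y) :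
    IsMVFamily (double j (X ×ˢ Y) (Xᶜ ×ˢ Yᶜ)) := by
  have hmem : ∀ (i : ℤ) (q : ℝ × ℝ), q ∈ double j (X ×ˢ Y) (Xᶜ ×ˢ Yᶜ) i ↔
      (i = j ∧ q.1 ∈ X ∧ q.2 ∈ Y) ∨ (i = j + 1 ∧ q.1 ∉ X ∧ q.2 ∉ Y) := fun _ _ ↦ Iff.rfl
  have hx : ∀ (p : DeltaPlus) (s : ℝ≥0 × ℝ≥0), p.1.1 + s.1 ∈ X → p.1.1 ∈ X := fun p s h ↦
    hX (le_add_of_nonneg_right s.1.coe_nonneg) h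
  have hy : ∀ (p : DeltaPlus) (s : ℝ≥0 × ℝ≥0), p.1.2 + s.2 ∈ Y → p.1.2 ∈ Y := fun p s h ↦
    hY (le_add_of_nonneg_right s.2.coe_nonneg) h
  have key : ∀ i : ℤ, i = j ∧ ¬ (i = j + 1) ∧ ¬ (i + 1 = j) ∧ i + 1 = j + 1 ∨
      ¬ (i = j) ∧ i = j + 1 ∧ ¬ (i + 1 = j) ∧ ¬ (i + 1 = j + 1) ∨
      ¬ (i = j) ∧ ¬ (i = j + 1) ∧ i + 1 = j ∧ ¬ (i + 1 = j + 1) ∨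
      ¬ (i = j) ∧ ¬ (i = j + 1) ∧ ¬ (i + 1 = j) ∧ ¬ (i + 1 = j + 1) := by
    intro i; omega
  constructor
  · intro i
    refine ⟨fun p hp q hq z hz ↦ ?_⟩
    rw [hmem] at hp hq ⊢
    have h₁ : z.1 ∈ X → p.1 ∈ X := fun h ↦ hX hz.1.1 h
    have h₂ : z.2 ∈ Y → p.2 ∈ Y := fun h ↦ hY hz.1.2 h
    have h₃ : q.1 ∈ X → z.1 ∈ X := fun h ↦ hX hz.2.1 h
    have h₄ : q.2 ∈ Y → z.2 ∈ Y := fun h ↦ hY hz.2.2 h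
    have := key i
    tauto
  · intro i s p
    have h₁ := hx p s.1
    have h₂ := hy p s.1
    have h := key i
    simp only [hmem, add_fst, add_snd, PosVec.x, PosVec.y, NNReal.coe_zero, add_zero]
    generalize (i = j) = P₁, (i = j + 1) = P₂, (i + 1 = j) = P₃, (i + 1 = j + 1) = P₄ at *
    generalize (p.1.1 ∈ X) = A, (p.1.2 ∈ Y) = B, (p.1.1 + s.1.1 ∈ X) = A', (p.1.2 + s.1.2 ∈ Y) = B'
      at *
    clear hmem hx hy key hX hY
    grind
  · intro i s p
    have h₁ := hx p s.1
    have h₂ := hy p s.1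
    have h := key i
    simp only [hmem, add_fst, add_snd, PosVec.x, PosVec.y, NNReal.coe_zero, add_zero]
    generalize (i = j) = P₁, (i = j + 1) = P₂, (i + 1 = j) = P₃, (i + 1 = j + 1) = P₄ at *
    generalize (p.1.1 ∈ X) = A, (p.1.2 ∈ Y) = B, (p.1.1 + s.1.1 ∈ X) = A', (p.1.2 + s.1.2 ∈ Y) = B'
      at *
    clear hmem hx hy key hX hY
    grind
  · intro i s p
    have h₁ := hx p s.1
    have h₂ := hy p s.1
    have h := key i
    simp only [hmem, add_fst, add_snd, PosVec.x, PosVec.y, NNReal.coe_zero, add_zero]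
    generalize (i = j) = P₁, (i = j + 1) = P₂, (i + 1 = j) = P₃, (i + 1 = j + 1) = P₄ at *
    generalize (p.1.1 ∈ X) = A, (p.1.2 ∈ Y) = B, (p.1.1 + s.1.1 ∈ X) = A', (p.1.2 + s.1.2 ∈ Y) = B'
      at *
    clear hmem hx hy key hX hY
    grind
  · intro i s p
    have h₁ := hx p s.1
    have h₂ := hy p s.1
    have h := key i
    simp only [hmem, add_fst, add_snd, PosVec.x, PosVec.y, NNReal.coe_zero, add_zero]
    generalize (i = j) = P₁, (i = j + 1) = P₂, (i + 1 = j) = P₃, (i + 1 = j + 1) = P₄ at *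
    generalize (p.1.1 ∈ X) = A, (p.1.2 ∈ Y) = B, (p.1.1 + s.1.1 ∈ X) = A', (p.1.2 + s.1.2 ∈ Y) = B'
      at *
    clear hmem hx hy key hX hY
    grind
  · intro i s p
    have h₁ := hx p s.1
    have h₂ := hy p s.1
    have h := key i
    simp only [hmem, add_fst, add_snd, PosVec.x, PosVec.y, NNReal.coe_zero, add_zero]
    generalize (i = j) = P₁, (i = j + 1) = P₂, (i + 1 = j) = P₃, (i + 1 = j + 1) = P₄ at *
    generalize (p.1.1 ∈ X) = A, (p.1.2 ∈ Y) = B, (p.1.1 + s.1.1 ∈ X) = A', (p.1.2 + s.1.2 ∈ Y) = B'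
      at *
    clear hmem hx hy key hX hY
    grind
  · intro i s p q hpq
    have h₁ : q.1.1 ∈ X → p.1.1 ∈ X := fun h ↦ hX hpq.1 h
    have h₂ : q.1.2 ∈ Y → p.1.2 ∈ Y := fun h ↦ hY hpq.2 h
    have h₃ : q.1.1 + s.1.1 ∈ X → p.1.1 + s.1.1 ∈ X := fun h ↦ hX (by gcongr; exact hpq.1) h
    have h₄ : q.1.2 + s.1.2 ∈ Y → p.1.2 + s.1.2 ∈ Y := fun h ↦ hY (by gcongr; exact hpq.2) h
    have h := key i
    simp only [hmem, add_fst, add_snd]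
    generalize (i = j) = P₁, (i = j + 1) = P₂, (i + 1 = j) = P₃, (i + 1 = j + 1) = P₄ at *
    clear hmem hx hy key hX hY
    grind
  · intro i s t p hst
    have h₃ : p.1.1 + t.1.1 ∈ X → p.1.1 + s.1.1 ∈ X := fun h ↦ hX (by
      gcongr; exact hst.1) h
    have h₄ : p.1.2 + t.1.2 ∈ Y → p.1.2 + s.1.2 ∈ Y := fun h ↦ hY (by
      gcongr; exact hst.2) h
    have h := key i
    simp only [hmem, add_fst, add_snd]
    generalize (i = j) = P₁, (i = j + 1) = P₂, (i + 1 = j) = P₃, (i + 1 = j + 1) = P₄ at *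
    clear hmem hx hy key hX hY
    grind

/-- The family of sets underlying the Mayer-Vietoris system `S_j^B` of a block `B`.
* If `B` is a birth block `⟨a, ∞[ × ⟨b, ∞[` with `a + b ≤ 0`, or the whole plane, or a horizontal or
  vertical block, `S_j^B` is `k^B` in degree `j`, with zero connecting morphisms.
* If `B` is a death block `]-∞, a⟩ × ]-∞, b⟩` with `a + b > 0`, it is `k^B` in degree `j` and
  `k^{B†}` in degree `j + 1`, where the dual block `B†` is the birth block with the same corner which
  contains a boundary line if and only if `B` does not; the connecting morphism
  `k^{B†}[s] ⟶ k^B` is the identity of `k` wherever both sides are `k`.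
* If `B` is a birth block with `a + b > 0`, it is `S_{j-1}^{B†}` for the dual death block `B†`.
* If `B` is a death block with `a + b ≤ 0`, it is `0`. -/
def Block.family : Block → ℤ → ℤ → Set (ℝ × ℝ)
  | .birth a b ca cb, j =>
      open scoped Classical in
      if a + b ≤ 0 then single j (Block.birth a b ca cb).toSet
      else double (j - 1) (Block.death a b (!ca) (!cb)).toSet (Block.birth a b ca cb).toSet
  | .plane, j => single j Block.plane.toSet
  | .death a b ca cb, j =>
      open scoped Classical in
      if 0 < a + b then
        double j (Block.death a b ca cb).toSet (Block.birth a b (!ca) (!cb)).toSet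
      else fun _ ↦ ∅
  | .horizontal a b ca cb, j => single j (Block.horizontal a b ca cb).toSet
  | .vertical a b ca cb, j => single j (Block.vertical a b ca cb).toSet

lemma ordConnected_upRay (a : ℝ) (c : Bool) : (upRay a c).OrdConnected :=
  (isUpperSet_upRay a c).ordConnected

lemma ordConnected_segment (a : ℝ) (b : WithTop ℝ) (ca cb : Bool) :
    (segment a b ca cb).OrdConnected := by
  refine ⟨fun x hx y hy z hz ↦ ⟨isUpperSet_upRay a ca hz.1 hx.1, ?_⟩⟩
  rcases hz.2.lt_or_eq with h | rfl
  · refine Or.inl ((WithTop.coe_lt_coe.2 h).trans_le ?_)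
    rcases hy.2 with h' | ⟨-, h'⟩
    · exact h'.le
    · exact h'.le
  · exact hy.2

lemma ordConnected_prod {X Y : Set ℝ} (hX : X.OrdConnected) (hY : Y.OrdConnected) :
    (X ×ˢ Y).OrdConnected :=
  ⟨fun _ hp _ hq _ hz ↦ ⟨hX.out hp.1 hq.1 ⟨hz.1.1, hz.2.1⟩, hY.out hp.2 hq.2 ⟨hz.1.2, hz.2.2⟩⟩⟩

lemma isMVFamily_birth (j : ℤ) (a b : ℝ) (ca cb : Bool) (hab : a + b ≤ 0) :
    IsMVFamily (single j (Block.birth a b ca cb).toSet) := by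
  refine isMVFamily_single j _ (ordConnected_prod (ordConnected_upRay a ca) (ordConnected_upRay b cb))
    fun s p ↦ ?_
  have hx : p.1.1 ∈ upRay a ca → p.1.1 + s.1.1 ∈ upRay a ca := fun h ↦
    isUpperSet_upRay a ca (le_add_of_nonneg_right s.1.1.coe_nonneg) h
  have hy : p.1.2 ∈ upRay b cb → p.1.2 + s.1.2 ∈ upRay b cb := fun h ↦
    isUpperSet_upRay b cb (le_add_of_nonneg_right s.1.2.coe_nonneg) h
  have hp : p.1.1 ∈ upRay a ca ∨ p.1.2 ∈ upRay b cb := by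
    have := p.2
    rcases lt_or_ge a p.1.1 with h | h
    · exact Or.inl (Or.inl h)
    · exact Or.inr (Or.inl (by linarith))
  change (p.1.1 ∈ upRay a ca ∧ p.1.2 ∈ upRay b cb →
      (p.1.1 + s.1.1 ∈ upRay a ca ∧ p.1.2 + (0 : ℝ) ∈ upRay b cb) ∨
      (p.1.1 + (0 : ℝ) ∈ upRay a ca ∧ p.1.2 + s.1.2 ∈ upRay b cb)) ∧
    (p.1.1 + s.1.1 ∈ upRay a ca ∧ p.1.2 + s.1.2 ∈ upRay b cb →
      (p.1.1 + s.1.1 ∈ upRay a ca ∧ p.1.2 + (0 : ℝ) ∈ upRay b cb) ∨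
      (p.1.1 + (0 : ℝ) ∈ upRay a ca ∧ p.1.2 + s.1.2 ∈ upRay b cb)) ∧
    (p.1.1 + s.1.1 ∈ upRay a ca ∧ p.1.2 + (0 : ℝ) ∈ upRay b cb →
      p.1.1 + (0 : ℝ) ∈ upRay a ca ∧ p.1.2 + s.1.2 ∈ upRay b cb →
      (p.1.1 ∈ upRay a ca ∧ p.1.2 ∈ upRay b cb) ∧
      (p.1.1 + s.1.1 ∈ upRay a ca ∧ p.1.2 + s.1.2 ∈ upRay b cb)) ∧
    (p.1.1 + s.1.1 ∈ upRay a ca ∧ p.1.2 + (0 : ℝ) ∈ upRay b cb →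
      ¬ (p.1.1 + (0 : ℝ) ∈ upRay a ca ∧ p.1.2 + s.1.2 ∈ upRay b cb) →
      (p.1.1 ∈ upRay a ca ∧ p.1.2 ∈ upRay b cb ↔
        ¬ (p.1.1 + s.1.1 ∈ upRay a ca ∧ p.1.2 + s.1.2 ∈ upRay b cb))) ∧
    (p.1.1 + (0 : ℝ) ∈ upRay a ca ∧ p.1.2 + s.1.2 ∈ upRay b cb →
      ¬ (p.1.1 + s.1.1 ∈ upRay a ca ∧ p.1.2 + (0 : ℝ) ∈ upRay b cb) →
      (p.1.1 ∈ upRay a ca ∧ p.1.2 ∈ upRay b cb ↔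
        ¬ (p.1.1 + s.1.1 ∈ upRay a ca ∧ p.1.2 + s.1.2 ∈ upRay b cb)))
  rw [add_zero, add_zero]
  generalize (p.1.1 ∈ upRay a ca) = A, (p.1.2 ∈ upRay b cb) = B,
    (p.1.1 + s.1.1 ∈ upRay a ca) = A', (p.1.2 + s.1.2 ∈ upRay b cb) = B' at *
  by_cases A <;> by_cases B <;> by_cases A' <;> by_cases B' <;> simp_all

lemma isMVFamily_horizontal (j : ℤ) (Y : Set ℝ) (hY : Y.OrdConnected) :
    IsMVFamily (single j (Set.univ ×ˢ Y)) := by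
  refine isMVFamily_single j _ (ordConnected_prod Set.ordConnected_univ hY) fun s p ↦ ?_
  simp only [Set.mem_prod, Set.mem_univ, true_and, add_snd, PosVec.x, PosVec.y, NNReal.coe_zero,
    add_zero]
  tauto

lemma isMVFamily_vertical (j : ℤ) (X : Set ℝ) (hX : X.OrdConnected) :
    IsMVFamily (single j (X ×ˢ Set.univ)) := by
  refine isMVFamily_single j _ (ordConnected_prod hX Set.ordConnected_univ) fun s p ↦ ?_
  simp only [Set.mem_prod, Set.mem_univ, and_true, add_fst, PosVec.x, PosVec.y, NNReal.coe_zero,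
    add_zero]
  tauto

lemma isMVFamily_death (j : ℤ) (a b : ℝ) (ca cb : Bool) :
    IsMVFamily (double j (Block.death a b ca cb).toSet (Block.birth a b (!ca) (!cb)).toSet) := by
  have h (a : ℝ) (c : Bool) : upRay a (!c) = (downRay a c)ᶜ :=
    Set.ext fun x ↦ mem_upRay_not_iff a c x
  have := isMVFamily_double j _ _ (isLowerSet_downRay a ca) (isLowerSet_downRay b cb)
  rwa [← h, ← h] at this

lemma Block.isMVFamily (B : Block) (j : ℤ) : IsMVFamily (B.family j) := by
  cases B with
  | birth a b ca cb =>
    dsimp only [Block.family]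
    split_ifs with h
    · exact isMVFamily_birth j a b ca cb h
    · simpa using isMVFamily_death (j - 1) a b (!ca) (!cb)
  | plane =>
    have := isMVFamily_horizontal j Set.univ Set.ordConnected_univ
    rwa [Set.univ_prod_univ] at this
  | death a b ca cb =>
    dsimp only [Block.family]
    split_ifs with h
    · exact isMVFamily_death j a b ca cb
    · have := isMVFamily_horizontal j ∅ Set.ordConnected_empty
      have e : single j (Set.univ ×ˢ (∅ : Set ℝ)) = fun _ ↦ ∅ := by
        funext i
        exact Set.eq_empty_of_forall_notMem fun x hx ↦ hx.2.2
      rwa [e] at this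
  | horizontal a b ca cb => exact isMVFamily_horizontal j _ (ordConnected_segment a b ca cb)
  | vertical a b ca cb => exact isMVFamily_vertical j _ (ordConnected_segment a b ca cb)

/-- The Mayer-Vietoris system `S_j^B` of a block `B`. -/
def Block.system (k : Type u) [Field k] (B : Block) (j : ℤ) : MVSystem.{max u v} k :=
  familySystem.{v} k (B.family j) (B.isMVFamily j)

/-! ### The blocks attached to an interval

For an interval `⟨a, b⟩`, there is a unique death block with `a + b > 0`, a unique vertical, a unique
horizontal and a unique birth block whose intersection with the antidiagonal
`{(-t, t)}` is mapped to `⟨a, b⟩` by the second projection. -/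

/-- The image under the second projection of the intersection of a block with the
antidiagonal. -/
def Block.trace (B : Block) : Set ℝ := {t | ((-t, t) : ℝ × ℝ) ∈ B.toSet}

/-- The bounded interval `⟨a, b⟩`; `ca` and `cb` say whether it contains its end points. -/
def interval (a b : ℝ) (ca cb : Bool) : Set ℝ := upRay a ca ∩ downRay b cb

/-- The death block `B_d^{⟨a, b⟩} = ]-∞, -a⟩ × ]-∞, b⟩`. -/
def deathBlock (a b : ℝ) (ca cb : Bool) : Block := .death (-a) b ca cb

/-- The vertical block `B_v^{⟨a, b⟩} = ⟨-b, -a⟩ × ℝ`. -/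
def verticalBlock (a b : ℝ) (ca cb : Bool) : Block := .vertical (-b) ((-a : ℝ) : WithTop ℝ) cb ca

/-- The horizontal block `B_h^{⟨a, b⟩} = ℝ × ⟨a, b⟩`. -/
def horizontalBlock (a b : ℝ) (ca cb : Bool) : Block := .horizontal a (b : WithTop ℝ) ca cb

/-- The birth block `B_b^{⟨a, b⟩} = ⟨-b, ∞[ × ⟨a, ∞[`. -/
def birthBlock (a b : ℝ) (ca cb : Bool) : Block := .birth (-b) a cb ca

lemma neg_mem_upRay (a t : ℝ) (c : Bool) : -t ∈ upRay (-a) c ↔ t ∈ downRay a c := by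
  change (-a < -t ∨ (c = true ∧ -t = -a)) ↔ (t < a ∨ (c = true ∧ t = a))
  rw [neg_lt_neg_iff, neg_inj]

lemma neg_mem_downRay (a t : ℝ) (c : Bool) : -t ∈ downRay (-a) c ↔ t ∈ upRay a c := by
  change (-t < -a ∨ (c = true ∧ -t = -a)) ↔ (a < t ∨ (c = true ∧ t = a))
  rw [neg_lt_neg_iff, neg_inj]

lemma mem_segment_coe (a b t : ℝ) (ca cb : Bool) :
    t ∈ segment a (b : WithTop ℝ) ca cb ↔ t ∈ upRay a ca ∧ t ∈ downRay b cb := by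
  change (t ∈ upRay a ca ∧ ((t : WithTop ℝ) < b ∨ (cb = true ∧ (t : WithTop ℝ) = b))) ↔ _
  rw [WithTop.coe_lt_coe, WithTop.coe_eq_coe]
  rfl

lemma trace_deathBlock (a b : ℝ) (ca cb : Bool) :
    (deathBlock a b ca cb).trace = interval a b ca cb :=
  Set.ext fun t ↦ and_congr (neg_mem_downRay a t ca) Iff.rfl

lemma trace_verticalBlock (a b : ℝ) (ca cb : Bool) :
    (verticalBlock a b ca cb).trace = interval a b ca cb := Set.ext fun t ↦ by
  change -t ∈ segment (-b) ((-a : ℝ) : WithTop ℝ) cb ca ∧ True ↔ t ∈ upRay a ca ∧ t ∈ downRay b cb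
  rw [mem_segment_coe, neg_mem_upRay, neg_mem_downRay, and_true, and_comm]

lemma trace_horizontalBlock (a b : ℝ) (ca cb : Bool) :
    (horizontalBlock a b ca cb).trace = interval a b ca cb := Set.ext fun t ↦ by
  change True ∧ t ∈ segment a (b : WithTop ℝ) ca cb ↔ t ∈ upRay a ca ∧ t ∈ downRay b cb
  rw [mem_segment_coe, true_and]

lemma trace_birthBlock (a b : ℝ) (ca cb : Bool) :
    (birthBlock a b ca cb).trace = interval a b ca cb := Set.ext fun t ↦ by
  change -t ∈ upRay (-b) cb ∧ t ∈ upRay a ca ↔ t ∈ upRay a ca ∧ t ∈ downRay b cb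
  rw [neg_mem_upRay, and_comm]

/-! ### Sheaves on `ℝ` and hypercohomology -/

instance instPresFilt (k : Type u) [Field k] :
    PreservesFilteredColimitsOfSize.{0, 0} (forget (ModuleCat.{u} k)) :=
  preservesFilteredColimitsOfSize_shrink.{0, u, 0, u} (forget (ModuleCat.{u} k))

/-- The category of sheaves of `k`-vector spaces on `ℝ`. -/
abbrev ShR (k : Type u) [Field k] := Sheaf (Opens.grothendieckTopology ℝ) (ModuleCat.{u} k)

section
variable (k : Type u) [Field k]

/-- The sheaf `k_U` of an open subset `U` of `ℝ` (the constant sheaf on `U` extended by zero), as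
the sheafification of the presheaf which is free on `Hom(-, U)`; it is characterized by
`Hom(k_U, F) = F(U)`. -/
def freeSheaf : Opens ℝ ⥤ ShR k :=
  uliftYoneda.{u} ⋙ (Functor.whiskeringRight _ _ _).obj (ModuleCat.free k) ⋙
    presheafToSheaf (Opens.grothendieckTopology ℝ) (ModuleCat.{u} k)

/-- `Hom(k_U, F) = F(U)`. -/
def freeSheafHomEquiv (U : Opens ℝ) (F : ShR k) :
    ((freeSheaf k).obj U ⟶ F) ≃ F.obj.obj (op U) :=
  ((sheafificationAdjunction (Opens.grothendieckTopology ℝ) (ModuleCat.{u} k)).homEquiv _ _).trans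
    ((((ModuleCat.adj k).whiskerRight (Opens ℝ)ᵒᵖ).homEquiv (uliftYoneda.{u}.obj U) F.obj).trans
      uliftYonedaEquiv)

lemma freeSheafHomEquiv_naturality {U V : Opens ℝ} (f : U ⟶ V) (F : ShR k)
    (g : (freeSheaf k).obj V ⟶ F) :
    freeSheafHomEquiv k U F ((freeSheaf k).map f ≫ g) =
      F.obj.map f.op (freeSheafHomEquiv k V F g) := by
  have h₁ := (sheafificationAdjunction (Opens.grothendieckTopology ℝ)
    (ModuleCat.{u} k)).homEquiv_naturality_left
      (Functor.whiskerRight (uliftYoneda.{u}.map f) (ModuleCat.free k)) g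
  have h₂ := ((ModuleCat.adj k).whiskerRight (Opens ℝ)ᵒᵖ).homEquiv_naturality_left
    (uliftYoneda.{u}.map f) (((sheafificationAdjunction (Opens.grothendieckTopology ℝ)
      (ModuleCat.{u} k)).homEquiv _ _) g)
  exact (congrArg (fun t ↦ uliftYonedaEquiv.{u} (((ModuleCat.adj k).whiskerRight
    (Opens ℝ)ᵒᵖ).homEquiv (uliftYoneda.{u}.obj U) F.obj t)) h₁).trans
    ((congrArg (fun t ↦ uliftYonedaEquiv.{u} t) h₂).trans
      (uliftYonedaEquiv_naturality (F := F.obj ⋙ forget (ModuleCat.{u} k)) _ f.op).symm)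

lemma freeSheaf_isPushout {U₁ U₂ U₃ U₄ : Opens ℝ} (h₁ : U₁ = U₂ ⊓ U₃) (h₄ : U₄ = U₂ ⊔ U₃)
    (a : U₁ ⟶ U₂) (b : U₁ ⟶ U₃) (c : U₂ ⟶ U₄) (d : U₃ ⟶ U₄) :
    IsPushout ((freeSheaf k).map a) ((freeSheaf k).map b)
      ((freeSheaf k).map c) ((freeSheaf k).map d) := by
  have huniq : ∀ (F : ShR k) (s t : F.obj.obj (op U₄)), F.obj.map c.op s = F.obj.map c.op t →
      F.obj.map d.op s = F.obj.map d.op t → s = t := fun F s t ↦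
    TopCat.Sheaf.eq_of_locally_eq₂ (X := TopCat.of ℝ) F c d h₄.le s t
  have hglue : ∀ (F : ShR k) (s : F.obj.obj (op U₂)) (t : F.obj.obj (op U₃)),
      F.obj.map a.op s = F.obj.map b.op t →
      ∃ r : F.obj.obj (op U₄), F.obj.map c.op r = s ∧ F.obj.map d.op r = t := by
    intro F s t hst
    let U : Bool → Opens ℝ := fun i ↦ match i with | true => U₂ | false => U₃
    obtain ⟨r, hr, -⟩ := TopCat.Sheaf.existsUnique_gluing' (X := TopCat.of ℝ) F U U₄
      (fun i ↦ match i with | true => c | false => d)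
      (by subst h₄; exact sup_le (le_iSup U true) (le_iSup U false))
      (fun i ↦ match i with | true => s | false => t) (by
        subst h₁
        rintro (_ | _) (_ | _)
        · rfl
        · have := congrArg (F.obj.map (homOfLE (inf_comm U₃ U₂).le : U₃ ⊓ U₂ ⟶ U₂ ⊓ U₃).op) hst
          simp only [← ConcreteCategory.comp_apply, ← Functor.map_comp] at this
          exact this.symm
        · exact hst
        · rfl)
    exact ⟨r, hr true, hr false⟩
  have hcomm : a ≫ c = b ≫ d := rfl
  have hcond : ∀ s : PushoutCocone ((freeSheaf k).map a) ((freeSheaf k).map b),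
      s.pt.obj.map a.op (freeSheafHomEquiv k U₂ s.pt s.inl) =
        s.pt.obj.map b.op (freeSheafHomEquiv k U₃ s.pt s.inr) := fun s ↦ by
    rw [← freeSheafHomEquiv_naturality, ← freeSheafHomEquiv_naturality, s.condition]
  choose r hr using fun s ↦ hglue s.pt _ _ (hcond s)
  refine ⟨⟨by rw [← Functor.map_comp, ← Functor.map_comp, hcomm]⟩, ⟨PushoutCocone.IsColimit.mk _
    (fun s ↦ (freeSheafHomEquiv k U₄ s.pt).symm (r s)) ?_ ?_ ?_⟩⟩
  · intro s
    apply (freeSheafHomEquiv k U₂ s.pt).injective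
    rw [freeSheafHomEquiv_naturality, Equiv.apply_symm_apply]
    exact (hr s).1
  · intro s
    apply (freeSheafHomEquiv k U₃ s.pt).injective
    rw [freeSheafHomEquiv_naturality, Equiv.apply_symm_apply]
    exact (hr s).2
  · intro s m h₂ h₃
    apply (freeSheafHomEquiv k U₄ s.pt).injective
    rw [Equiv.apply_symm_apply]
    apply huniq
    · rw [(hr s).1, ← freeSheafHomEquiv_naturality, h₂]
    · rw [(hr s).2, ← freeSheafHomEquiv_naturality, h₃]

instance : (ModuleCat.free k).PreservesMonomorphisms where
  preserves {X Y} f hf := by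
    rw [ModuleCat.mono_iff_injective]
    rw [mono_iff_injective] at hf
    exact Finsupp.mapDomain_injective hf

lemma freeSheaf_mono {U V : Opens ℝ} (f : U ⟶ V) : Mono ((freeSheaf k).map f) := by
  have : Mono (uliftYoneda.{u}.map f) := inferInstance
  dsimp [freeSheaf]
  have : Mono (Functor.whiskerRight (uliftYoneda.{u}.map f) (ModuleCat.free k)) := inferInstance
  infer_instance


/-- A covering of an open subset `U₄` of `ℝ` by two open subsets `U₂` and `U₃` with intersection
`U₁`. -/
structure Cover where
  /-- the intersection -/
  U₁ : Opens ℝ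
  /-- the first open subset -/
  U₂ : Opens ℝ
  /-- the second open subset -/
  U₃ : Opens ℝ
  /-- the union -/
  U₄ : Opens ℝ
  inf_eq : U₁ = U₂ ⊓ U₃
  sup_eq : U₄ = U₂ ⊔ U₃

namespace Cover

lemma le₁₂ (Q : Cover) : Q.U₁ ≤ Q.U₂ := Q.inf_eq.le.trans inf_le_left
lemma le₁₃ (Q : Cover) : Q.U₁ ≤ Q.U₃ := Q.inf_eq.le.trans inf_le_right
lemma le₂₄ (Q : Cover) : Q.U₂ ≤ Q.U₄ := le_sup_left.trans Q.sup_eq.ge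
lemma le₃₄ (Q : Cover) : Q.U₃ ≤ Q.U₄ := le_sup_right.trans Q.sup_eq.ge

end Cover

/-- The morphism `k_U ⟶ k_V` for `U ⊆ V`. -/
abbrev freeSheafMap {U V : Opens ℝ} (h : U ≤ V) : (freeSheaf k).obj U ⟶ (freeSheaf k).obj V :=
  (freeSheaf k).map (homOfLE h)

lemma freeSheafMap_comp {U V W : Opens ℝ} (h : U ≤ V) (h' : V ≤ W) :
    freeSheafMap k h ≫ freeSheafMap k h' = freeSheafMap k (h.trans h') :=
  ((freeSheaf k).map_comp _ _).symm

/-- The Mayer-Vietoris sequence `k_{U₁} ⟶ k_{U₂} ⊕ k_{U₃} ⟶ k_{U₄}` of a covering. -/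
abbrev Cover.complex (Q : Cover) : ShortComplex (ShR k) where
  X₁ := (freeSheaf k).obj Q.U₁
  X₂ := (freeSheaf k).obj Q.U₂ ⊞ (freeSheaf k).obj Q.U₃
  X₃ := (freeSheaf k).obj Q.U₄
  f := biprod.lift (freeSheafMap k Q.le₁₂) (-freeSheafMap k Q.le₁₃)
  g := biprod.desc (freeSheafMap k Q.le₂₄) (freeSheafMap k Q.le₃₄)
  zero := by
    rw [biprod.lift_desc, Preadditive.neg_comp, freeSheafMap_comp, freeSheafMap_comp,
      add_neg_cancel]

lemma Cover.shortExact (Q : Cover) : (Q.complex k).ShortExact := by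
  have hp := freeSheaf_isPushout k Q.inf_eq Q.sup_eq (homOfLE Q.le₁₂) (homOfLE Q.le₁₃)
    (homOfLE Q.le₂₄) (homOfLE Q.le₃₄)
  have hQ : IsColimit (CokernelCofork.ofπ (Q.complex k).g (Q.complex k).zero) :=
    CokernelCofork.IsColimit.ofπ _ _
      (fun x hx ↦ hp.desc (biprod.inl ≫ x) (biprod.inr ≫ x) (by
        have hx' : biprod.lift (freeSheafMap k Q.le₁₂) (-freeSheafMap k Q.le₁₃) ≫ x = 0 := hx
        have : x = biprod.desc (biprod.inl ≫ x) (biprod.inr ≫ x) := by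
          apply biprod.hom_ext' <;> simp
        rw [this, biprod.lift_desc, Preadditive.neg_comp, add_neg_eq_zero] at hx'
        exact hx'))
      (fun x hx ↦ biprod.hom_ext' _ _
        ((biprod.inl_desc_assoc _ _ _).trans (hp.inl_desc _ _ _))
        ((biprod.inr_desc_assoc _ _ _).trans (hp.inr_desc _ _ _)))
      (fun x hx m hm ↦ by
        subst hm
        apply hp.hom_ext
        · exact ((hp.inl_desc _ _ _).trans (biprod.inl_desc_assoc _ _ _)).symm
        · exact ((hp.inr_desc _ _ _).trans (biprod.inr_desc_assoc _ _ _)).symm)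
  obtain ⟨h₁, h₂⟩ := (ShortComplex.exact_and_epi_g_iff_g_is_cokernel _).2 ⟨hQ⟩
  have : Mono (freeSheafMap k Q.le₁₂) := freeSheaf_mono k _
  have : Mono ((Q.complex k).f ≫ biprod.fst) := by
    have h : (Q.complex k).f ≫ biprod.fst = freeSheafMap k Q.le₁₂ := biprod.lift_fst _ _
    rwa [h]
  exact { exact := h₁, mono_f := mono_of_mono _ biprod.fst, epi_g := h₂ }

/-- The morphism between Mayer-Vietoris sequences induced by inclusions of coverings. -/
def Cover.complexMap {Q R : Cover} (h₁ : Q.U₁ ≤ R.U₁) (h₂ : Q.U₂ ≤ R.U₂) (h₃ : Q.U₃ ≤ R.U₃)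
    (h₄ : Q.U₄ ≤ R.U₄) : Q.complex k ⟶ R.complex k where
  τ₁ := freeSheafMap k h₁
  τ₂ := biprod.map (freeSheafMap k h₂) (freeSheafMap k h₃)
  τ₃ := freeSheafMap k h₄
  comm₁₂ := by
    dsimp only [Cover.complex]
    apply biprod.hom_ext
    · simp only [Category.assoc, biprod.lift_fst, biprod.map_fst, biprod.lift_fst_assoc,
        freeSheafMap_comp]
    · simp only [Category.assoc, biprod.lift_snd, biprod.map_snd, biprod.lift_snd_assoc,
        freeSheafMap_comp, Preadditive.neg_comp, Preadditive.comp_neg]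
  comm₂₃ := by
    dsimp only [Cover.complex]
    apply biprod.hom_ext'
    · simp only [biprod.inl_map_assoc, biprod.inl_desc, biprod.inl_desc_assoc, freeSheafMap_comp]
    · simp only [biprod.inr_map_assoc, biprod.inr_desc, biprod.inr_desc_assoc, freeSheafMap_comp]

section Cohomology

variable {k} [HasDerivedCategory.{w} (ShR k)] (F : DerivedCategory (ShR k))

/-- The sheaf `k_U` as an object of the derived category. -/
abbrev freeObj (k : Type u) [Field k] [HasDerivedCategory.{w} (ShR k)] (U : Opens ℝ) :
    DerivedCategory (ShR k) :=
  (DerivedCategory.singleFunctor (ShR k) 0).obj ((freeSheaf k).obj U)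

/-- `k_U ⟶ k_V` in the derived category. -/
abbrev freeObjMap (k : Type u) [Field k] [HasDerivedCategory.{w} (ShR k)] {U V : Opens ℝ}
    (h : U ≤ V) : freeObj k U ⟶ freeObj k V :=
  (DerivedCategory.singleFunctor (ShR k) 0).map (freeSheafMap k h)

lemma freeObjMap_comp {U V W : Opens ℝ} (h : U ≤ V) (h' : V ≤ W) :
    freeObjMap k h ≫ freeObjMap k h' = freeObjMap k (h.trans h') := by
  rw [← Functor.map_comp, freeSheafMap_comp]

/-- The hypercohomology `H^n(U, F) = H^n(RΓ(U, F)) = Hom(k_U, F[n])`, with morphisms taken in the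
derived category. -/
abbrev Cohomology (n : ℤ) (U : Opens ℝ) : Type w := ShiftedHom (freeObj k U) F n

/-- The restriction map `H^n(V, F) ⟶ H^n(U, F)` for `U ⊆ V`. -/
def restrict (n : ℤ) {U V : Opens ℝ} (h : U ≤ V) : Cohomology F n V →ₗ[k] Cohomology F n U :=
  Linear.leftComp k _ (freeObjMap k h)

lemma restrict_apply (n : ℤ) {U V : Opens ℝ} (h : U ≤ V) (α : Cohomology F n V) :
    restrict F n h α = freeObjMap k h ≫ α := rfl

lemma restrict_comp (n : ℤ) {U V W : Opens ℝ} (h : U ≤ V) (h' : V ≤ W) :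
    restrict F n h ∘ₗ restrict F n h' = restrict F n (h.trans h') := by
  ext α
  rw [LinearMap.comp_apply, restrict_apply, restrict_apply, restrict_apply, ← Category.assoc,
    freeObjMap_comp]

lemma restrict_self (n : ℤ) (U : Opens ℝ) : restrict F n (le_refl U) = LinearMap.id := by
  ext α
  have : freeObjMap k (le_refl U) = 𝟙 _ := by
    have : freeSheafMap k (le_refl U) = 𝟙 _ := (freeSheaf k).map_id U
    rw [freeObjMap, this, CategoryTheory.Functor.map_id]
  rw [restrict_apply, this, Category.id_comp]
  rfl

/-- The connecting map `H^n(U₁, F) ⟶ H^{n+1}(U₄, F)` of the Mayer-Vietoris long exact sequence of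
a covering `U₄ = U₂ ∪ U₃`, `U₁ = U₂ ∩ U₃`, that is, the composition with the connecting morphism
`k_{U₄} ⟶ k_{U₁}[1]` of the short exact sequence `0 ⟶ k_{U₁} ⟶ k_{U₂} ⊕ k_{U₃} ⟶ k_{U₄} ⟶ 0`. -/
def Cover.connecting (Q : Cover) (n : ℤ) :
    Cohomology F n Q.U₁ →ₗ[k] Cohomology F (n + 1) Q.U₄ where
  toFun α := ShiftedHom.comp (Q.shortExact k).singleδ α rfl
  map_add' _ _ := ShiftedHom.comp_add _ _ _ _
  map_smul' _ _ := ShiftedHom.comp_smul _ _ _ _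

lemma Cover.connecting_natural {Q R : Cover} (h₁ : Q.U₁ ≤ R.U₁) (h₂ : Q.U₂ ≤ R.U₂)
    (h₃ : Q.U₃ ≤ R.U₃) (h₄ : Q.U₄ ≤ R.U₄) (n : ℤ) :
    restrict F (n + 1) h₄ ∘ₗ R.connecting F n = Q.connecting F n ∘ₗ restrict F n h₁ := by
  ext α
  have h := (ShortComplex.ShortExact.singleTriangle.map (Q.shortExact k) (R.shortExact k)
    (Cover.complexMap k h₁ h₂ h₃ h₄)).comm₃
  change (Q.shortExact k).singleδ ≫ (freeObjMap k h₁)⟦(1 : ℤ)⟧' =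
    freeObjMap k h₄ ≫ (R.shortExact k).singleδ at h
  change freeObjMap k h₄ ≫ (R.shortExact k).singleδ ≫ α⟦(1 : ℤ)⟧' ≫ _ =
    (Q.shortExact k).singleδ ≫ (freeObjMap k h₁ ≫ α)⟦(1 : ℤ)⟧' ≫ _
  rw [Functor.map_comp_assoc, ← Category.assoc, ← h, Category.assoc]

/-- The two components of `k_{U₁} ⟶ k_{U₂} ⊕ k_{U₃}` in the derived category. -/
lemma Cover.mor₁_comp (Q : Cover) {Z : DerivedCategory (ShR k)}
    (g : (DerivedCategory.singleFunctor (ShR k) 0).obj (Q.complex k).X₂ ⟶ Z) :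
    (DerivedCategory.singleFunctor (ShR k) 0).map (Q.complex k).f ≫ g =
      freeObjMap k Q.le₁₂ ≫ (DerivedCategory.singleFunctor (ShR k) 0).map biprod.inl ≫ g -
      freeObjMap k Q.le₁₃ ≫ (DerivedCategory.singleFunctor (ShR k) 0).map biprod.inr ≫ g := by
  have h : (Q.complex k).f = freeSheafMap k Q.le₁₂ ≫ biprod.inl -
      freeSheafMap k Q.le₁₃ ≫ biprod.inr := by
    apply biprod.hom_ext
    · refine (biprod.lift_fst _ _).trans ?_
      simp
    · refine (biprod.lift_snd _ _).trans ?_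
      simp
  rw [h, Functor.map_sub, Functor.map_comp, Functor.map_comp, Preadditive.sub_comp,
    Category.assoc, Category.assoc]

lemma Cover.inl_mor₂ (Q : Cover) {Z : DerivedCategory (ShR k)} (g : freeObj k Q.U₄ ⟶ Z) :
    (DerivedCategory.singleFunctor (ShR k) 0).map biprod.inl ≫
      (DerivedCategory.singleFunctor (ShR k) 0).map (Q.complex k).g ≫ g =
      freeObjMap k Q.le₂₄ ≫ g := by
  have h : biprod.inl ≫ (Q.complex k).g = freeSheafMap k Q.le₂₄ := biprod.inl_desc _ _
  rw [← Category.assoc, ← Functor.map_comp, h]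

lemma Cover.inr_mor₂ (Q : Cover) {Z : DerivedCategory (ShR k)} (g : freeObj k Q.U₄ ⟶ Z) :
    (DerivedCategory.singleFunctor (ShR k) 0).map biprod.inr ≫
      (DerivedCategory.singleFunctor (ShR k) 0).map (Q.complex k).g ≫ g =
      freeObjMap k Q.le₃₄ ≫ g := by
  have h : biprod.inr ≫ (Q.complex k).g = freeSheafMap k Q.le₃₄ := biprod.inr_desc _ _
  rw [← Category.assoc, ← Functor.map_comp, h]

/-- Morphisms from `k_{U₂} ⊕ k_{U₃}` in the derived category. -/
lemma Cover.hom_ext₂ (Q : Cover) {Z : DerivedCategory (ShR k)}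
    {g h : (DerivedCategory.singleFunctor (ShR k) 0).obj (Q.complex k).X₂ ⟶ Z}
    (h₁ : (DerivedCategory.singleFunctor (ShR k) 0).map biprod.inl ≫ g =
      (DerivedCategory.singleFunctor (ShR k) 0).map biprod.inl ≫ h)
    (h₂ : (DerivedCategory.singleFunctor (ShR k) 0).map biprod.inr ≫ g =
      (DerivedCategory.singleFunctor (ShR k) 0).map biprod.inr ≫ h) : g = h := by
  have e : 𝟙 (Q.complex k).X₂ = biprod.fst ≫ biprod.inl + biprod.snd ≫ biprod.inr :=
    biprod.total.symm
  have e' := congrArg (DerivedCategory.singleFunctor (ShR k) 0).map e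
  rw [CategoryTheory.Functor.map_id, Functor.map_add, Functor.map_comp, Functor.map_comp] at e'
  rw [← Category.id_comp g, ← Category.id_comp h, e', Preadditive.add_comp, Preadditive.add_comp,
    Category.assoc, Category.assoc, Category.assoc, Category.assoc, h₁, h₂]

lemma Cover.exists_hom₂ (Q : Cover) {Z : DerivedCategory (ShR k)} (x : freeObj k Q.U₂ ⟶ Z)
    (y : freeObj k Q.U₃ ⟶ Z) :
    ∃ g : (DerivedCategory.singleFunctor (ShR k) 0).obj (Q.complex k).X₂ ⟶ Z,
      (DerivedCategory.singleFunctor (ShR k) 0).map biprod.inl ≫ g = x ∧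
      (DerivedCategory.singleFunctor (ShR k) 0).map biprod.inr ≫ g = y := by
  refine ⟨(DerivedCategory.singleFunctor (ShR k) 0).map biprod.fst ≫ x +
    (DerivedCategory.singleFunctor (ShR k) 0).map biprod.snd ≫ y, ?_, ?_⟩
  · rw [Preadditive.comp_add, ← Category.assoc, ← Category.assoc, ← Functor.map_comp,
      ← Functor.map_comp, biprod.inl_fst, biprod.inl_snd, CategoryTheory.Functor.map_id, Functor.map_zero,
      Category.id_comp, zero_comp, add_zero]
  · rw [Preadditive.comp_add, ← Category.assoc, ← Category.assoc, ← Functor.map_comp,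
      ← Functor.map_comp, biprod.inr_fst, biprod.inr_snd, CategoryTheory.Functor.map_id, Functor.map_zero,
      Category.id_comp, zero_comp, zero_add]

lemma Cover.connecting_eq_zero_iff (Q : Cover) (n : ℤ) (α : Cohomology F n Q.U₁) :
    Q.connecting F n α = 0 ↔ (Q.shortExact k).singleδ ≫ α⟦(1 : ℤ)⟧' = 0 := by
  change (Q.shortExact k).singleδ ≫ α⟦(1 : ℤ)⟧' ≫ _ = 0 ↔ _
  rw [← Category.assoc, Preadditive.IsIso.comp_right_eq_zero]

lemma Cover.exact₁ (Q : Cover) (n : ℤ) :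
    Function.Exact ((restrict F n Q.le₁₂).coprod (-restrict F n Q.le₁₃)) (Q.connecting F n) := by
  have hT := (Q.shortExact k).singleTriangle_distinguished
  intro α
  rw [Q.connecting_eq_zero_iff]
  constructor
  · intro hα
    obtain ⟨g, hg⟩ : ∃ g : ((DerivedCategory.singleFunctor (ShR k) 0).obj
        (Q.complex k).X₂)⟦(1 : ℤ)⟧ ⟶ (F⟦n⟧)⟦(1 : ℤ)⟧, α⟦(1 : ℤ)⟧' =
        (-((DerivedCategory.singleFunctor (ShR k) 0).map (Q.complex k).f)⟦(1 : ℤ)⟧') ≫ g :=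
      Pretriangulated.Triangle.yoneda_exact₃ _ (Pretriangulated.rot_of_distTriang _ hT) _ hα
    obtain ⟨g', rfl⟩ := (shiftFunctor (DerivedCategory (ShR k)) (1 : ℤ)).map_surjective g
    have hg' : α = (DerivedCategory.singleFunctor (ShR k) 0).map (Q.complex k).f ≫ (-g') := by
      apply (shiftFunctor (DerivedCategory (ShR k)) (1 : ℤ)).map_injective
      rw [hg, Preadditive.comp_neg, Functor.map_neg, Functor.map_comp, Preadditive.neg_comp]
    rw [Q.mor₁_comp] at hg'
    refine ⟨((DerivedCategory.singleFunctor (ShR k) 0).map biprod.inl ≫ (-g'),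
      (DerivedCategory.singleFunctor (ShR k) 0).map biprod.inr ≫ (-g')), ?_⟩
    rw [hg', LinearMap.coprod_apply, sub_eq_add_neg]
    rfl
  · rintro ⟨⟨x, y⟩, rfl⟩
    obtain ⟨g, rfl, rfl⟩ := Q.exists_hom₂ x y
    have h : (restrict F n Q.le₁₂).coprod (-restrict F n Q.le₁₃)
        ((DerivedCategory.singleFunctor (ShR k) 0).map biprod.inl ≫ g,
          (DerivedCategory.singleFunctor (ShR k) 0).map biprod.inr ≫ g) =
        (DerivedCategory.singleFunctor (ShR k) 0).map (Q.complex k).f ≫ g := by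
      rw [Q.mor₁_comp, LinearMap.coprod_apply, sub_eq_add_neg]
      rfl
    rw [h, Functor.map_comp, ← Category.assoc]
    have h₀ := Pretriangulated.comp_distTriang_mor_zero₃₁ _ hT
    change (Q.shortExact k).singleδ ≫ _ = 0 at h₀
    exact (congrArg (· ≫ g⟦(1 : ℤ)⟧') h₀).trans zero_comp

lemma Cover.exact₂ (Q : Cover) (n : ℤ) :
    Function.Exact ((restrict F n Q.le₂₄).prod (restrict F n Q.le₃₄))
      ((restrict F n Q.le₁₂).coprod (-restrict F n Q.le₁₃)) := by
  have hT := (Q.shortExact k).singleTriangle_distinguished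
  rintro ⟨x, y⟩
  obtain ⟨g, rfl, rfl⟩ := Q.exists_hom₂ x y
  have h : (restrict F n Q.le₁₂).coprod (-restrict F n Q.le₁₃)
      ((DerivedCategory.singleFunctor (ShR k) 0).map biprod.inl ≫ g,
        (DerivedCategory.singleFunctor (ShR k) 0).map biprod.inr ≫ g) =
      (DerivedCategory.singleFunctor (ShR k) 0).map (Q.complex k).f ≫ g := by
    rw [Q.mor₁_comp, LinearMap.coprod_apply, sub_eq_add_neg]
    rfl
  rw [h]
  constructor
  · intro hg
    obtain ⟨ψ, rfl⟩ := Pretriangulated.Triangle.yoneda_exact₂ _ hT g hg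
    exact ⟨ψ, Prod.ext (Q.inl_mor₂ ψ).symm (Q.inr_mor₂ ψ).symm⟩
  · rintro ⟨ψ, hψ⟩
    obtain ⟨h₁, h₂⟩ := Prod.mk.inj hψ
    have : g = (DerivedCategory.singleFunctor (ShR k) 0).map (Q.complex k).g ≫ ψ :=
      Q.hom_ext₂ (h₁.symm.trans (Q.inl_mor₂ ψ).symm) (h₂.symm.trans (Q.inr_mor₂ ψ).symm)
    rw [this, ← Category.assoc]
    exact (congrArg (· ≫ ψ) (Pretriangulated.comp_distTriang_mor_zero₁₂ _ hT)).trans zero_comp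

lemma Cover.exact₃ (Q : Cover) (n : ℤ) :
    Function.Exact (Q.connecting F n)
      ((restrict F (n + 1) Q.le₂₄).prod (restrict F (n + 1) Q.le₃₄)) := by
  have hT := (Q.shortExact k).singleTriangle_distinguished
  intro ψ
  constructor
  · intro hψ
    obtain ⟨h₁, h₂⟩ := Prod.mk.inj hψ
    have hψ' : (DerivedCategory.singleFunctor (ShR k) 0).map (Q.complex k).g ≫ ψ = 0 :=
      Q.hom_ext₂ ((Q.inl_mor₂ ψ).trans (h₁.trans comp_zero.symm))
        ((Q.inr_mor₂ ψ).trans (h₂.trans comp_zero.symm))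
    obtain ⟨g, hg⟩ : ∃ g : (freeObj k Q.U₁)⟦(1 : ℤ)⟧ ⟶ F⟦n + 1⟧,
        ψ = (Q.shortExact k).singleδ ≫ g := Pretriangulated.Triangle.yoneda_exact₃ _ hT ψ hψ'
    obtain ⟨α, hα⟩ := (shiftFunctor (DerivedCategory (ShR k)) (1 : ℤ)).map_surjective
      (g ≫ (shiftFunctorAdd' (DerivedCategory (ShR k)) n 1 (n + 1) rfl).hom.app F)
    refine ⟨α, ?_⟩
    change (Q.shortExact k).singleδ ≫ α⟦(1 : ℤ)⟧' ≫ _ = ψ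
    rw [hα, Category.assoc, Iso.hom_inv_id_app, Category.comp_id, hg]
  · rintro ⟨α, rfl⟩
    have h₀ := Pretriangulated.comp_distTriang_mor_zero₂₃ _ hT
    change (DerivedCategory.singleFunctor (ShR k) 0).map (Q.complex k).g ≫
      (Q.shortExact k).singleδ = 0 at h₀
    refine Prod.ext ?_ ?_
    · refine (Q.inl_mor₂ _).symm.trans ?_
      change _ ≫ _ ≫ (Q.shortExact k).singleδ ≫ _ = 0
      rw [reassoc_of% h₀, zero_comp, comp_zero]
    · refine (Q.inr_mor₂ _).symm.trans ?_
      change _ ≫ _ ≫ (Q.shortExact k).singleδ ≫ _ = 0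
      rw [reassoc_of% h₀, zero_comp, comp_zero]

end Cohomology
end

section Dual

variable {k : Type u} [Field k] {V₁ V₂ V₃ V₄ : Type*} [AddCommGroup V₁] [AddCommGroup V₂]
  [AddCommGroup V₃] [AddCommGroup V₄] [Module k V₁] [Module k V₂] [Module k V₃] [Module k V₄]

lemma exact_dualMap {f : V₁ →ₗ[k] V₂} {g : V₂ →ₗ[k] V₃} (h : Function.Exact f g) :
    Function.Exact g.dualMap f.dualMap := by
  rw [LinearMap.exact_iff] at h ⊢
  rw [LinearMap.ker_dualMap_eq_dualAnnihilator_range, LinearMap.range_dualMap_eq_dualAnnihilator_ker,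
    h]

lemma exact_dual_first {f : V₂ →ₗ[k] V₁} {g : V₃ →ₗ[k] V₁} {d : V₁ →ₗ[k] V₄}
    (h : Function.Exact (f.coprod (-g)) d) :
    Function.Exact d.dualMap (f.dualMap.prod (-g.dualMap)) := by
  intro φ
  rw [← exact_dualMap h φ]
  constructor
  · intro hφ
    have h₁ : φ ∘ₗ f = 0 := congrArg Prod.fst hφ
    have h₂ : -(φ ∘ₗ g) = 0 := congrArg Prod.snd hφ
    ext x
    · simpa using LinearMap.congr_fun h₁ x
    · simpa using LinearMap.congr_fun h₂ x
  · intro hφ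
    refine Prod.ext (LinearMap.ext fun x ↦ ?_) (LinearMap.ext fun x ↦ ?_)
    · simpa using LinearMap.congr_fun hφ (x, 0)
    · simpa using LinearMap.congr_fun hφ (0, x)

lemma exact_dual_middle {f : V₂ →ₗ[k] V₁} {g : V₃ →ₗ[k] V₁} {f' : V₄ →ₗ[k] V₂} {g' : V₄ →ₗ[k] V₃}
    (h : Function.Exact (f'.prod g') (f.coprod (-g))) :
    Function.Exact (f.dualMap.prod (-g.dualMap)) (f'.dualMap.coprod g'.dualMap) := by
  rintro ⟨φ, ψ⟩
  have := exact_dualMap h (φ.coprod ψ)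
  constructor
  · intro hφ
    obtain ⟨χ, hχ⟩ := this.1 (LinearMap.ext fun x ↦ LinearMap.congr_fun hφ x)
    refine ⟨χ, Prod.ext (LinearMap.ext fun x ↦ ?_) (LinearMap.ext fun x ↦ ?_)⟩
    · simpa using LinearMap.congr_fun hχ (x, 0)
    · simpa using LinearMap.congr_fun hχ (0, x)
  · rintro ⟨χ, hχ⟩
    obtain ⟨rfl, rfl⟩ := Prod.mk.inj hχ
    ext x
    have := congrArg χ (h.apply_apply_eq_zero x)
    simpa using this

lemma exact_dual_second {f : V₄ →ₗ[k] V₂} {g : V₄ →ₗ[k] V₃} {d : V₁ →ₗ[k] V₄}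
    (h : Function.Exact d (f.prod g)) :
    Function.Exact (f.dualMap.coprod g.dualMap) d.dualMap := by
  intro φ
  rw [exact_dualMap h φ]
  constructor
  · rintro ⟨χ, rfl⟩
    refine ⟨(χ ∘ₗ LinearMap.inl k _ _, χ ∘ₗ LinearMap.inr k _ _), ?_⟩
    ext x
    simp [← map_add]
  · rintro ⟨⟨χ, χ'⟩, rfl⟩
    exact ⟨χ.coprod χ', by ext x; simp⟩

end Dual


/-! ### The functor `Ψ` -/

section Psi

variable {k : Type u} [Field k]

/-- The open interval `]-x, y[` attached to the point `(x, y)` of `Δ⁺`. -/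
def window (p : DeltaPlus) : Opens ℝ := ⟨Set.Ioo (-p.1.1) p.1.2, isOpen_Ioo⟩

lemma window_mono {p q : DeltaPlus} (h : p ≤ q) : window p ≤ window q :=
  Set.Ioo_subset_Ioo (neg_le_neg h.1) h.2

/-- The covering `]-x - s₁, y + s₂[ = ]-x - s₁, y[ ∪ ]-x, y + s₂[`, with intersection
`]-x, y[`. -/
def windowCover (p : DeltaPlus) (s : PosVec) : Cover where
  U₁ := window p
  U₂ := window (p.add s.x)
  U₃ := window (p.add s.y)
  U₄ := window (p.add s.1)
  inf_eq := by
    ext t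
    change (-p.1.1 < t ∧ t < p.1.2) ↔
      (-(p.1.1 + s.1.1) < t ∧ t < p.1.2 + (0 : ℝ)) ∧ -(p.1.1 + (0 : ℝ)) < t ∧ t < p.1.2 + s.1.2
    have h₁ : (0 : ℝ) < s.1.1 := s.2.1
    have h₂ : (0 : ℝ) < s.1.2 := s.2.2
    constructor
    · rintro ⟨h, h'⟩
      refine ⟨⟨?_, ?_⟩, ?_, ?_⟩ <;> linarith
    · rintro ⟨⟨-, h⟩, h', -⟩
      constructor <;> linarith
  sup_eq := by
    ext t
    change (-(p.1.1 + s.1.1) < t ∧ t < p.1.2 + s.1.2) ↔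
      (-(p.1.1 + s.1.1) < t ∧ t < p.1.2 + (0 : ℝ)) ∨ -(p.1.1 + (0 : ℝ)) < t ∧ t < p.1.2 + s.1.2
    have h₁ : (0 : ℝ) < s.1.1 := s.2.1
    have h₂ : (0 : ℝ) < s.1.2 := s.2.2
    have hp := p.2
    constructor
    · rintro ⟨h, h'⟩
      rcases lt_or_ge t p.1.2 with h'' | h''
      · exact Or.inl ⟨h, by linarith⟩
      · exact Or.inr ⟨by linarith, h'⟩
    · rintro (⟨h, h'⟩ | ⟨h, h'⟩)
      · exact ⟨h, by linarith⟩
      · exact ⟨by linarith, h'⟩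

variable [HasDerivedCategory.{w} (ShR k)] (F : DerivedCategory (ShR k))

/-- The persistence module `Ψ(F)_n`, with value the dual space of `H^n(]-x, y[, F)` at `(x, y)`
and structure maps dual to the restriction maps. -/
def psiObj (n : ℤ) : Pers.{max u w} k where
  obj p := ModuleCat.of k (Module.Dual k (Cohomology F n (window p)))
  map f := ModuleCat.ofHom (restrict F n (window_mono (leOfHom f))).dualMap
  map_id p := by
    rw [restrict_self, LinearMap.dualMap_id]
    rfl
  map_comp f g := by
    rw [← ModuleCat.ofHom_comp, LinearMap.dualMap_comp_dualMap, restrict_comp]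

/-- The Mayer-Vietoris system `Ψ(F)`: the connecting morphism `Ψ(F)_{n+1}[s] ⟶ Ψ(F)_n` at `(x, y)`
is dual to the Mayer-Vietoris connecting map `H^n(]-x, y[, F) ⟶ H^{n+1}(]-x - s₁, y + s₂[, F)`. -/
def psi : MVSystem.{max u w} k where
  obj n := psiObj F n
  δ n s :=
    { app := fun p ↦ ModuleCat.ofHom ((windowCover p s).connecting F n).dualMap
      naturality := fun p q f ↦ by
        have h := leOfHom f
        have e := Cover.connecting_natural F (Q := windowCover p s) (R := windowCover q s)
          (window_mono h) (window_mono (DeltaPlus.add_le_add h le_rfl))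
          (window_mono (DeltaPlus.add_le_add h le_rfl))
          (window_mono (DeltaPlus.add_le_add h le_rfl)) n
        have e' := congrArg LinearMap.dualMap e
        rw [← LinearMap.dualMap_comp_dualMap, ← LinearMap.dualMap_comp_dualMap] at e'
        exact ModuleCat.hom_ext e' }
  exact_first n s p := exact_dual_first ((windowCover p s).exact₁ F n)
  exact_middle n s p := exact_dual_middle ((windowCover p s).exact₂ F n)
  exact_second n s p := exact_dual_second ((windowCover p s).exact₃ F n)
  δ_comp n s t h := by
    refine NatTrans.ext (funext fun p ↦ ModuleCat.hom_ext ?_)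
    have e := Cover.connecting_natural F (Q := windowCover p s) (R := windowCover p t)
      (le_refl (windowCover p s).U₁)
      (window_mono (DeltaPlus.add_le_add le_rfl ⟨h.1, le_rfl⟩))
      (window_mono (DeltaPlus.add_le_add le_rfl ⟨le_rfl, h.2⟩))
      (window_mono (DeltaPlus.add_le_add (le_refl p) h)) n
    have e₁ : restrict F n (le_refl (windowCover p s).U₁) = LinearMap.id := restrict_self F n _
    have e₂ := e.trans ((congrArg (Cover.connecting F (windowCover p s) n ∘ₗ ·) e₁).trans
      (LinearMap.comp_id _))
    have e' := congrArg LinearMap.dualMap e₂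
    rw [← LinearMap.dualMap_comp_dualMap] at e'
    exact e'

end Psi

/-! ### The sheaves `k_Z` -/

section IntervalSheaf

variable (k : Type u) [Field k]

/-- The sections over `U` of the sheaf `k_Z`, for a locally closed subset `Z` of `ℝ`: functions
`f : U → k` which vanish outside of `Z`, such that every point `x` of `U` has a neighbourhood on
which `f = f x` at the points of `Z`. In other words, `f` is locally constant on `U ∩ Z` and, as
`f x = 0` if `x ∉ Z`, its support is closed in `U`. This is the extension by zero `j_! k` of the
constant sheaf on `Z` along the inclusion `j : Z → ℝ`. -/
def extSections (Z : Set ℝ) (U : Opens ℝ) : Submodule k (U → k) where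
  carrier := {f | ∀ x : U, ((x : ℝ) ∉ Z → f x = 0) ∧ ∀ᶠ y : U in 𝓝 x, (y : ℝ) ∈ Z → f y = f x}
  add_mem' {f g} hf hg x := by
    refine ⟨fun h ↦ ?_, ?_⟩
    · rw [Pi.add_apply, (hf x).1 h, (hg x).1 h, add_zero]
    · filter_upwards [(hf x).2, (hg x).2] with y h₁ h₂ hy
      rw [Pi.add_apply, Pi.add_apply, h₁ hy, h₂ hy]
  zero_mem' x := ⟨fun _ ↦ rfl, Filter.Eventually.of_forall fun _ _ ↦ rfl⟩
  smul_mem' c f hf x := by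
    refine ⟨fun h ↦ ?_, ?_⟩
    · rw [Pi.smul_apply, (hf x).1 h, smul_zero]
    · filter_upwards [(hf x).2] with y h₁ hy
      rw [Pi.smul_apply, Pi.smul_apply, h₁ hy]

lemma extSections_restrict (Z : Set ℝ) {U V : Opens ℝ} (h : U ≤ V) {f : V → k}
    (hf : f ∈ extSections k Z V) : (fun x : U ↦ f ⟨x, h x.2⟩) ∈ extSections k Z U := fun x ↦ by
  have hc : Continuous fun x : U ↦ (⟨x, h x.2⟩ : V) := continuous_subtype_val.subtype_mk _
  exact ⟨(hf ⟨x, h x.2⟩).1, hc.continuousAt.eventually (hf ⟨x, h x.2⟩).2⟩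

/-- The presheaf of sections of `k_Z`, with the restriction of functions as restriction maps. -/
def extPresheaf (Z : Set ℝ) : (Opens ℝ)ᵒᵖ ⥤ ModuleCat.{u} k where
  obj U := ModuleCat.of k (extSections k Z U.unop)
  map i := ModuleCat.ofHom
    { toFun := fun f ↦ ⟨_, extSections_restrict k Z (leOfHom i.unop) f.2⟩
      map_add' := fun _ _ ↦ rfl
      map_smul' := fun _ _ ↦ rfl }
  map_id _ := rfl
  map_comp _ _ := rfl

lemma extPresheaf_isSheaf (Z : Set ℝ) :
    Presheaf.IsSheaf (Opens.grothendieckTopology ℝ) (extPresheaf k Z) := by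
  refine (TopCat.Presheaf.isSheaf_iff_isSheafUniqueGluing (X := TopCat.of ℝ)
    (extPresheaf k Z)).2 ?_
  intro ι U sf hsf
  have hsf' : ∀ (i j : ι) (x : ℝ) (hi : x ∈ U i) (hj : x ∈ U j),
      (sf i).1 ⟨x, hi⟩ = (sf j).1 ⟨x, hj⟩ := fun i j x hi hj ↦
    congrFun (congrArg Subtype.val (hsf i j)) ⟨x, hi, hj⟩
  let V : Opens ℝ := iSup U
  have hmem : ∀ x : V, ∃ i, (x : ℝ) ∈ U i := fun x ↦ Opens.mem_iSup.1 x.2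
  choose c hc using hmem
  let f : V → k := fun x ↦ (sf (c x)).1 ⟨x, hc x⟩
  have hf : ∀ (i : ι) (x : ℝ) (hi : x ∈ U i) (hx : x ∈ V),
      f ⟨x, hx⟩ = (sf i).1 ⟨x, hi⟩ := fun i x hi hx ↦ hsf' _ _ _ _ _
  have hf' : f ∈ extSections k Z V := by
    intro x
    refine ⟨((sf (c x)).2 ⟨x, hc x⟩).1, ?_⟩
    have h := ((sf (c x)).2 ⟨x, hc x⟩).2
    rw [nhds_subtype_eq_comap, Filter.eventually_comap] at h ⊢
    filter_upwards [h, (U (c x)).2.mem_nhds (hc x)] with y hy hyU z hz hzZ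
    subst hz
    rw [hf (c x) z hyU z.2]
    exact hy ⟨z, hyU⟩ rfl hzZ
  refine ⟨(⟨f, hf'⟩ : extSections k Z V), fun i ↦ ?_, fun g hg ↦ ?_⟩
  · exact Subtype.ext (funext fun x ↦ hf i x x.2 _)
  · refine Subtype.ext (funext fun x ↦ ?_)
    have := congrFun (congrArg Subtype.val (hg (c x))) ⟨x, hc x⟩
    exact this

/-- The sheaf `k_Z` on `ℝ`. -/
def extSheaf (Z : Set ℝ) : ShR k := ⟨extPresheaf k Z, extPresheaf_isSheaf k Z⟩

/-- The object `k_Z[n]` of the derived category of sheaves on `ℝ`. -/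
abbrev extObj [HasDerivedCategory.{w} (ShR k)] (Z : Set ℝ) (n : ℤ) : DerivedCategory (ShR k) :=
  ((DerivedCategory.singleFunctor (ShR k) 0).obj (extSheaf k Z))⟦n⟧

end IntervalSheaf

end MayerVietoris

end

/-!
The cohomology of `k_Z` on an interval `]c, d[` is computed by hand, for `Z` a bounded interval.

Everything rests on one gluing argument on the real line. A sheaf of sets on `ℝ` with local sections
has a section on `]c, d[` as soon as, at the points to the right (left) of some `m`, a section can be
changed so as to agree near the point with a given one while still being defined up to its right
(left) end: sections are extended step by step, first up to every `e < d` by a supremum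
argument, then up to `d` by correcting a sequence of sections until it becomes stationary
(`SetSheaf.nonempty_of_correctable`). For the sheaf of liftings of a section of `G'' = G / F`, the
possible corrections are sections of `F`. So `H¹(]c, d[, F) = 0` if the germs of `F` extend to the
right, respectively to the left, within `]c, d[` (`exists_lift`, `ext_one_eq_zero`). Injective sheaves
have this property, because `k_W ⟶ k_ℝ` is a monomorphism for `W` open, and quotients inherit it if
germs extend to all of `ℝ`; hence `Hⁿ(]c, d[, F) = 0` for all `n ≥ 2` and all sheaves `F`
(`ext_eq_zero_of_two_le`).

For `F = k_Z` sections are explicit. `H⁰(]c, d[, k_Z)` is `k`, via the value on `Z`, if `]c, d[` meets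
`Z` and contains no end point of `Z` which does not belong to `Z` (`IsFull`), and it is `0` otherwise
(`valueFunctional_bijective`, `subsingleton_cohomology_of_not_isFull`). For the four types of
intervals, and `]c, d[ = ]-x, y[`, this condition describes the corresponding block, so that
`Ψ(k_Z[-i])` is `k^B` in degree `i` (`blockIso`). A germ of `k_Z` extends over every point except an
end point that does not belong to `Z`, so `H¹(]c, d[, k_Z)` vanishes unless both end points are missing
from `Z` and lie in `]c, d[` (`cohomology_eq_zero_of_subset_Ioc`, `cohomology_eq_zero_of_subset_Ico`).
This gives the vertical, horizontal and birth blocks.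

For `Z = ]a, b[` there remains degree `i + 1`, which vanishes outside of `B†`. Let
`p₀ = (-a, b)` be the corner of `B`. At a point `p₀ + s` of `B†`, exactness forces the connecting map
`Ψ_{i+1}(p₀ + s) → Ψ_i(p₀) = k` to be an isomorphism, since `Ψ_i` and `Ψ_{i+1}` vanish at `p₀ + s_x`
and `p₀ + s_y`. By the compatibility of the connecting maps for different `s` these isomorphisms
commute with the structure maps, and by naturality along `p ≤ p₀` with all connecting maps
(`MVSystem.nonempty_iso_of_corner`). So the generators of `H¹` never have to be computed.
-/

noncomputable section

namespace MayerVietoris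

/-! ### Gluing sections of a sheaf of sets along an interval -/

/-- The open interval `]a, b[` as an open subset of `ℝ`. -/
def openInterval (a b : ℝ) : Opens ℝ := ⟨Set.Ioo a b, isOpen_Ioo⟩

lemma openInterval_mono {a b a' b' : ℝ} (ha : a' ≤ a) (hb : b ≤ b') :
    openInterval a b ≤ openInterval a' b' :=
  Set.Ioo_subset_Ioo ha hb

/-- The inverse image of an open subset of `ℝ` under `x ↦ -x`. -/
def negOpens (V : Opens ℝ) : Opens ℝ := ⟨{x | -x ∈ V}, V.2.preimage continuous_neg⟩

lemma negOpens_mono {V W : Opens ℝ} (h : V ≤ W) : negOpens V ≤ negOpens W := fun _ hx ↦ h hx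

lemma negOpens_negOpens (V : Opens ℝ) : negOpens (negOpens V) = V := by
  ext x
  change - -x ∈ V ↔ x ∈ V
  rw [neg_neg]

lemma negOpens_le {V W : Opens ℝ} : negOpens V ≤ W ↔ V ≤ negOpens W :=
  ⟨fun h ↦ (negOpens_negOpens V).ge.trans (negOpens_mono h),
    fun h ↦ (negOpens_mono h).trans (negOpens_negOpens W).le⟩

lemma negOpens_openInterval (a b : ℝ) : negOpens (openInterval a b) = openInterval (-b) (-a) := by
  ext x
  change a < -x ∧ -x < b ↔ -b < x ∧ x < -a
  constructor <;> rintro ⟨h, h'⟩ <;> constructor <;> linarith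

lemma negOpens_openInterval_neg (a b : ℝ) :
    negOpens (openInterval (-b) (-a)) = openInterval a b := by
  rw [negOpens_openInterval, neg_neg, neg_neg]

/-- A sheaf of sets on `ℝ`, reduced to what the gluing argument on intervals uses: restriction
maps, and the existence of a section over `W` gluing a compatible family of sections over a
covering of `W`. Compatibility and gluing are tested on all open subsets on which both sides are
defined. -/
structure SetSheaf where
  /-- the set of sections over an open subset -/
  obj : Opens ℝ → Type u
  /-- the restriction maps -/
  res : ∀ {V W : Opens ℝ}, V ≤ W → obj W → obj V
  res_res : ∀ {V W X : Opens ℝ} (h : V ≤ W) (h' : W ≤ X) (t : obj X),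
    res h (res h' t) = res (h.trans h') t
  glue : ∀ {ι : Type} (U : ι → Opens ℝ) (t : ∀ i, obj (U i)),
    (∀ i j V (hi : V ≤ U i) (hj : V ≤ U j), res hi (t i) = res hj (t j)) →
    ∀ W, W ≤ iSup U →
      ∃ r : obj W, ∀ i V (hi : V ≤ U i) (hW : V ≤ W), res hW r = res hi (t i)

namespace SetSheaf

variable (S : SetSheaf.{u})

/-- The inverse image of a sheaf of sets under `x ↦ -x`. -/
def reflect : SetSheaf.{u} where
  obj W := S.obj (negOpens W)
  res h := S.res (negOpens_mono h)
  res_res _ _ _ := S.res_res _ _ _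
  glue U t ht W hW := by
    obtain ⟨r, hr⟩ := S.glue (fun i ↦ negOpens (U i)) t
      (fun i j V hi hj ↦ by
        have h := congrArg (S.res (negOpens_negOpens V).ge)
          (ht i j (negOpens V) (negOpens_le.2 hi) (negOpens_le.2 hj))
        exact (S.res_res _ _ _).symm.trans (h.trans (S.res_res _ _ _)))
      (negOpens W) (fun x hx ↦ by
        obtain ⟨i, hi⟩ := Opens.mem_iSup.1 (hW hx)
        exact Opens.mem_iSup.2 ⟨i, hi⟩)
    exact ⟨r, fun i V hi hV ↦ hr i _ _ _⟩

/-- Two sections on `]p, q[` and `]p', q'[` which agree on a neighbourhood `]p', q[` of a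
point glue to a section on `]p, q'[`. -/
lemma exists_glue₂ {p q p' q' : ℝ} (hpq : p' < q)
    (t : S.obj (openInterval p q)) (u : S.obj (openInterval p' q'))
    (h : ∀ V (h₁ : V ≤ openInterval p q) (h₂ : V ≤ openInterval p' q'), S.res h₁ t = S.res h₂ u) :
    ∃ r : S.obj (openInterval p q'),
      (∀ V (hV : V ≤ openInterval p q) (hV' : V ≤ openInterval p q'), S.res hV' r = S.res hV t) ∧
      ∀ V (hV : V ≤ openInterval p' q') (hV' : V ≤ openInterval p q'),
        S.res hV' r = S.res hV u := by
  obtain ⟨r, hr⟩ := S.glue (ι := Bool)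
    (fun i ↦ match i with | true => openInterval p q | false => openInterval p' q')
    (fun i ↦ match i with | true => t | false => u)
    (by
      rintro (_ | _) (_ | _) V hi hj
      · rfl
      · exact (h V hj hi).symm
      · exact h V hi hj
      · rfl)
    (openInterval p q') (fun x hx ↦ by
      rcases lt_or_ge x q with hxq | hxq
      · exact Opens.mem_iSup.2 ⟨true, hx.1, hxq⟩
      · exact Opens.mem_iSup.2 ⟨false, hpq.trans_le hxq, hx.2⟩)
  exact ⟨r, fun V hV hV' ↦ hr true V hV hV', fun V hV hV' ↦ hr false V hV hV'⟩

/-- A sheaf of sets has local sections around a point. -/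
def HasSectionNear (x : ℝ) : Prop :=
  ∃ p q, p < x ∧ x < q ∧ Nonempty (S.obj (openInterval p q))

/-- If there are a section `t` on a neighbourhood of `x` and a section on a neighbourhood
`]p', q'[` of `x`, then there is a section which is defined up to `q'` on the right and agrees with
`t` near `x`. -/
def RightCorrectable (x : ℝ) : Prop :=
  ∀ p q p' q' (_ : p < x) (_ : x < q) (_ : p' < x) (_ : x < q') (t : S.obj (openInterval p q))
    (_ : S.obj (openInterval p' q')), ∃ r s, r < x ∧ x < s ∧ p ≤ r ∧ s ≤ q ∧ s ≤ q' ∧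
      ∃ u : S.obj (openInterval r q'), ∀ V (h : V ≤ openInterval r q')
        (h' : V ≤ openInterval p q), V ≤ openInterval r s → S.res h u = S.res h' t

/-- The mirror image of `RightCorrectable`. -/
def LeftCorrectable (x : ℝ) : Prop :=
  ∀ p q p' q' (_ : p < x) (_ : x < q) (_ : p' < x) (_ : x < q') (t : S.obj (openInterval p q))
    (_ : S.obj (openInterval p' q')), ∃ r s, r < x ∧ x < s ∧ p ≤ r ∧ s ≤ q ∧ p' ≤ r ∧
      ∃ u : S.obj (openInterval p' s), ∀ V (h : V ≤ openInterval p' s)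
        (h' : V ≤ openInterval p q), V ≤ openInterval r s → S.res h u = S.res h' t

variable {S}

lemma RightCorrectable.extend {x : ℝ} (hx : S.RightCorrectable x) {p q p' q' : ℝ} (hp : p < x)
    (hq : x < q) (hp' : p' < x) (hq' : x < q') (t : S.obj (openInterval p q))
    (u : S.obj (openInterval p' q')) :
    ∃ r : S.obj (openInterval p q'), ∀ V (h : V ≤ openInterval p q') (h' : V ≤ openInterval p q),
      V ≤ openInterval p x → S.res h r = S.res h' t := by
  obtain ⟨a, b, ha, hb, hpa, hbq, hbq', v, hv⟩ := hx p q p' q' hp hq hp' hq' t u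
  obtain ⟨r, hr, -⟩ := S.exists_glue₂ (ha.trans hb)
    (S.res (openInterval_mono le_rfl hbq) t) v (fun V h₁ h₂ ↦ by
      rw [S.res_res]
      exact (hv V h₂ _ fun y hy ↦ ⟨(h₂ hy).1, (h₁ hy).2⟩).symm)
  refine ⟨r, fun V h h' hV ↦ ?_⟩
  rw [hr V (hV.trans (openInterval_mono le_rfl hb.le)) h, S.res_res]

/-- Sections exist on `]p, e[` for all `e < d`, by a supremum argument. -/
lemma nonempty_of_rightCorrectable {p m q d : ℝ} (hp : p < m) (hq : m < q)
    (t : S.obj (openInterval p q)) (hloc : ∀ x, m ≤ x → x < d → S.HasSectionNear x)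
    (hR : ∀ x, m ≤ x → x < d → S.RightCorrectable x) {e : ℝ} (hed : e < d) :
    Nonempty (S.obj (openInterval p e)) := by
  by_contra hne
  have hdown : ∀ {e e' : ℝ}, e ≤ e' → Nonempty (S.obj (openInterval p e')) →
      Nonempty (S.obj (openInterval p e)) := fun h ⟨t⟩ ↦ ⟨S.res (openInterval_mono le_rfl h) t⟩
  let A : Set ℝ := {e | Nonempty (S.obj (openInterval p e))}
  have hA : BddAbove A := ⟨e, fun e' he' ↦ not_lt.1 fun h ↦ hne (hdown h.le he')⟩
  have hqA : q ∈ A := ⟨t⟩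
  have hqσ : q ≤ sSup A := le_csSup hA hqA
  have hσe : sSup A ≤ e := csSup_le ⟨q, hqA⟩ fun e' he' ↦ not_lt.1 fun h ↦ hne (hdown h.le he')
  obtain ⟨p', q', hp', hq', ⟨u⟩⟩ := hloc (sSup A) (hq.le.trans hqσ) (hσe.trans_lt hed)
  obtain ⟨e', ⟨t'⟩, he'⟩ := exists_lt_of_lt_csSup ⟨q, hqA⟩
    (max_lt hp' (hq.trans_le hqσ) : max p' m < sSup A)
  obtain ⟨x, hx, hx'⟩ := exists_between he'
  have he'σ : e' ≤ sSup A := le_csSup hA ⟨t'⟩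
  obtain ⟨hx₁, hx₂⟩ := max_lt_iff.1 hx
  obtain ⟨r, -⟩ := (hR x hx₂.le ((hx'.trans_le he'σ).trans_le (hσe.trans hed.le))).extend
    (hp.trans hx₂) hx' hx₁ ((hx'.trans_le he'σ).trans hq') t' u
  exact hq'.not_ge (le_csSup hA ⟨r⟩)

/-- A section on a neighbourhood of `m` extends, without change on the left of `m`, to the right
up to `d`. Sections on `]p, e[` for `e < d` exist, and a sequence of such sections with `e`
increasing to `d` can be corrected step by step in such a way that it becomes stationary on each
`]p, e[`. -/
lemma exists_extension_right {p m q d : ℝ} (hp : p < m) (hq : m < q) (hd : m < d)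
    (t : S.obj (openInterval p q)) (hloc : ∀ x, m ≤ x → x < d → S.HasSectionNear x)
    (hR : ∀ x, m ≤ x → x < d → S.RightCorrectable x) :
    ∃ r : S.obj (openInterval p d), ∀ V (h : V ≤ openInterval p d) (h' : V ≤ openInterval p q),
      V ≤ openInterval p m → S.res h r = S.res h' t := by
  obtain ⟨e, he_mono, he_mem, he_lim⟩ := exists_seq_strictMono_tendsto' hd
  have hme : ∀ n, m < e n := fun n ↦ (he_mem n).1
  have hed : ∀ n, e n < d := fun n ↦ (he_mem n).2
  have hex : ∀ n, Nonempty (S.obj (openInterval p (e n))) := fun n ↦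
    nonempty_of_rightCorrectable hp hq t hloc hR (hed n)
  obtain ⟨t₀, ht₀⟩ := (hR m le_rfl hd).extend hp hq hp (hme 1) t (hex 1).some
  have hstep : ∀ (n : ℕ) (s : S.obj (openInterval p (e (n + 1)))),
      ∃ s' : S.obj (openInterval p (e (n + 2))), ∀ V (h : V ≤ openInterval p (e (n + 2)))
        (h' : V ≤ openInterval p (e (n + 1))), V ≤ openInterval p (e n) →
          S.res h s' = S.res h' s := fun n s ↦
    (hR (e n) (hme n).le (hed n)).extend (hp.trans (hme n)) (he_mono (Nat.lt_succ_self n))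
      (hp.trans (hme n)) (he_mono (by omega)) s (hex (n + 2)).some
  choose next hnext using hstep
  let s : ∀ n, S.obj (openInterval p (e (n + 1))) := fun n ↦ Nat.rec t₀ next n
  have hle : ∀ n, openInterval p (e n) ≤ openInterval p (e (n + 1)) := fun n ↦
    openInterval_mono le_rfl (he_mono (Nat.lt_succ_self n)).le
  have hs : ∀ i j, i ≤ j → ∀ V (h : V ≤ openInterval p (e i)) (h' : V ≤ openInterval p (e j)),
      S.res (h.trans (hle i)) (s i) = S.res (h'.trans (hle j)) (s j) := by
    intro i j hij
    induction j, hij using Nat.le_induction with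
    | base => exact fun V h h' ↦ rfl
    | succ j hij ih =>
      intro V h h'
      have h'' : V ≤ openInterval p (e j) :=
        h.trans (openInterval_mono le_rfl (he_mono.monotone hij))
      rw [ih V h h'']
      exact (hnext j (s j) V (h'.trans (hle (j + 1))) (h''.trans (hle j)) h'').symm
  obtain ⟨r, hr⟩ := S.glue (fun n ↦ openInterval p (e n)) (fun n ↦ S.res (hle n) (s n))
    (fun i j V hi hj ↦ by
      rw [S.res_res, S.res_res]
      rcases le_total i j with h | h
      · exact hs i j h V hi hj
      · exact (hs j i h V hj hi).symm)
    (openInterval p d) (fun x hx ↦ by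
      obtain ⟨n, hn⟩ := (he_lim.eventually (lt_mem_nhds hx.2)).exists
      exact Opens.mem_iSup.2 ⟨n, hx.1, hn⟩)
  refine ⟨r, fun V h h' hV ↦ ?_⟩
  have hV₀ : V ≤ openInterval p (e 0) := hV.trans (openInterval_mono le_rfl (hme 0).le)
  rw [hr 0 V hV₀ h, S.res_res]
  exact ht₀ V _ h' hV

/-- The mirror image of `exists_extension_right`. -/
lemma exists_extension_left {c p m q : ℝ} (hp : p < m) (hq : m < q) (hc : c < m)
    (t : S.obj (openInterval p q)) (hloc : ∀ x, c < x → x ≤ m → S.HasSectionNear x)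
    (hL : ∀ x, c < x → x ≤ m → S.LeftCorrectable x) :
    ∃ r : S.obj (openInterval c q), ∀ V (h : V ≤ openInterval c q) (h' : V ≤ openInterval p q),
      V ≤ openInterval m q → S.res h r = S.res h' t := by
  obtain ⟨r, hr⟩ := exists_extension_right (S := S.reflect) (p := -q) (m := -m) (q := -p) (d := -c)
    (neg_lt_neg hq) (neg_lt_neg hp) (neg_lt_neg hc) (S.res (negOpens_openInterval_neg p q).le t)
    (fun x hx hx' ↦ by
      obtain ⟨p', q', hp', hq', ⟨u⟩⟩ := hloc (-x) (by linarith) (by linarith)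
      exact ⟨-q', -p', by linarith, by linarith, ⟨S.res (negOpens_openInterval_neg p' q').le u⟩⟩)
    (fun x hx hx' a b a' b' ha hb ha' hb' t u ↦ by
      obtain ⟨r, s, hr, hs, hbr, hsa, hbr', v, hv⟩ := hL (-x) (by linarith) (by linarith)
        (-b) (-a) (-b') (-a') (by linarith) (by linarith) (by linarith) (by linarith)
        (S.res (negOpens_openInterval a b).ge t) (S.res (negOpens_openInterval a' b').ge u)
      refine ⟨-s, -r, by linarith, by linarith, by linarith, by linarith, by linarith,
        S.res ((negOpens_openInterval _ _).trans (by rw [neg_neg])).le v, fun V h h' hV ↦ ?_⟩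
      have hV' : negOpens V ≤ openInterval r s := by
        rwa [negOpens_le, negOpens_openInterval]
      exact (S.res_res _ _ _).trans
        ((hv (negOpens V) (hV'.trans (openInterval_mono hbr' le_rfl))
          (hV'.trans (openInterval_mono hbr hsa)) hV').trans (S.res_res _ _ _)))
  refine ⟨S.res (negOpens_openInterval_neg c q).ge r, fun V h h' hV ↦ ?_⟩
  have hV' : negOpens V ≤ openInterval (-q) (-m) := by
    rwa [negOpens_le, negOpens_openInterval_neg]
  have key := congrArg (S.res (negOpens_negOpens V).ge) (hr (negOpens V)
    (hV'.trans (openInterval_mono le_rfl (neg_le_neg hc.le)))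
    (hV'.trans (openInterval_mono le_rfl (neg_le_neg hp.le))) hV')
  exact (S.res_res _ _ _).trans ((S.res_res _ _ _).symm.trans
    (key.trans ((S.res_res _ _ _).trans (S.res_res _ _ _))))

/-- A sheaf of sets with local sections has a section on `]c, d[` if sections can be corrected to
the right at the points on the right of `m` and to the left at the points on the left of `m`. -/
theorem nonempty_of_correctable {c m d : ℝ} (hc : c < m) (hd : m < d)
    (hloc : ∀ x, c < x → x < d → S.HasSectionNear x)
    (hR : ∀ x, m ≤ x → x < d → S.RightCorrectable x)
    (hL : ∀ x, c < x → x ≤ m → S.LeftCorrectable x) :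
    Nonempty (S.obj (openInterval c d)) := by
  obtain ⟨p, q, hp, hq, ⟨t⟩⟩ := hloc m hc hd
  -- A section extended to the right of a point `m'` on the right of `m` agrees with `t` near `m`.
  obtain ⟨m', hm, hm'⟩ := exists_between (lt_min hq hd)
  obtain ⟨hm'q, hm'd⟩ := lt_min_iff.1 hm'
  obtain ⟨r, hr⟩ := exists_extension_right (hp.trans hm) hm'q hm'd t
    (fun x hx hx' ↦ hloc x (hc.trans (hm.trans_le hx)) hx') fun x hx hx' ↦ hR x (hm.le.trans hx) hx'
  obtain ⟨l, hl⟩ := exists_extension_left hp hq hc t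
    (fun x hx hx' ↦ hloc x hx (hx'.trans_lt hd)) hL
  obtain ⟨s, -⟩ := S.exists_glue₂ hm
    (S.res (openInterval_mono le_rfl hm'q.le) l) (S.res (openInterval_mono hp.le le_rfl) r)
    (fun V h₁ h₂ ↦ by
      have hV : V ≤ openInterval m m' := fun y hy ↦ ⟨(h₂ hy).1, (h₁ hy).2⟩
      rw [S.res_res, S.res_res, hl V _ (hV.trans (openInterval_mono hp.le hm'q.le))
        (hV.trans (openInterval_mono le_rfl hm'q.le)),
        hr V _ (hV.trans (openInterval_mono hp.le hm'q.le))
          (hV.trans (openInterval_mono hp.le le_rfl))])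
  exact ⟨s⟩

end SetSheaf

/-! ### Sections of sheaves on `ℝ` -/

section Sections

variable (k : Type u) [Field k]

instance : EnoughInjectives (ShR k) := by
  have : EssentiallySmall.{u} (Opens ℝ) := essentiallySmall_of_small_of_locallySmall _
  have : IsGrothendieckAbelian.{u} (ShR k) := Sheaf.isGrothendieckAbelian_of_essentiallySmall _ _
  infer_instance

instance : (Opens.grothendieckTopology ℝ).WEqualsLocallyBijective (ModuleCat.{u} k) := by
  have : EssentiallySmall.{u} (Opens ℝ) := essentiallySmall_of_small_of_locallySmall _
  have : ((equivSmallModel.{u} (Opens ℝ)).inverse.inducedTopology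
      (Opens.grothendieckTopology ℝ)).WEqualsLocallyBijective (ModuleCat.{u} k) := inferInstance
  exact GrothendieckTopology.WEqualsLocallyBijective.ofEssentiallySmall _

variable {k}

/-- The restriction map `F(W) → F(V)` for `V ⊆ W`. -/
abbrev resSec (F : ShR k) {V W : Opens ℝ} (h : V ≤ W) :
    F.obj.obj (op W) →ₗ[k] F.obj.obj (op V) :=
  (F.obj.map (homOfLE h).op).hom

/-- The map `F(U) → G(U)` induced by a morphism of sheaves. -/
abbrev onSec {F G : ShR k} (g : F ⟶ G) (U : Opens ℝ) : F.obj.obj (op U) →ₗ[k] G.obj.obj (op U) :=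
  (g.hom.app (op U)).hom

lemma resSec_resSec (F : ShR k) {V W X : Opens ℝ} (h : V ≤ W) (h' : W ≤ X)
    (s : F.obj.obj (op X)) : resSec F h (resSec F h' s) = resSec F (h.trans h') s := by
  have := F.obj.map_comp (homOfLE h').op (homOfLE h).op
  exact (ConcreteCategory.congr_hom this s).symm

lemma onSec_resSec {F G : ShR k} (g : F ⟶ G) {V W : Opens ℝ} (h : V ≤ W)
    (s : F.obj.obj (op W)) : onSec g V (resSec F h s) = resSec G h (onSec g W s) :=
  ConcreteCategory.congr_hom (g.hom.naturality (homOfLE h).op) s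

lemma onSec_comp {F G H : ShR k} (f : F ⟶ G) (g : G ⟶ H) (U : Opens ℝ) (s : F.obj.obj (op U)) :
    onSec g U (onSec f U s) = onSec (f ≫ g) U s := rfl

/-- An epimorphism of sheaves is locally surjective on sections. -/
lemma exists_local_lift {F G : ShR k} (g : F ⟶ G) [Epi g] {U : Opens ℝ} (s : G.obj.obj (op U))
    {x : ℝ} (hx : x ∈ U) :
    ∃ (V : Opens ℝ) (h : V ≤ U), x ∈ V ∧ ∃ t : F.obj.obj (op V), onSec g V t = resSec G h s := by
  have : CategoryTheory.Sheaf.IsLocallySurjective g :=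
    (CategoryTheory.Sheaf.isLocallySurjective_iff_epi' (ModuleCat.{u} k) g).2 inferInstance
  obtain ⟨V, i, ⟨t, ht⟩, hi⟩ := this.imageSieve_mem s x hx
  exact ⟨V, leOfHom i, hi, t, ht⟩

lemma freeSheafHomEquiv_comp {U : Opens ℝ} {F G : ShR k} (φ : (freeSheaf k).obj U ⟶ F)
    (g : F ⟶ G) :
    freeSheafHomEquiv k U G (φ ≫ g) = onSec g U (freeSheafHomEquiv k U F φ) := by
  have h₁ := (sheafificationAdjunction (Opens.grothendieckTopology ℝ)
    (ModuleCat.{u} k)).homEquiv_naturality_right φ g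
  have h₂ := ((ModuleCat.adj k).whiskerRight (Opens ℝ)ᵒᵖ).homEquiv_naturality_right
    (((sheafificationAdjunction (Opens.grothendieckTopology ℝ)
      (ModuleCat.{u} k)).homEquiv _ _) φ) g.hom
  exact (congrArg (fun t ↦ uliftYonedaEquiv.{u} (((ModuleCat.adj k).whiskerRight
    (Opens ℝ)ᵒᵖ).homEquiv (uliftYoneda.{u}.obj U) G.obj t)) h₁).trans
    (congrArg (fun t ↦ uliftYonedaEquiv.{u} t) h₂)

/-- The sections functor is left exact. -/
lemma exists_onSec_eq {S : ShortComplex (ShR k)} (hS : S.ShortExact) {U : Opens ℝ}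
    (t : S.X₂.obj.obj (op U)) (ht : onSec S.g U t = 0) : ∃ s, onSec S.f U s = t := by
  have := hS.mono_f
  have h0 : freeSheafHomEquiv k U S.X₃ 0 = 0 := by
    have h := freeSheafHomEquiv_comp (U := U) (0 : (freeSheaf k).obj U ⟶ S.X₃) (0 : S.X₃ ⟶ S.X₃)
    rw [zero_comp] at h
    exact h
  let φ := (freeSheafHomEquiv k U S.X₂).symm t
  have hφ : φ ≫ S.g = 0 := by
    apply (freeSheafHomEquiv k U S.X₃).injective
    rw [freeSheafHomEquiv_comp, Equiv.apply_symm_apply, ht, h0]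
  refine ⟨freeSheafHomEquiv k U S.X₁ (hS.exact.lift φ hφ), ?_⟩
  rw [← freeSheafHomEquiv_comp, ShortComplex.Exact.lift_f, Equiv.apply_symm_apply]

/-! ### Extension of germs -/

/-- All germs of sections of `F` are germs of global sections. -/
def GermsExtend (F : ShR k) : Prop :=
  ∀ (x : ℝ) (W : Opens ℝ), x ∈ W → ∀ f : F.obj.obj (op W), ∃ (V : Opens ℝ) (h : V ≤ W),
    x ∈ V ∧ ∃ f' : F.obj.obj (op ⊤), resSec F le_top f' = resSec F h f

/-- Every germ at `x` of a section of `F` extends to the right up to `d`. -/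
def GermsExtendRight (F : ShR k) (d x : ℝ) : Prop :=
  ∀ W : Opens ℝ, x ∈ W → ∀ f : F.obj.obj (op W), ∃ p q, p < x ∧ x < q ∧
    ∃ (h : openInterval p q ≤ W) (hd : q ≤ d) (f' : F.obj.obj (op (openInterval p d))),
      resSec F (openInterval_mono le_rfl hd) f' = resSec F h f

/-- Every germ at `x` of a section of `F` extends to the left up to `c`. -/
def GermsExtendLeft (F : ShR k) (c x : ℝ) : Prop :=
  ∀ W : Opens ℝ, x ∈ W → ∀ f : F.obj.obj (op W), ∃ p q, p < x ∧ x < q ∧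
    ∃ (h : openInterval p q ≤ W) (hc : c ≤ p) (f' : F.obj.obj (op (openInterval c q))),
      resSec F (openInterval_mono hc le_rfl) f' = resSec F h f

lemma exists_openInterval_le {V : Opens ℝ} {x : ℝ} (hx : x ∈ V) :
    ∃ p q, p < x ∧ x < q ∧ openInterval p q ≤ V := by
  obtain ⟨p, q, hx', h⟩ := mem_nhds_iff_exists_Ioo_subset.1 (V.2.mem_nhds hx)
  exact ⟨p, q, hx'.1, hx'.2, h⟩

lemma GermsExtend.right {F : ShR k} (hF : GermsExtend F) {x d : ℝ} (hx : x < d) :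
    GermsExtendRight F d x := by
  intro W hW f
  obtain ⟨V, hVW, hV, f', hf'⟩ := hF x W hW f
  obtain ⟨p, q, hp, hq, hpq⟩ := exists_openInterval_le hV
  have h : openInterval p (min q d) ≤ V := (openInterval_mono le_rfl (min_le_left _ _)).trans hpq
  refine ⟨p, min q d, hp, lt_min hq hx, h.trans hVW, min_le_right _ _, resSec F le_top f', ?_⟩
  have := congrArg (resSec F h) hf'
  rw [resSec_resSec, resSec_resSec] at this
  rw [resSec_resSec]
  exact this

lemma GermsExtend.left {F : ShR k} (hF : GermsExtend F) {x c : ℝ} (hx : c < x) :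
    GermsExtendLeft F c x := by
  intro W hW f
  obtain ⟨V, hVW, hV, f', hf'⟩ := hF x W hW f
  obtain ⟨p, q, hp, hq, hpq⟩ := exists_openInterval_le hV
  have h : openInterval (max p c) q ≤ V := (openInterval_mono (le_max_left _ _) le_rfl).trans hpq
  refine ⟨max p c, q, max_lt hp hx, hq, h.trans hVW, le_max_right _ _, resSec F le_top f', ?_⟩
  have := congrArg (resSec F h) hf'
  rw [resSec_resSec, resSec_resSec] at this
  rw [resSec_resSec]
  exact this

lemma GermsExtend.of_epi {F G : ShR k} (hF : GermsExtend F) (g : F ⟶ G) [Epi g] :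
    GermsExtend G := by
  intro x W hx s
  obtain ⟨V, hVW, hV, t, ht⟩ := exists_local_lift g s hx
  obtain ⟨V', hVV, hV', t', ht'⟩ := hF x V hV t
  refine ⟨V', hVV.trans hVW, hV', onSec g ⊤ t', ?_⟩
  rw [← onSec_resSec, ht', onSec_resSec, ht, resSec_resSec]

/-- Sections of an injective sheaf extend, as `k_W ⟶ k_ℝ` is a monomorphism. -/
lemma germsExtend_of_injective (F : ShR k) [Injective F] : GermsExtend F := by
  intro x W hx f
  have : Mono (freeSheafMap k (le_top : W ≤ ⊤)) := freeSheaf_mono k _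
  refine ⟨W, le_rfl, hx, freeSheafHomEquiv k ⊤ F (Injective.factorThru
    ((freeSheafHomEquiv k W F).symm f) (freeSheafMap k (le_top : W ≤ ⊤))), ?_⟩
  refine (freeSheafHomEquiv_naturality k (homOfLE (le_top : W ≤ ⊤)) F _).symm.trans ?_
  rw [Injective.comp_factorThru, Equiv.apply_symm_apply]
  exact (ConcreteCategory.congr_hom (F.obj.map_id (op W)) f).symm

/-! ### Lifting sections over an interval -/

/-- The sheaf of sets of local liftings through `g : F ⟶ G` of a section `s` of `G` over `U`. Its
sections over `W` are the liftings of `s` over `W ∩ U`. -/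
def liftSheaf {F G : ShR k} (g : F ⟶ G) {U : Opens ℝ} (s : G.obj.obj (op U)) : SetSheaf.{u} where
  obj W := {t : F.obj.obj (op (W ⊓ U)) // onSec g _ t = resSec G inf_le_right s}
  res h t := ⟨resSec F (inf_le_inf_right U h) t.1, by
    rw [onSec_resSec, t.2, resSec_resSec]⟩
  res_res h h' t := Subtype.ext (resSec_resSec F _ _ _)
  glue {ι} V t ht W hW := by
    have hcov : W ⊓ U ≤ ⨆ i, W ⊓ (V i ⊓ U) := fun x hx ↦ by
      obtain ⟨i, hi⟩ := Opens.mem_iSup.1 (hW hx.1)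
      exact Opens.mem_iSup.2 ⟨i, hx.1, hi, hx.2⟩
    obtain ⟨r, hr, -⟩ := TopCat.Sheaf.existsUnique_gluing' (X := TopCat.of ℝ) F
      (fun i ↦ W ⊓ (V i ⊓ U)) (W ⊓ U) (fun i ↦ homOfLE (inf_le_inf_left W inf_le_right)) hcov
      (fun i ↦ resSec F inf_le_right (t i).1) (fun i j ↦ by
        have h := congrArg Subtype.val (ht i j (W ⊓ (V i ⊓ U) ⊓ (W ⊓ (V j ⊓ U)))
          (fun x hx ↦ hx.1.2.1) fun x hx ↦ hx.2.2.1)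
        have h' := congrArg (resSec F (V := W ⊓ (V i ⊓ U) ⊓ (W ⊓ (V j ⊓ U)))
          (le_inf le_rfl fun x hx ↦ hx.1.2.2)) h
        change resSec F _ (resSec F _ (t i).1) = resSec F _ (resSec F _ (t j).1) at h'
        change resSec F _ (resSec F _ (t i).1) = resSec F _ (resSec F _ (t j).1)
        rw [resSec_resSec, resSec_resSec] at h' ⊢
        exact h')
    have hr' : ∀ i, resSec F (inf_le_inf_left W inf_le_right) r = resSec F inf_le_right (t i).1 := hr
    refine ⟨⟨r, ?_⟩, fun i X hi hX ↦ Subtype.ext ?_⟩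
    · refine TopCat.Sheaf.eq_of_locally_eq' (X := TopCat.of ℝ) G (fun i ↦ W ⊓ (V i ⊓ U)) (W ⊓ U)
        (fun i ↦ homOfLE (inf_le_inf_left W inf_le_right)) hcov _ _ fun i ↦ ?_
      change resSec G _ (onSec g _ r) = resSec G _ (resSec G _ s)
      rw [← onSec_resSec, hr' i, onSec_resSec, (t i).2, resSec_resSec, resSec_resSec]
    · have hX' : X ⊓ U ≤ W ⊓ (V i ⊓ U) := fun x hx ↦ ⟨hX hx.1, hi hx.1, hx.2⟩
      have h := congrArg (resSec F hX') (hr' i)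
      rw [resSec_resSec, resSec_resSec] at h
      exact h

lemma hasSectionNear_liftSheaf {F G : ShR k} (g : F ⟶ G) [Epi g] {U : Opens ℝ}
    (s : G.obj.obj (op U)) {x : ℝ} (hx : x ∈ U) : (liftSheaf g s).HasSectionNear x := by
  obtain ⟨V, hVU, hV, t, ht⟩ := exists_local_lift g s hx
  obtain ⟨p, q, hp, hq, hpq⟩ := exists_openInterval_le hV
  exact ⟨p, q, hp, hq, ⟨resSec F (inf_le_left.trans hpq) t, by
    rw [onSec_resSec, ht, resSec_resSec]⟩⟩

/-- Two liftings of a section of the quotient differ by a section of the kernel. -/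
lemma exists_sub_eq {S : ShortComplex (ShR k)} (hS : S.ShortExact) {U A B : Opens ℝ}
    (s : S.X₃.obj.obj (op U)) (t : (liftSheaf S.g s).obj A) (u : (liftSheaf S.g s).obj B) :
    ∃ f : S.X₁.obj.obj (op (A ⊓ B ⊓ U)),
      onSec S.f _ f = resSec S.X₂ (inf_le_inf_right U inf_le_left) t.1 -
        resSec S.X₂ (inf_le_inf_right U inf_le_right) u.1 := by
  apply exists_onSec_eq hS
  rw [map_sub, onSec_resSec, onSec_resSec, t.2, u.2, resSec_resSec, resSec_resSec, sub_self]

/-- The correction of the lifting `u` is the addition of the extension to the right of the germ of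
the section `t - u` of `S.X₁`. -/
lemma rightCorrectable_liftSheaf {S : ShortComplex (ShR k)} (hS : S.ShortExact) {c d : ℝ}
    (s : S.X₃.obj.obj (op (openInterval c d))) {x : ℝ} (hc : c < x) (hd : x < d)
    (hx : GermsExtendRight S.X₁ d x) : (liftSheaf S.g s).RightCorrectable x := by
  intro p q p' q' hp hq hp' hq' t u
  obtain ⟨f, hf⟩ := exists_sub_eq hS s t u
  obtain ⟨a, b, ha, hb, hab, hbd, f', hf'⟩ := hx
    (openInterval p q ⊓ openInterval p' q' ⊓ openInterval c d) ⟨⟨⟨hp, hq⟩, hp', hq'⟩, hc, hd⟩ f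
  obtain ⟨r, hr, hrx⟩ := exists_between (max_lt (max_lt hp hp') ha)
  obtain ⟨hr, hra⟩ := max_lt_iff.1 hr
  obtain ⟨hrp, hrp'⟩ := max_lt_iff.1 hr
  let b' := min (min q q') b
  have hle : openInterval r q' ⊓ openInterval c d ≤ openInterval a d :=
    fun y hy ↦ ⟨hra.trans hy.1.1, hy.2.2⟩
  refine ⟨r, b', hrx, lt_min (lt_min hq hq') hb, hrp.le, (min_le_left _ _).trans (min_le_left _ _),
    (min_le_left _ _).trans (min_le_right _ _),
    ⟨resSec S.X₂ (inf_le_inf_right _ (openInterval_mono hrp'.le le_rfl)) u.1 +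
      onSec S.f _ (resSec S.X₁ hle f'), ?_⟩, fun V h h' hV ↦ Subtype.ext ?_⟩
  · rw [map_add, onSec_resSec, u.2, resSec_resSec, onSec_comp, S.zero, add_eq_left]
    rfl
  · have hVab : V ⊓ openInterval c d ≤ openInterval a b := fun y hy ↦
      ⟨hra.trans (hV hy.1).1, (hV hy.1).2.trans_le (min_le_right _ _)⟩
    have h₁ := congrArg (resSec S.X₁ hVab) hf'
    have h₂ := congrArg (resSec S.X₂ (hVab.trans hab)) hf
    change resSec S.X₂ _ (_ + onSec S.f _ _) = resSec S.X₂ _ t.1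
    rw [map_sub, resSec_resSec, resSec_resSec, ← onSec_resSec] at h₂
    rw [resSec_resSec, resSec_resSec] at h₁
    rw [map_add, resSec_resSec, ← onSec_resSec, resSec_resSec, h₁, h₂, add_sub_cancel]

/-- The mirror image of `rightCorrectable_liftSheaf`. -/
lemma leftCorrectable_liftSheaf {S : ShortComplex (ShR k)} (hS : S.ShortExact) {c d : ℝ}
    (s : S.X₃.obj.obj (op (openInterval c d))) {x : ℝ} (hc : c < x) (hd : x < d)
    (hx : GermsExtendLeft S.X₁ c x) : (liftSheaf S.g s).LeftCorrectable x := by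
  intro p q p' q' hp hq hp' hq' t u
  obtain ⟨f, hf⟩ := exists_sub_eq hS s t u
  obtain ⟨a, b, ha, hb, hab, hca, f', hf'⟩ := hx
    (openInterval p q ⊓ openInterval p' q' ⊓ openInterval c d) ⟨⟨⟨hp, hq⟩, hp', hq'⟩, hc, hd⟩ f
  obtain ⟨r, hrx, hr⟩ := exists_between (lt_min (lt_min hq hq') hb)
  obtain ⟨hr, hrb⟩ := lt_min_iff.1 hr
  obtain ⟨hrq, hrq'⟩ := lt_min_iff.1 hr
  let a' := max (max p p') a
  have hle : openInterval p' r ⊓ openInterval c d ≤ openInterval c b :=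
    fun y hy ↦ ⟨hy.2.1, hy.1.2.trans hrb⟩
  refine ⟨a', r, max_lt (max_lt hp hp') ha, hrx, (le_max_left _ _).trans (le_max_left _ _), hrq.le,
    (le_max_right _ _).trans (le_max_left _ _),
    ⟨resSec S.X₂ (inf_le_inf_right _ (openInterval_mono le_rfl hrq'.le)) u.1 +
      onSec S.f _ (resSec S.X₁ hle f'), ?_⟩, fun V h h' hV ↦ Subtype.ext ?_⟩
  · rw [map_add, onSec_resSec, u.2, resSec_resSec, onSec_comp, S.zero, add_eq_left]
    rfl
  · have hVab : V ⊓ openInterval c d ≤ openInterval a b := fun y hy ↦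
      ⟨(le_max_right _ _).trans_lt (hV hy.1).1, (hV hy.1).2.trans hrb⟩
    have h₁ := congrArg (resSec S.X₁ hVab) hf'
    have h₂ := congrArg (resSec S.X₂ (hVab.trans hab)) hf
    change resSec S.X₂ _ (_ + onSec S.f _ _) = resSec S.X₂ _ t.1
    rw [map_sub, resSec_resSec, resSec_resSec, ← onSec_resSec] at h₂
    rw [resSec_resSec, resSec_resSec] at h₁
    rw [map_add, resSec_resSec, ← onSec_resSec, resSec_resSec, h₁, h₂, add_sub_cancel]

/-- If the germs of sections of the kernel extend to the right at the points on the right of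
some `m` and to the left at the points on the left of `m`, then sections of the quotient over
`]c, d[` lift. -/
theorem exists_lift {S : ShortComplex (ShR k)} (hS : S.ShortExact) {c m d : ℝ} (hc : c < m)
    (hd : m < d) (hR : ∀ x, m ≤ x → x < d → GermsExtendRight S.X₁ d x)
    (hL : ∀ x, c < x → x ≤ m → GermsExtendLeft S.X₁ c x)
    (s : S.X₃.obj.obj (op (openInterval c d))) : ∃ t, onSec S.g (openInterval c d) t = s := by
  have := hS.epi_g
  obtain ⟨t⟩ := SetSheaf.nonempty_of_correctable (S := liftSheaf S.g s) hc hd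
    (fun x hx hx' ↦ hasSectionNear_liftSheaf S.g s ⟨hx, hx'⟩)
    (fun x hx hx' ↦ rightCorrectable_liftSheaf hS s (hc.trans_le hx) hx' (hR x hx hx'))
    fun x hx hx' ↦ leftCorrectable_liftSheaf hS s hx (hx'.trans_lt hd) (hL x hx hx')
  have hle : openInterval c d ≤ openInterval c d ⊓ openInterval c d := le_inf le_rfl le_rfl
  refine ⟨resSec S.X₂ hle t.1, ?_⟩
  rw [onSec_resSec, t.2, resSec_resSec]
  exact ConcreteCategory.congr_hom (S.X₃.obj.map_id (op (openInterval c d))) s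

end Sections

/-! ### Vanishing of the cohomology of intervals -/

section Vanishing

variable {k : Type u} [Field k] [HasExt.{w} (ShR k)]

/-- `H¹(]c, d[, F) = 0` if germs of `F` extend to the right at the points on the right of some `m`
and to the left at the points on its left: `H¹` is the obstruction to the lifting of sections from the
quotient of an injective sheaf by `F`. -/
lemma ext_one_eq_zero {F : ShR k} {c m d : ℝ} (hc : c < m) (hd : m < d)
    (hR : ∀ x, m ≤ x → x < d → GermsExtendRight F d x)
    (hL : ∀ x, c < x → x ≤ m → GermsExtendLeft F c x)
    (α : Abelian.Ext.{w} ((freeSheaf k).obj (openInterval c d)) F 1) : α = 0 := by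
  have hS : (ShortComplex.mk (Injective.ι F) (cokernel.π (Injective.ι F))
    (cokernel.condition _)).ShortExact := { exact := ShortComplex.exact_cokernel _ }
  obtain ⟨β, rfl⟩ := Abelian.Ext.covariant_sequence_exact₁ _ hS α
    (Abelian.Ext.eq_zero_of_injective _) (n₀ := 0) rfl
  obtain ⟨φ, rfl⟩ := Abelian.Ext.mk₀_bijective _ _ |>.2 β
  obtain ⟨t, ht⟩ := exists_lift hS hc hd hR hL (freeSheafHomEquiv k _ _ φ)
  have hφ : φ = (freeSheafHomEquiv k _ _).symm t ≫ cokernel.π (Injective.ι F) := by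
    apply (freeSheafHomEquiv k _ _).injective
    rw [freeSheafHomEquiv_comp, Equiv.apply_symm_apply]
    exact ht.symm
  rw [hφ, ← Abelian.Ext.mk₀_comp_mk₀, Abelian.Ext.comp_assoc_of_second_deg_zero]
  have := hS.comp_extClass
  rw [this, Abelian.Ext.comp_zero]

/-- A sheaf all of whose germs extend to global sections has no higher cohomology on intervals: this
class of sheaves contains the injective sheaves and it is stable under quotients. -/
lemma GermsExtend.ext_eq_zero {F : ShR k} (hF : GermsExtend F) {c d : ℝ} (hcd : c < d) (n : ℕ)
    (α : Abelian.Ext.{w} ((freeSheaf k).obj (openInterval c d)) F (n + 1)) : α = 0 := by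
  induction n generalizing F with
  | zero =>
    obtain ⟨m, hc, hd⟩ := exists_between hcd
    exact ext_one_eq_zero hc hd (fun x _ hx ↦ hF.right hx) (fun x hx _ ↦ hF.left hx) α
  | succ n ih =>
    have hS : (ShortComplex.mk (Injective.ι F) (cokernel.π (Injective.ι F))
      (cokernel.condition _)).ShortExact := { exact := ShortComplex.exact_cokernel _ }
    obtain ⟨β, rfl⟩ := Abelian.Ext.covariant_sequence_exact₁ _ hS α
      (Abelian.Ext.eq_zero_of_injective _) (n₀ := n + 1) rfl
    rw [ih ((germsExtend_of_injective _).of_epi (cokernel.π (Injective.ι F))) β,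
      Abelian.Ext.zero_comp]

/-- Intervals have cohomological dimension at most one: a quotient of an injective sheaf has no
higher cohomology on them. -/
lemma ext_eq_zero_of_two_le (F : ShR k) {c d : ℝ} (hcd : c < d) (n : ℕ)
    (α : Abelian.Ext.{w} ((freeSheaf k).obj (openInterval c d)) F (n + 2)) : α = 0 := by
  have hS : (ShortComplex.mk (Injective.ι F) (cokernel.π (Injective.ι F))
    (cokernel.condition _)).ShortExact := { exact := ShortComplex.exact_cokernel _ }
  obtain ⟨β, rfl⟩ := Abelian.Ext.covariant_sequence_exact₁ _ hS α
    (Abelian.Ext.eq_zero_of_injective _) (n₀ := n + 1) rfl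
  rw [((germsExtend_of_injective _).of_epi (cokernel.π (Injective.ι F))).ext_eq_zero hcd n β,
    Abelian.Ext.zero_comp]

end Vanishing

/-! ### Sections of `k_Z` -/

section ExtSections

variable {k : Type u} [Field k]

/-- `Z` is closed near the points of `W`: every point of `W` outside of `Z` has a neighbourhood
which does not meet `Z`. -/
def ClosedOn (Z W : Set ℝ) : Prop := ∀ y ∈ W, y ∉ Z → ∀ᶠ z in 𝓝 y, z ∉ Z

lemma ClosedOn.mono {Z V W : Set ℝ} (h : ClosedOn Z W) (hVW : V ⊆ W) : ClosedOn Z V :=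
  fun y hy ↦ h y (hVW hy)

lemma indicator_mem_extSections {Z : Set ℝ} {W : Opens ℝ} {c : k} (h : c = 0 ∨ ClosedOn Z W) :
    (fun y : W ↦ Z.indicator (fun _ ↦ c) (y : ℝ)) ∈ extSections k Z W := by
  intro x
  refine ⟨fun hx ↦ Set.indicator_of_notMem hx _, ?_⟩
  by_cases hx : (x : ℝ) ∈ Z
  · exact Filter.Eventually.of_forall fun y hy ↦
      (Set.indicator_of_mem hy fun _ ↦ c).trans (Set.indicator_of_mem hx fun _ ↦ c).symm
  · rcases h with rfl | h
    · exact Filter.Eventually.of_forall fun y _ ↦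
        (congrFun (Set.indicator_zero k Z) y).trans (congrFun (Set.indicator_zero k Z) x).symm
    · filter_upwards [continuous_subtype_val.continuousAt.eventually (h x x.2 hx)] with y hy hy'
      exact absurd hy' hy

lemma exists_openInterval_forall {Z : Set ℝ} {W : Opens ℝ} {f : W → k}
    (hf : f ∈ extSections k Z W) {x : ℝ} (hx : x ∈ W) :
    ∃ p q, p < x ∧ x < q ∧ ∃ h : openInterval p q ≤ W,
      ∀ y (hy : y ∈ openInterval p q), y ∈ Z → f ⟨y, h hy⟩ = f ⟨x, hx⟩ := by
  have h := (hf ⟨x, hx⟩).2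
  rw [nhds_subtype_eq_comap, Filter.eventually_comap] at h
  obtain ⟨p, q, hx', hpq⟩ := mem_nhds_iff_exists_Ioo_subset.1
    (Filter.inter_mem h (W.2.mem_nhds hx))
  exact ⟨p, q, hx'.1, hx'.2, fun y hy ↦ (hpq hy).2, fun y hy hyZ ↦ (hpq hy).1 ⟨y, _⟩ rfl hyZ⟩

/-- The condition on points `x ∈ Z` in `germsExtendRight_extSheaf` and `germsExtendLeft_extSheaf`, in
the form used for a section `f`: for `x ∉ Z` its value is `0` and there is no condition. -/
lemma eq_zero_or_closedOn {Z : Set ℝ} {W : Opens ℝ} {f : W → k} (hf : f ∈ extSections k Z W)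
    (x : W) {P : ℝ → Prop} {V : ℝ → Set ℝ} (hP : ∃ p, P p)
    (h : (x : ℝ) ∈ Z → ∃ p, P p ∧ ClosedOn Z (V p)) :
    ∃ p, P p ∧ (f x = 0 ∨ ClosedOn Z (V p)) := by
  by_cases hx : (x : ℝ) ∈ Z
  · obtain ⟨p, hp, hp'⟩ := h hx
    exact ⟨p, hp, Or.inr hp'⟩
  · obtain ⟨p, hp⟩ := hP
    exact ⟨p, hp, Or.inl ((hf x).1 hx)⟩

/-- A germ of `k_Z` extends to the right as a constant function on `Z` if `Z` is closed near the
points on the right. -/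
lemma germsExtendRight_extSheaf {Z : Set ℝ} {x d : ℝ} (hd : x < d)
    (h : x ∈ Z → ∃ p, p < x ∧ ClosedOn Z (Set.Ioo p d)) :
    GermsExtendRight (extSheaf k Z) d x := by
  intro W hx f
  obtain ⟨p, q, hp, hq, hpq, hf⟩ := exists_openInterval_forall f.2 hx
  obtain ⟨p', hp', h'⟩ := eq_zero_or_closedOn f.2 ⟨x, hx⟩ (V := fun p ↦ Set.Ioo p d)
    (exists_lt x) h
  refine ⟨max p p', min q d, max_lt hp hp', lt_min hq hd,
    (openInterval_mono (le_max_left _ _) (min_le_left _ _)).trans hpq, min_le_right _ _,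
    ⟨_, indicator_mem_extSections (c := f.1 ⟨x, hx⟩) (h'.imp id fun h' ↦ h'.mono
      (Set.Ioo_subset_Ioo (le_max_right _ _) le_rfl))⟩, Subtype.ext (funext fun y ↦ ?_)⟩
  have hy : (y : ℝ) ∈ openInterval p q :=
    openInterval_mono (le_max_left _ _) (min_le_left _ _) y.2
  change Z.indicator (fun _ ↦ f.1 ⟨x, hx⟩) (y : ℝ) = f.1 ⟨y, hpq hy⟩
  by_cases hyZ : (y : ℝ) ∈ Z
  · rw [Set.indicator_of_mem hyZ, hf y hy hyZ]
  · rw [Set.indicator_of_notMem hyZ]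
    exact ((f.2 ⟨y, hpq hy⟩).1 hyZ).symm

/-- The mirror image of `germsExtendRight_extSheaf`. -/
lemma germsExtendLeft_extSheaf {Z : Set ℝ} {x c : ℝ} (hc : c < x)
    (h : x ∈ Z → ∃ q, x < q ∧ ClosedOn Z (Set.Ioo c q)) :
    GermsExtendLeft (extSheaf k Z) c x := by
  intro W hx f
  obtain ⟨p, q, hp, hq, hpq, hf⟩ := exists_openInterval_forall f.2 hx
  obtain ⟨q', hq', h'⟩ := eq_zero_or_closedOn f.2 ⟨x, hx⟩ (V := fun q ↦ Set.Ioo c q)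
    (exists_gt x) h
  refine ⟨max p c, min q q', max_lt hp hc, lt_min hq hq',
    (openInterval_mono (le_max_left _ _) (min_le_left _ _)).trans hpq, le_max_right _ _,
    ⟨_, indicator_mem_extSections (c := f.1 ⟨x, hx⟩) (h'.imp id fun h' ↦ h'.mono
      (Set.Ioo_subset_Ioo le_rfl (min_le_right _ _)))⟩, Subtype.ext (funext fun y ↦ ?_)⟩
  have hy : (y : ℝ) ∈ openInterval p q :=
    openInterval_mono (le_max_left _ _) (min_le_left _ _) y.2
  change Z.indicator (fun _ ↦ f.1 ⟨x, hx⟩) (y : ℝ) = f.1 ⟨y, hpq hy⟩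
  by_cases hyZ : (y : ℝ) ∈ Z
  · rw [Set.indicator_of_mem hyZ, hf y hy hyZ]
  · rw [Set.indicator_of_notMem hyZ]
    exact ((f.2 ⟨y, hpq hy⟩).1 hyZ).symm

/-- Over an interval, the sections of `k_Z` are constant on `Z`. -/
lemma extSections_eq {Z : Set ℝ} (hZ : Z.OrdConnected) {c d : ℝ} {f : openInterval c d → k}
    (hf : f ∈ extSections k Z (openInterval c d)) {x y : openInterval c d} (hx : (x : ℝ) ∈ Z)
    (hy : (y : ℝ) ∈ Z) : f x = f y := by
  classical
  let _ : TopologicalSpace k := ⊥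
  have : DiscreteTopology k := ⟨rfl⟩
  have hpre : IsPreconnected (Z ∩ Set.Ioo c d) := (hZ.inter Set.ordConnected_Ioo).isPreconnected
  let g : ℝ → k := fun t ↦ if h : t ∈ openInterval c d then f ⟨t, h⟩ else 0
  have hg : ∀ t : openInterval c d, g t = f t := fun t ↦ dif_pos t.2
  have hcont : ContinuousOn g (Z ∩ Set.Ioo c d) := by
    intro t ht
    have hev : ∀ᶠ z in 𝓝[Z ∩ Set.Ioo c d] t, g z = g t := by
      obtain ⟨p, q, hp, hq, hpq, hfpq⟩ := exists_openInterval_forall hf ht.2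
      filter_upwards [self_mem_nhdsWithin, mem_nhdsWithin_of_mem_nhds (Ioo_mem_nhds hp hq)]
        with z hz hz'
      exact (hg ⟨z, hz.2⟩).trans ((hfpq z hz' hz.1).trans (hg ⟨t, ht.2⟩).symm)
    exact tendsto_nhds_of_eventually_eq hev
  rw [← hg, ← hg]
  exact hpre.constant hcont ⟨hx, x.2⟩ ⟨hy, y.2⟩

/-- `Z` meets `W` and it is closed near the points of `W`. If `Z` and `W` are intervals, this means
that `k_Z` has non-zero sections over `W`. -/
def IsFull (Z W : Set ℝ) : Prop := (Z ∩ W).Nonempty ∧ ClosedOn Z W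

lemma extSections_eq_zero {Z : Set ℝ} (hZ : Z.OrdConnected) {c d : ℝ}
    (h : ¬ IsFull Z (Set.Ioo c d)) {f : openInterval c d → k}
    (hf : f ∈ extSections k Z (openInterval c d)) : f = 0 := by
  funext x
  by_cases hx : (x : ℝ) ∈ Z
  · have h' : ¬ ClosedOn Z (Set.Ioo c d) := fun h' ↦ h ⟨⟨x, hx, x.2⟩, h'⟩
    simp only [ClosedOn, not_forall] at h'
    obtain ⟨y, hy, hyZ, hy'⟩ := h'
    obtain ⟨p, q, hp, hq, hpq, hfpq⟩ := exists_openInterval_forall hf hy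
    obtain ⟨z, hz, hz'⟩ := ((Filter.not_eventually.1 hy').and_eventually
      (Ioo_mem_nhds hp hq)).exists
    have hzZ := not_not.1 hz
    rw [extSections_eq hZ hf hx (y := ⟨z, hpq hz'⟩) hzZ, hfpq z hz' hzZ, (hf _).1 hyZ]
    rfl
  · exact (hf x).1 hx

variable (k) in
/-- The value on `Z` of a section of `k_Z` over `W`, taken at a chosen point of `Z ∩ W`, and zero
if there is none. -/
def valueOn (Z : Set ℝ) (W : Opens ℝ) : extSections k Z W →ₗ[k] k := by
  classical
  exact if h : ∃ x : W, (x : ℝ) ∈ Z then LinearMap.proj h.choose ∘ₗ (extSections k Z W).subtype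
    else 0

lemma valueOn_eq {Z : Set ℝ} (hZ : Z.OrdConnected) {c d : ℝ}
    (f : extSections k Z (openInterval c d)) (x : openInterval c d) (hx : (x : ℝ) ∈ Z) :
    valueOn k Z _ f = f.1 x := by
  have h : ∃ x : openInterval c d, (x : ℝ) ∈ Z := ⟨x, hx⟩
  rw [valueOn, dif_pos h]
  exact extSections_eq hZ f.2 h.choose_spec hx

lemma valueOn_injective {Z : Set ℝ} (hZ : Z.OrdConnected) {c d : ℝ} :
    Function.Injective (valueOn k Z (openInterval c d)) := by
  rw [injective_iff_map_eq_zero]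
  intro f hf
  refine Subtype.ext (funext fun x ↦ ?_)
  by_cases hx : (x : ℝ) ∈ Z
  · rw [← valueOn_eq hZ f x hx, hf]
    rfl
  · exact (f.2 x).1 hx

lemma exists_valueOn_eq_one {Z : Set ℝ} (hZ : Z.OrdConnected) {c d : ℝ}
    (h : IsFull Z (Set.Ioo c d)) : ∃ f, valueOn k Z (openInterval c d) f = 1 := by
  obtain ⟨⟨x, hx, hx'⟩, h⟩ := h
  refine ⟨⟨_, indicator_mem_extSections (c := 1) (Or.inr h)⟩, ?_⟩
  rw [valueOn_eq hZ _ ⟨x, hx'⟩ hx]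
  exact Set.indicator_of_mem hx fun _ ↦ 1

variable (k) in
/-- Evaluation at the canonical section of `k_U`, which identifies `Hom(k_U, F)` with `F(U)`. -/
def homToSec (U : Opens ℝ) (F : ShR k) : ((freeSheaf k).obj U ⟶ F) →ₗ[k] F.obj.obj (op U) where
  toFun φ := onSec φ U (freeSheafHomEquiv k U _ (𝟙 _))
  map_add' _ _ := rfl
  map_smul' _ _ := rfl

lemma homToSec_apply (U : Opens ℝ) (F : ShR k) (φ : (freeSheaf k).obj U ⟶ F) :
    homToSec k U F φ = freeSheafHomEquiv k U F φ := by
  have h := freeSheafHomEquiv_comp (𝟙 ((freeSheaf k).obj U)) φ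
  rw [Category.id_comp] at h
  exact h.symm

end ExtSections

/-! ### Cohomology of `k_Z` on intervals -/

section Cohomology

variable {k : Type u} [Field k] [HasDerivedCategory.{w} (ShR k)]

lemma shiftedHom_eq_zero_of_neg (F G : ShR k) {n : ℤ} (hn : n < 0)
    (f : ShiftedHom ((DerivedCategory.singleFunctor (ShR k) 0).obj F)
      ((DerivedCategory.singleFunctor (ShR k) 0).obj G) n) : f = 0 := by
  let t := DerivedCategory.TStructure.t (C := ShR k)
  have h₁ : t.IsLE ((DerivedCategory.singleFunctor (ShR k) 0).obj F) 0 := inferInstance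
  have h₂ : t.IsGE ((DerivedCategory.singleFunctor (ShR k) 0).obj G) 0 := inferInstance
  have h₃ : t.IsGE (((DerivedCategory.singleFunctor (ShR k) 0).obj G)⟦n⟧) (-n) :=
    t.isGE_shift _ 0 n _ (by omega)
  exact t.zero f 0 (-n)

/-- The cohomology of `k_Z[-i]` in degree `n` vanishes if that of `k_Z` in degree `n - i` does. -/
lemma cohomology_eq_zero_of_shiftedHom {Z : Set ℝ} {U : Opens ℝ} {i n m : ℤ} (hm : -i + n = m)
    (h : ∀ f : ShiftedHom (freeObj k U)
      ((DerivedCategory.singleFunctor (ShR k) 0).obj (extSheaf k Z)) m, f = 0)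
    (α : Cohomology (extObj k Z (-i)) n U) : α = 0 := by
  let e := (shiftFunctorAdd' (DerivedCategory (ShR k)) (-i) n m hm).app
    ((DerivedCategory.singleFunctor (ShR k) 0).obj (extSheaf k Z))
  have := h (α ≫ e.inv)
  exact (Preadditive.IsIso.comp_right_eq_zero α e.inv).1 this

lemma cohomology_eq_zero_of_lt {Z : Set ℝ} {U : Opens ℝ} {i n : ℤ} (hn : n < i)
    (α : Cohomology (extObj k Z (-i)) n U) : α = 0 :=
  cohomology_eq_zero_of_shiftedHom rfl (shiftedHom_eq_zero_of_neg _ _ (by omega)) α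

lemma cohomology_eq_zero_of_ext {Z : Set ℝ} {U : Opens ℝ} {i n : ℤ} (m : ℕ)
    (hn : n = i + m)
    (h : have := hasExt_of_hasDerivedCategory (ShR k)
      ∀ β : Abelian.Ext.{w} ((freeSheaf k).obj U) (extSheaf k Z) m, β = 0)
    (α : Cohomology (extObj k Z (-i)) n U) : α = 0 := by
  have := hasExt_of_hasDerivedCategory (ShR k)
  refine cohomology_eq_zero_of_shiftedHom (m := m) (by omega) (fun f ↦ ?_) α
  rw [← Abelian.Ext.homEquiv.apply_symm_apply f, h (Abelian.Ext.homEquiv.symm f)]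
  exact Abelian.Ext.zero_hom _ _ _

lemma cohomology_eq_zero_of_two_le {Z : Set ℝ} {c d : ℝ} (hcd : c < d) {i n : ℤ} (hn : i + 2 ≤ n)
    (α : Cohomology (extObj k Z (-i)) n (openInterval c d)) : α = 0 := by
  obtain ⟨m, hm⟩ := Int.le.dest hn
  refine cohomology_eq_zero_of_ext (m + 2) (by push_cast; omega) ?_ α
  have := hasExt_of_hasDerivedCategory (ShR k)
  exact fun β ↦ ext_eq_zero_of_two_le _ hcd m β

/-- `H¹(]c, d[, k_Z) = 0` if `Z` is closed near the points on the right of each of its points beyond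
`m`, and near those on the left of each of its points before `m`. -/
lemma cohomology_eq_zero_of_closedOn {Z : Set ℝ} {c d : ℝ} (m : ℝ) (hc : c < m) (hd : m < d)
    (hR : ∀ x, m ≤ x → x < d → x ∈ Z → ∃ p, p < x ∧ ClosedOn Z (Set.Ioo p d))
    (hL : ∀ x, c < x → x ≤ m → x ∈ Z → ∃ q, x < q ∧ ClosedOn Z (Set.Ioo c q)) {i : ℤ}
    (α : Cohomology (extObj k Z (-i)) (i + 1) (openInterval c d)) : α = 0 := by
  refine cohomology_eq_zero_of_ext 1 (by simp) ?_ α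
  have := hasExt_of_hasDerivedCategory (ShR k)
  exact fun β ↦ ext_one_eq_zero hc hd
    (fun x hx hx' ↦ germsExtendRight_extSheaf hx' (hR x hx hx'))
    (fun x hx hx' ↦ germsExtendLeft_extSheaf hx (hL x hx hx')) β

variable (k) in
/-- Morphisms of sheaves are the same in the derived category. -/
def singleHomEquiv (F G : ShR k) : (F ⟶ G) ≃ₗ[k]
    ((DerivedCategory.singleFunctor (ShR k) 0).obj F ⟶
      (DerivedCategory.singleFunctor (ShR k) 0).obj G) :=
  LinearEquiv.ofBijective ((DerivedCategory.singleFunctor (ShR k) 0).mapLinearMap k) (by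
    rw [Functor.coe_mapLinearMap]
    exact ⟨Functor.map_injective _, Functor.map_surjective _⟩)

variable (k) in
/-- The isomorphism `H^i(U, k_Z[-i]) = k_Z(U)`. -/
def cohomologyEquiv (Z : Set ℝ) (i : ℤ) (U : Opens ℝ) :
    Cohomology (extObj k Z (-i)) i U ≃ₗ[k] extSections k Z U :=
  (Linear.homCongr k (Iso.refl (freeObj k U))
    ((shiftFunctorCompIsoId (DerivedCategory (ShR k)) (-i) i (neg_add_cancel i)).app
      ((DerivedCategory.singleFunctor (ShR k) 0).obj (extSheaf k Z)))) ≪≫ₗ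
  (singleHomEquiv k ((freeSheaf k).obj U) (extSheaf k Z)).symm ≪≫ₗ
  LinearEquiv.ofBijective (homToSec k U (extSheaf k Z)) (by
    rw [show ⇑(homToSec k U (extSheaf k Z)) = freeSheafHomEquiv k U (extSheaf k Z) from
      funext (homToSec_apply U _)]
    exact (freeSheafHomEquiv k U (extSheaf k Z)).bijective)

lemma cohomologyEquiv_restrict (Z : Set ℝ) (i : ℤ) {U V : Opens ℝ} (h : U ≤ V)
    (α : Cohomology (extObj k Z (-i)) i V) :
    cohomologyEquiv k Z i U (restrict _ i h α) =
      resSec (extSheaf k Z) h (cohomologyEquiv k Z i V α) := by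
  let e := (shiftFunctorCompIsoId (DerivedCategory (ShR k)) (-i) i (neg_add_cancel i)).app
      ((DerivedCategory.singleFunctor (ShR k) 0).obj (extSheaf k Z))
  obtain ⟨φ, hφ⟩ := (DerivedCategory.singleFunctor (ShR k) 0).map_surjective (α ≫ e.hom)
  have h₁ : ∀ {W : Opens ℝ} (β : Cohomology (extObj k Z (-i)) i W)
      (ψ : (freeSheaf k).obj W ⟶ extSheaf k Z),
      (DerivedCategory.singleFunctor (ShR k) 0).map ψ = β ≫ e.hom →
      cohomologyEquiv k Z i W β = freeSheafHomEquiv k W _ ψ := by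
    intro W β ψ hψ
    rw [← homToSec_apply]
    change homToSec k W _ ((singleHomEquiv k _ _).symm (Linear.homCongr k _ _ β)) = _
    refine congrArg _ ((LinearEquiv.symm_apply_eq _).2 ?_)
    refine Eq.trans ?_ hψ.symm
    exact (Linear.homCongr_apply _ _ _ _).trans (congrArg (· ≫ e.hom) (Category.id_comp β))
  rw [h₁ α φ hφ, h₁ _ (freeSheafMap k h ≫ φ), freeSheafHomEquiv_naturality]
  rw [Functor.map_comp, hφ, restrict_apply, Category.assoc]

variable (k) in
/-- The value on `Z` of a class in `H^i(U, k_Z[-i]) = k_Z(U)`. -/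
def valueFunctional (Z : Set ℝ) (i : ℤ) (U : Opens ℝ) :
    Module.Dual k (Cohomology (extObj k Z (-i)) i U) :=
  valueOn k Z U ∘ₗ (cohomologyEquiv k Z i U).toLinearMap

lemma valueFunctional_restrict {Z : Set ℝ} (hZ : Z.OrdConnected) (i : ℤ) {c d c' d' : ℝ}
    (h : openInterval c d ≤ openInterval c' d') (hne : (Z ∩ Set.Ioo c d).Nonempty) :
    (restrict _ i h).dualMap (valueFunctional k Z i (openInterval c d)) =
      valueFunctional k Z i (openInterval c' d') := by
  obtain ⟨x, hxZ, hx⟩ := hne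
  refine LinearMap.ext fun α ↦ ?_
  change valueOn k Z _ (cohomologyEquiv k Z i _ (restrict _ i h α)) =
    valueOn k Z _ (cohomologyEquiv k Z i _ α)
  rw [cohomologyEquiv_restrict, valueOn_eq hZ (cohomologyEquiv k Z i _ α) ⟨x, h hx⟩ hxZ]
  exact valueOn_eq hZ _ ⟨x, hx⟩ hxZ

lemma subsingleton_cohomology_of_not_isFull {Z : Set ℝ} (hZ : Z.OrdConnected) (i : ℤ) {c d : ℝ}
    (h : ¬ IsFull Z (Set.Ioo c d)) :
    Subsingleton (Cohomology (extObj k Z (-i)) i (openInterval c d)) := by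
  have : Subsingleton (extSections k Z (openInterval c d)) :=
    ⟨fun f g ↦ Subtype.ext ((extSections_eq_zero hZ h f.2).trans
      (extSections_eq_zero hZ h g.2).symm)⟩
  exact (cohomologyEquiv k Z i _).toEquiv.subsingleton

lemma valueFunctional_bijective {Z : Set ℝ} (hZ : Z.OrdConnected) (i : ℤ) {c d : ℝ}
    (h : IsFull Z (Set.Ioo c d)) :
    Function.Bijective (valueFunctional k Z i (openInterval c d)) := by
  refine ⟨(valueOn_injective hZ).comp (cohomologyEquiv k Z i _).injective, ?_⟩
  obtain ⟨f, hf⟩ := exists_valueOn_eq_one (k := k) hZ h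
  intro c
  refine ⟨c • (cohomologyEquiv k Z i _).symm f, ?_⟩
  have : valueFunctional k Z i (openInterval _ _) ((cohomologyEquiv k Z i _).symm f) = 1 := by
    refine Eq.trans ?_ hf
    exact congrArg (valueOn k Z _) (LinearEquiv.apply_symm_apply _ _)
  rw [map_smul, this, smul_eq_mul, mul_one]

end Cohomology

/-! ### Isomorphisms of Mayer-Vietoris systems -/

section Systems

variable {k : Type u} [Field k]

namespace MVSystem

/-- An isomorphism of Mayer-Vietoris systems from its components. -/
def isoMk {S T : MVSystem.{v} k} (φ : ∀ n, S.obj n ≅ T.obj n)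
    (comm : ∀ (n : ℤ) (s : PosVec),
      Functor.whiskerLeft (translation s.1) (φ (n + 1)).hom ≫ T.δ n s = S.δ n s ≫ (φ n).hom) :
    S ≅ T where
  hom := { app := fun n ↦ (φ n).hom, comm := comm }
  inv :=
    { app := fun n ↦ (φ n).inv
      comm := fun n s ↦ by
        rw [← cancel_mono (φ n).hom, Category.assoc, Category.assoc, Iso.inv_hom_id,
          Category.comp_id, ← comm, ← Category.assoc, ← Functor.whiskerLeft_comp, Iso.inv_hom_id,
          Functor.whiskerLeft_id']
        exact Category.id_comp _ }
  hom_inv_id := Hom.ext (funext fun n ↦ (φ n).hom_inv_id)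
  inv_hom_id := Hom.ext (funext fun n ↦ (φ n).inv_hom_id)

lemma isZero_obj {S : MVSystem.{v} k} {n : ℤ} (h : ∀ p, Subsingleton ((S.obj n).obj p)) :
    IsZero (S.obj n) :=
  Functor.isZero _ fun p ↦ by
    have := h p
    exact ModuleCat.isZero_of_subsingleton _

/-- Mayer-Vietoris systems which are zero outside of the degrees `i` and `i + 1` are isomorphic
if they are in these two degrees, compatibly with the one remaining connecting morphism. -/
lemma nonempty_iso {S T : MVSystem.{v} k} (i : ℤ)
    (hS : ∀ n, n ≠ i → n ≠ i + 1 → IsZero (S.obj n))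
    (hT : ∀ n, n ≠ i → n ≠ i + 1 → IsZero (T.obj n))
    (f : S.obj i ≅ T.obj i) (g : S.obj (i + 1) ≅ T.obj (i + 1))
    (comm : ∀ s : PosVec,
      Functor.whiskerLeft (translation s.1) g.hom ≫ T.δ i s = S.δ i s ≫ f.hom) :
    Nonempty (S ≅ T) := by
  obtain ⟨φ, hf, hg⟩ : ∃ φ : ∀ n, S.obj n ≅ T.obj n, φ i = f ∧ φ (i + 1) = g := by
    refine ⟨fun n ↦ if h : n = i then h ▸ f else
      if h' : n = i + 1 then h' ▸ g else (hS n h h').iso (hT n h h'), ?_, ?_⟩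
    · exact dif_pos rfl
    · exact (dif_neg (by omega)).trans (dif_pos rfl)
  refine ⟨isoMk φ fun n s ↦ ?_⟩
  by_cases hn : n = i
  · subst hn
    rw [hf, hg]
    exact comm s
  · by_cases hn' : n = i + 1
    · have h := hS (n + 1) (by omega) (by omega)
      exact (Functor.isZero _ fun p ↦ h.obj _ : IsZero ((S.obj (n + 1)).shift s.1)).eq_of_src _ _
    · exact (hT n hn hn').eq_of_tgt _ _

/-! ### Systems of the type of a death block -/

variable (S : MVSystem.{v} k) (i : ℤ) (p₀ : DeltaPlus)

/-- The connecting map `S_{i+1}(p₀ + s) → S_i(p₀)`. -/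
def δAt (s : PosVec) : (S.obj (i + 1)).obj (p₀.add s.1) ⟶ (S.obj i).obj p₀ := (S.δ i s).app p₀

/-- The composite `S_{i+1}(q) → S_{i+1}(p₀ + s) → S_i(p₀)` for `q ≤ p₀ + s`. -/
def transfer (s : PosVec) {q : DeltaPlus} (h : q ≤ p₀.add s.1) :
    (S.obj (i + 1)).obj q ⟶ (S.obj i).obj p₀ :=
  (S.obj (i + 1)).map (homOfLE h) ≫ S.δAt i p₀ s

lemma transfer_eq_of_le {s t : PosVec} (hst : s ≤ t) {q : DeltaPlus} (h : q ≤ p₀.add s.1)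
    (h' : q ≤ p₀.add t.1) : S.transfer i p₀ s h = S.transfer i p₀ t h' := by
  have e : (S.obj (i + 1)).map (homOfLE (DeltaPlus.add_le_add (le_refl p₀) hst)) ≫
      S.δAt i p₀ t = S.δAt i p₀ s := NatTrans.congr_app (S.δ_comp i s t hst) p₀
  rw [transfer, transfer, ← e, ← Category.assoc, ← Functor.map_comp]
  rfl

/-- By the compatibility of the connecting morphisms, the map to `S_i(p₀)` does not depend on the
choice of `s`. -/
lemma transfer_eq (s t : PosVec) {q : DeltaPlus} (h : q ≤ p₀.add s.1) (h' : q ≤ p₀.add t.1) :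
    S.transfer i p₀ s h = S.transfer i p₀ t h' := by
  let r : PosVec := ⟨s.1 ⊔ t.1, lt_sup_of_lt_left s.2.1, lt_sup_of_lt_left s.2.2⟩
  have hs : s ≤ r := (le_sup_left : s.1 ≤ s.1 ⊔ t.1)
  have ht : t ≤ r := (le_sup_right : t.1 ≤ s.1 ⊔ t.1)
  have hr : q ≤ p₀.add r.1 := h.trans (DeltaPlus.add_le_add le_rfl hs)
  rw [S.transfer_eq_of_le i p₀ hs h hr, S.transfer_eq_of_le i p₀ ht h' hr]

lemma map_transfer (s : PosVec) {q q' : DeltaPlus} (h : q ≤ q') (h' : q' ≤ p₀.add s.1) :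
    (S.obj (i + 1)).map (homOfLE h) ≫ S.transfer i p₀ s h' = S.transfer i p₀ s (h.trans h') := by
  rw [transfer, transfer, ← Category.assoc, ← Functor.map_comp]
  rfl

/-- If `p ≤ p₀`, the connecting morphism at `p` followed by the structure map to `p₀` is the
connecting morphism at `p₀`. -/
lemma δ_map_eq_transfer (s : PosVec) {p : DeltaPlus} (h : p ≤ p₀) :
    S.δAt i p s ≫ (S.obj i).map (homOfLE h) =
      S.transfer i p₀ s (DeltaPlus.add_le_add h le_rfl) :=
  ((S.δ i s).naturality (homOfLE h)).symm

/-- A vector `s` such that `q ≤ p₀ + s`. -/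
def bound (q : DeltaPlus) : PosVec :=
  ⟨((q.1.1 - p₀.1.1).toNNReal ⊔ 1, (q.1.2 - p₀.1.2).toNNReal ⊔ 1),
    lt_sup_of_lt_right one_pos, lt_sup_of_lt_right one_pos⟩

lemma le_add_bound (q : DeltaPlus) : q ≤ p₀.add (bound p₀ q).1 := by
  have h (x y : ℝ) : x ≤ y + ((x - y).toNNReal ⊔ 1 : ℝ≥0) := by
    have h₁ : x - y ≤ (x - y).toNNReal := Real.le_coe_toNNReal _
    have h₂ : (((x - y).toNNReal : ℝ≥0) : ℝ) ≤ ((x - y).toNNReal ⊔ 1 : ℝ≥0) :=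
      NNReal.coe_le_coe.2 le_sup_left
    linarith
  exact ⟨h _ _, h _ _⟩

/-- If `S_i` and `S_{i+1}` vanish at `p₀ + s_x` and `p₀ + s_y`, the connecting map
`S_{i+1}(p₀ + s) → S_i(p₀)` is an isomorphism, by exactness. -/
lemma transfer_bijective {s : PosVec} (hx : Subsingleton ((S.obj (i + 1)).obj (p₀.add s.x)))
    (hy : Subsingleton ((S.obj (i + 1)).obj (p₀.add s.y)))
    (hx' : Subsingleton ((S.obj i).obj (p₀.add s.x)))
    (hy' : Subsingleton ((S.obj i).obj (p₀.add s.y))) :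
    Function.Bijective (S.transfer i p₀ s (le_refl (p₀.add s.1))).hom := by
  have h : S.transfer i p₀ s (le_refl (p₀.add s.1)) = S.δAt i p₀ s := by
    have : (S.obj (i + 1)).map (homOfLE (le_refl (p₀.add s.1))) = 𝟙 _ := (S.obj (i + 1)).map_id _
    rw [transfer, this, Category.id_comp]
  rw [h]
  constructor
  · rw [injective_iff_map_eq_zero]
    intro v hv
    obtain ⟨w, rfl⟩ := (S.exact_second i s p₀ v).1 hv
    rw [Subsingleton.elim w 0, map_zero]
  · intro v
    exact (S.exact_first i s p₀ v).1 (Subsingleton.elim _ _)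

variable {S i p₀}

/-- The map `k^B(p) → k^{B'}(q)` which is the identity of `k` if `p ∈ B` and `q ∈ B'` and `0`
otherwise. -/
def blockHom {B B' : Set (ℝ × ℝ)} (hB : B.OrdConnected) (hB' : B'.OrdConnected)
    (p q : DeltaPlus) : (blockModule.{w} k B hB).obj p ⟶ (blockModule.{w} k B' hB').obj q :=
  ModuleCat.ofHom (idIf.{w} k (p.1 ∈ B) (q.1 ∈ B'))

lemma blockHom_comp {B B' B'' : Set (ℝ × ℝ)} (hB : B.OrdConnected) (hB' : B'.OrdConnected)
    (hB'' : B''.OrdConnected) {p q r : DeltaPlus} (h : q.1 ∈ B') :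
    blockHom.{u, w} (k := k) hB hB' p q ≫ blockHom.{u, w} hB' hB'' q r = blockHom hB hB'' p r :=
  ModuleCat.hom_ext (idIf_comp fun _ _ ↦ h)

lemma blockHom_self {B : Set (ℝ × ℝ)} (hB : B.OrdConnected) (p : DeltaPlus) :
    blockHom.{u, w} (k := k) hB hB p p = 𝟙 _ :=
  ModuleCat.hom_ext (idIf_self _)

lemma isIso_blockHom {B B' : Set (ℝ × ℝ)} (hB : B.OrdConnected) (hB' : B'.OrdConnected)
    {p q : DeltaPlus} (hp : p.1 ∈ B) (hq : q.1 ∈ B') :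
    IsIso (blockHom.{u, w} (k := k) hB hB' p q) :=
  ⟨blockHom hB' hB q p, (blockHom_comp hB hB' hB hq).trans (blockHom_self hB p),
    (blockHom_comp hB' hB hB' hp).trans (blockHom_self hB' q)⟩

/-- A Mayer-Vietoris system which is `k^B` in degree `i` and is concentrated in degree `i + 1` on
`B†`, for the death block `B` with corner `p₀`, is isomorphic to `S_i^B`. The isomorphism in degree
`i + 1` is determined by the connecting morphisms to the corner `p₀`. -/
theorem nonempty_iso_of_corner {S : MVSystem.{max u w} k}
    {D : ℤ → Set (ℝ × ℝ)} (hD : IsMVFamily D)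
    (hD₀ : ∀ p : DeltaPlus, p.1 ∈ D i ↔ p ≤ p₀)
    (hD₁ : ∀ p : DeltaPlus, p.1 ∈ D (i + 1) ↔ ∃ s : PosVec, p = p₀.add s.1)
    (hD₂ : ∀ n, n ≠ i → n ≠ i + 1 → ∀ p : DeltaPlus, p.1 ∉ D n)
    (hS₂ : ∀ n, n ≠ i → n ≠ i + 1 → ∀ p, Subsingleton ((S.obj n).obj p))
    (hS₁ : ∀ p : DeltaPlus, p.1 ∉ D (i + 1) → Subsingleton ((S.obj (i + 1)).obj p))
    (f : S.obj i ≅ blockModule.{w} k (D i) (hD.ordConnected i)) :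
    Nonempty (S ≅ familySystem.{w} k D hD) := by
  have hp₀ : p₀.1 ∈ D i := (hD₀ p₀).2 le_rfl
  have hzero : ∀ {n : ℤ} {p : DeltaPlus}, p.1 ∉ D n →
      Subsingleton ((blockModule.{w} k (D n) (hD.ordConnected n)).obj p) := fun h ↦
    ⟨fun x y ↦ (KIf.eq_zero h x).trans (KIf.eq_zero h y).symm⟩
  -- The isomorphism in degree `i + 1` is transported from the value of `f` at `p₀`.
  let g : S.obj (i + 1) ⟶ blockModule.{w} k (D (i + 1)) (hD.ordConnected (i + 1)) :=
    { app := fun q ↦ S.transfer i p₀ (bound p₀ q) (le_add_bound p₀ q) ≫ f.hom.app p₀ ≫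
        blockHom (hD.ordConnected i) (hD.ordConnected (i + 1)) p₀ q
      naturality := fun q q' hqq' ↦ by
        by_cases hq : q.1 ∈ D (i + 1)
        · have h₂ := S.map_transfer i p₀ (bound p₀ q') (leOfHom hqq') (le_add_bound p₀ q')
          rw [S.transfer_eq i p₀ _ (bound p₀ q) _ (le_add_bound p₀ q)] at h₂
          change (S.obj (i + 1)).map (homOfLE (leOfHom hqq')) ≫ _ = (_ ≫ _ ≫ _) ≫
            blockHom (hD.ordConnected (i + 1)) (hD.ordConnected (i + 1)) q q'
          rw [Category.assoc, Category.assoc, blockHom_comp _ _ _ hq, ← h₂, Category.assoc]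
        · have := hS₁ q hq
          exact (ModuleCat.isZero_of_subsingleton ((S.obj (i + 1)).obj q)).eq_of_src _ _ }
  have hg : IsIso g := by
    rw [NatTrans.isIso_iff_isIso_app]
    intro q
    by_cases hq : q.1 ∈ D (i + 1)
    · obtain ⟨s, rfl⟩ := (hD₁ q).1 hq
      have hs₁ : (0 : ℝ) < s.1.1 := s.2.1
      have hs₂ : (0 : ℝ) < s.1.2 := s.2.2
      have hnx : (p₀.add s.x).1 ∉ D (i + 1) := fun h ↦ by
        obtain ⟨t, ht⟩ := (hD₁ _).1 h
        have h₂ : p₀.1.2 + (0 : ℝ) = p₀.1.2 + t.1.2 := congrArg (fun p ↦ p.1.2) ht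
        have : (0 : ℝ) < t.1.2 := t.2.2
        linarith
      have hny : (p₀.add s.y).1 ∉ D (i + 1) := fun h ↦ by
        obtain ⟨t, ht⟩ := (hD₁ _).1 h
        have h₂ : p₀.1.1 + (0 : ℝ) = p₀.1.1 + t.1.1 := congrArg (fun p ↦ p.1.1) ht
        have : (0 : ℝ) < t.1.1 := t.2.1
        linarith
      have hnx' : (p₀.add s.x).1 ∉ D i := fun h ↦ by
        have : p₀.1.1 + s.1.1 ≤ p₀.1.1 := ((hD₀ _).1 h).1
        linarith
      have hny' : (p₀.add s.y).1 ∉ D i := fun h ↦ by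
        have : p₀.1.2 + s.1.2 ≤ p₀.1.2 := ((hD₀ _).1 h).2
        linarith
      have hS₀ : ∀ {p : DeltaPlus}, p.1 ∉ D i → Subsingleton ((S.obj i).obj p) := fun {p} h ↦ by
        have := hzero h
        exact (f.app p).toLinearEquiv.toEquiv.subsingleton
      have h₁ := S.transfer_bijective i p₀ (s := s) (hS₁ _ hnx) (hS₁ _ hny) (hS₀ hnx') (hS₀ hny')
      rw [S.transfer_eq i p₀ s _ _ (le_add_bound p₀ _)] at h₁
      have h₂ : IsIso (S.transfer i p₀ _ (le_add_bound p₀ (p₀.add s.1))) :=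
        (ConcreteCategory.isIso_iff_bijective _).2 h₁
      have h₃ : IsIso (blockHom.{u, w} (k := k) (hD.ordConnected i) (hD.ordConnected (i + 1)) p₀
        (p₀.add s.1)) := isIso_blockHom _ _ hp₀ hq
      dsimp only [g]
      infer_instance
    · have := hS₁ q hq
      have := hzero hq
      exact ⟨0, (ModuleCat.isZero_of_subsingleton _).eq_of_src _ _,
        (ModuleCat.isZero_of_subsingleton
          ((blockModule.{w} k (D (i + 1)) (hD.ordConnected (i + 1))).obj q)).eq_of_src _ _⟩
  refine nonempty_iso i (fun n hn hn' ↦ isZero_obj (hS₂ n hn hn'))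
    (fun n hn hn' ↦ isZero_obj (S := familySystem.{w} k D hD) fun p ↦ hzero (hD₂ n hn hn' p))
    f (@asIso _ _ _ _ g hg) fun s ↦ NatTrans.ext (funext fun p ↦ ?_)
  by_cases hp : p.1 ∈ D i
  · by_cases hps : (p.add s.1).1 ∈ D (i + 1)
    · have hle := (hD₀ p).1 hp
      have h₂ : f.hom.app p = (S.obj i).map (homOfLE hle) ≫ f.hom.app p₀ ≫
          blockHom (hD.ordConnected i) (hD.ordConnected i) p₀ p := by
        rw [← Category.assoc, f.hom.naturality, Category.assoc]
        have : (blockModule.{w} k (D i) (hD.ordConnected i)).map (homOfLE hle) ≫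
            blockHom (hD.ordConnected i) (hD.ordConnected i) p₀ p = 𝟙 _ :=
          (blockHom_comp _ _ _ hp₀).trans (blockHom_self _ _)
        rw [this, Category.comp_id]
      change (S.transfer i p₀ _ (le_add_bound p₀ (p.add s.1)) ≫ f.hom.app p₀ ≫
          blockHom (hD.ordConnected i) (hD.ordConnected (i + 1)) p₀ (p.add s.1)) ≫
        blockHom (hD.ordConnected (i + 1)) (hD.ordConnected i) (p.add s.1) p =
        S.δAt i p s ≫ f.hom.app p
      rw [h₂, ← Category.assoc (S.δAt i p s), S.δ_map_eq_transfer i p₀ s hle,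
        Category.assoc, Category.assoc, blockHom_comp _ _ _ hps,
        S.transfer_eq i p₀ s _ _ (le_add_bound p₀ (p.add s.1))]
    · have := hS₁ _ hps
      exact (ModuleCat.isZero_of_subsingleton ((S.obj (i + 1)).obj (p.add s.1))).eq_of_src _ _
  · have := hzero hp
    exact (ModuleCat.isZero_of_subsingleton
      ((blockModule.{w} k (D i) (hD.ordConnected i)).obj p)).eq_of_tgt _ _

end MVSystem

end Systems

/-! ### The system `Ψ(k_Z[-i])` in degree `i` -/

section Psi

variable {k : Type u} [Field k] [HasDerivedCategory.{w} (ShR k)]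

variable (k) in
/-- The map from `k^B` to the dual of `H^i(]-x, y[, k_Z[-i])` which sends `1` to the value on
`Z`. -/
def blockToDual (Z : Set ℝ) (i : ℤ) (B : Set (ℝ × ℝ)) (p : DeltaPlus) :
    KIf.{w} k (p.1 ∈ B) →ₗ[k] Module.Dual k (Cohomology (extObj k Z (-i)) i (window p)) := by
  classical
  exact if h : p.1 ∈ B then
    { toFun := fun c ↦ (c ⟨h⟩).down • valueFunctional k Z i (window p)
      map_add' := fun _ _ ↦ add_smul _ _ _
      map_smul' := fun _ _ ↦ mul_smul _ _ _ }
  else 0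

lemma blockToDual_apply {Z : Set ℝ} {i : ℤ} {B : Set (ℝ × ℝ)} {p : DeltaPlus} (h : p.1 ∈ B)
    (c : KIf.{w} k (p.1 ∈ B)) :
    blockToDual k Z i B p c = (c ⟨h⟩).down • valueFunctional k Z i (window p) := by
  rw [blockToDual, dif_pos h]
  rfl

lemma subsingleton_psiObj {F : DerivedCategory (ShR k)} {n : ℤ} {p : DeltaPlus}
    (h : ∀ α : Cohomology F n (window p), α = 0) : Subsingleton ((psiObj F n).obj p) :=
  ⟨fun (φ ψ : Module.Dual k (Cohomology F n (window p))) ↦ LinearMap.ext fun α ↦ by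
    rw [h α, map_zero, map_zero]⟩

section

variable {Z : Set ℝ} {B : Set (ℝ × ℝ)}

lemma blockToDual_bijective (hZ : Z.OrdConnected) (i : ℤ) {p : DeltaPlus}
    (hp : p.1 ∈ B ↔ IsFull Z (Set.Ioo (-p.1.1) p.1.2)) :
    Function.Bijective (blockToDual k Z i B p) := by
  by_cases hpB : p.1 ∈ B
  · have hbij : Function.Bijective (valueFunctional k Z i (window p)) :=
      valueFunctional_bijective hZ i (hp.1 hpB)
    obtain ⟨e, he⟩ := hbij.2 1
    constructor
    · intro c c' hcc'
      rw [blockToDual_apply hpB, blockToDual_apply hpB] at hcc'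
      have h := LinearMap.congr_fun hcc' e
      rw [LinearMap.smul_apply, LinearMap.smul_apply, he, smul_eq_mul, smul_eq_mul, mul_one,
        mul_one] at h
      exact funext fun _ ↦ ULift.down_injective h
    · intro φ
      refine ⟨fun _ ↦ ⟨φ e⟩, LinearMap.ext fun α ↦ ?_⟩
      have hα : α = valueFunctional k Z i (window p) α • e := hbij.1 (by
        rw [map_smul, he, smul_eq_mul, mul_one])
      have hφ : φ α = valueFunctional k Z i (window p) α * φ e := by
        conv_lhs => rw [hα]
        rw [map_smul, smul_eq_mul]
      rw [blockToDual_apply hpB, hφ, LinearMap.smul_apply, smul_eq_mul, mul_comm]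
  · have := subsingleton_cohomology_of_not_isFull (k := k) hZ i (mt hp.2 hpB)
    refine ⟨fun c c' _ ↦ (KIf.eq_zero hpB c).trans (KIf.eq_zero hpB c').symm,
      fun φ ↦ ⟨0, LinearMap.ext fun α ↦ ?_⟩⟩
    have hα : α = 0 := this.elim α 0
    rw [hα, map_zero, map_zero]

lemma blockToDual_natural (hZ : Z.OrdConnected) (i : ℤ)
    (hBZ : ∀ p : DeltaPlus, p.1 ∈ B ↔ IsFull Z (Set.Ioo (-p.1.1) p.1.2))
    {p q : DeltaPlus} (hpq : p ≤ q) (c : KIf.{w} k (p.1 ∈ B)) :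
    blockToDual k Z i B q (idIf.{w} k (p.1 ∈ B) (q.1 ∈ B) c) =
      (restrict _ i (window_mono hpq)).dualMap (blockToDual k Z i B p c) := by
  by_cases hq : q.1 ∈ B
  · by_cases hp : p.1 ∈ B
    · rw [blockToDual_apply hq, blockToDual_apply hp, idIf_pos hp, map_smul]
      exact congrArg _ (valueFunctional_restrict hZ i _ ((hBZ p).1 hp).1).symm
    · rw [KIf.eq_zero hp c, map_zero, map_zero, map_zero, map_zero]
  · have := subsingleton_cohomology_of_not_isFull (k := k) hZ i (mt (hBZ q).2 hq)
    refine LinearMap.ext fun α ↦ ?_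
    have hα : α = 0 := this.elim α 0
    rw [hα, map_zero, map_zero]

/-- `Ψ(k_Z[-i])_i = k^B`, if `B` consists of the points `(x, y)` such that `k_Z` has non-zero
sections over `]-x, y[`. -/
def blockIso (hZ : Z.OrdConnected) (i : ℤ) (hB : B.OrdConnected)
    (hBZ : ∀ p : DeltaPlus, p.1 ∈ B ↔ IsFull Z (Set.Ioo (-p.1.1) p.1.2)) :
    blockModule.{w} k B hB ≅ psiObj (extObj k Z (-i)) i :=
  NatIso.ofComponents
    (fun p ↦ (LinearEquiv.ofBijective (blockToDual k Z i B p)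
      (blockToDual_bijective hZ i (hBZ p))).toModuleIso)
    fun hpq ↦ ModuleCat.hom_ext (LinearMap.ext fun c ↦
      blockToDual_natural hZ i hBZ (leOfHom hpq) c)

end

lemma subsingleton_psi_obj {Z : Set ℝ} {i n : ℤ} (hn : n ≠ i) (hn' : n ≠ i + 1) (p : DeltaPlus) :
    Subsingleton (((psi (extObj k Z (-i))).obj n).obj p) := by
  refine subsingleton_psiObj fun α ↦ ?_
  have hp := p.2
  rcases lt_or_gt_of_ne hn with h | h
  · exact cohomology_eq_zero_of_lt h α
  · exact cohomology_eq_zero_of_two_le (by linarith) (by omega) α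

/-- `Ψ(k_Z[-i]) = S_i^B` if `k_Z` has no cohomology in degree `1` on intervals. -/
theorem nonempty_psi_iso_of_acyclic {Z : Set ℝ} (hZ : Z.OrdConnected) (i : ℤ)
    {D : ℤ → Set (ℝ × ℝ)} (hD : IsMVFamily D)
    (hD₀ : ∀ p : DeltaPlus, p.1 ∈ D i ↔ IsFull Z (Set.Ioo (-p.1.1) p.1.2))
    (hD₁ : ∀ n, n ≠ i → ∀ p, p ∉ D n)
    (h : ∀ (p : DeltaPlus) (α : Cohomology (extObj k Z (-i)) (i + 1) (window p)), α = 0) :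
    Nonempty (psi (extObj k Z (-i)) ≅ familySystem.{w} k D hD) := by
  have hT : ∀ n, n ≠ i → IsZero ((familySystem.{w} k D hD).obj n) := fun n hn ↦
    MVSystem.isZero_obj (S := familySystem.{w} k D hD) fun p ↦
      ⟨fun x y ↦ (KIf.eq_zero (hD₁ n hn _) x).trans (KIf.eq_zero (hD₁ n hn _) y).symm⟩
  have hS : IsZero ((psi (extObj k Z (-i))).obj (i + 1)) :=
    MVSystem.isZero_obj fun p ↦ subsingleton_psiObj (h p)
  refine MVSystem.nonempty_iso i
    (fun n hn hn' ↦ MVSystem.isZero_obj (subsingleton_psi_obj hn hn')) (fun n hn _ ↦ hT n hn)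
    (blockIso hZ i (hD.ordConnected i) hD₀).symm (hS.iso (hT _ (by omega))) fun s ↦ ?_
  exact (Functor.isZero _ fun p ↦ hS.obj _ :
    IsZero (((psi (extObj k Z (-i))).obj (i + 1)).shift s.1)).eq_of_src _ _

end Psi

/-! ### Bounded intervals -/

section Intervals

variable {Z W : Set ℝ} {a b c d : ℝ}

lemma closedOn_of_subset_Icc (hZ : Z ⊆ Set.Icc a b) (hW : ∀ y ∈ W, y ∈ Set.Icc a b → y ∈ Z) :
    ClosedOn Z W := fun y hy hyZ ↦ by
  filter_upwards [isClosed_Icc.isOpen_compl.mem_nhds (mt (hW y hy) hyZ)] with z hz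
  exact mt (@hZ z) hz

lemma ClosedOn.left_notMem (h : ClosedOn Z W) (hab : a < b) (hZ : Set.Ioo a b ⊆ Z) (ha : a ∉ Z) :
    a ∉ W := fun haW ↦ by
  have h₁ : ∀ᶠ z in 𝓝[>] a, z ∉ Z := (h a haW ha).filter_mono nhdsWithin_le_nhds
  obtain ⟨z, hz, hz'⟩ := (h₁.and (Ioo_mem_nhdsGT hab)).exists
  exact hz (hZ hz')

lemma ClosedOn.right_notMem (h : ClosedOn Z W) (hab : a < b) (hZ : Set.Ioo a b ⊆ Z) (hb : b ∉ Z) :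
    b ∉ W := fun hbW ↦ by
  have h₁ : ∀ᶠ z in 𝓝[<] b, z ∉ Z := (h b hbW hb).filter_mono nhdsWithin_le_nhds
  obtain ⟨z, hz, hz'⟩ := (h₁.and (Ioo_mem_nhdsLT hab)).exists
  exact hz (hZ hz')

lemma isFull_Ioo_iff (hab : a < b) (hcd : c < d) :
    IsFull (Set.Ioo a b) (Set.Ioo c d) ↔ a ≤ c ∧ d ≤ b := by
  constructor
  · rintro ⟨⟨z, ⟨h₁, h₂⟩, h₃, h₄⟩, h⟩
    have ha := h.left_notMem hab subset_rfl fun h ↦ h.1.false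
    have hb := h.right_notMem hab subset_rfl fun h ↦ h.2.false
    exact ⟨not_lt.1 fun h ↦ ha ⟨h, h₁.trans h₄⟩, not_lt.1 fun h ↦ hb ⟨h₃.trans h₂, h⟩⟩
  · rintro ⟨h₁, h₂⟩
    obtain ⟨z, hz⟩ := exists_between hcd
    exact ⟨⟨z, Set.Ioo_subset_Ioo h₁ h₂ hz, hz⟩,
      closedOn_of_subset_Icc Set.Ioo_subset_Icc_self fun y hy _ ↦ Set.Ioo_subset_Ioo h₁ h₂ hy⟩

lemma isFull_Ioc_iff (hab : a < b) (hcd : c < d) :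
    IsFull (Set.Ioc a b) (Set.Ioo c d) ↔ a ≤ c ∧ c < b := by
  constructor
  · rintro ⟨⟨z, ⟨h₁, h₂⟩, h₃, h₄⟩, h⟩
    have ha := h.left_notMem hab Set.Ioo_subset_Ioc_self fun h ↦ h.1.false
    exact ⟨not_lt.1 fun h ↦ ha ⟨h, h₁.trans h₄⟩, h₃.trans_le h₂⟩
  · rintro ⟨h₁, h₂⟩
    obtain ⟨z, hz, hz'⟩ := exists_between (lt_min hcd h₂)
    exact ⟨⟨z, ⟨h₁.trans_lt hz, (lt_min_iff.1 hz').2.le⟩, hz, (lt_min_iff.1 hz').1⟩,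
      closedOn_of_subset_Icc Set.Ioc_subset_Icc_self fun y hy hy' ↦ ⟨h₁.trans_lt hy.1, hy'.2⟩⟩

lemma isFull_Ico_iff (hab : a < b) (hcd : c < d) :
    IsFull (Set.Ico a b) (Set.Ioo c d) ↔ a < d ∧ d ≤ b := by
  constructor
  · rintro ⟨⟨z, ⟨h₁, h₂⟩, h₃, h₄⟩, h⟩
    have hb := h.right_notMem hab Set.Ioo_subset_Ico_self fun h ↦ h.2.false
    exact ⟨h₁.trans_lt h₄, not_lt.1 fun h ↦ hb ⟨h₃.trans h₂, h⟩⟩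
  · rintro ⟨h₁, h₂⟩
    obtain ⟨z, hz, hz'⟩ := exists_between (max_lt hcd h₁)
    exact ⟨⟨z, ⟨(max_lt_iff.1 hz).2.le, hz'.trans_le h₂⟩, (max_lt_iff.1 hz).1, hz'⟩,
      closedOn_of_subset_Icc Set.Ico_subset_Icc_self fun y hy hy' ↦ ⟨hy'.1, hy.2.trans_le h₂⟩⟩

lemma isFull_Icc_iff (hab : a ≤ b) (hcd : c < d) :
    IsFull (Set.Icc a b) (Set.Ioo c d) ↔ c < b ∧ a < d := by
  constructor
  · rintro ⟨⟨z, ⟨h₁, h₂⟩, h₃, h₄⟩, -⟩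
    exact ⟨h₃.trans_le h₂, h₁.trans_lt h₄⟩
  · rintro ⟨h₁, h₂⟩
    refine ⟨?_, closedOn_of_subset_Icc subset_rfl fun _ _ h ↦ h⟩
    rcases lt_or_ge c a with h | h
    · exact ⟨a, ⟨le_rfl, hab⟩, h, h₂⟩
    · obtain ⟨z, hz, hz'⟩ := exists_between (lt_min hcd h₁)
      exact ⟨z, ⟨h.trans hz.le, (lt_min_iff.1 hz').2.le⟩, hz, (lt_min_iff.1 hz').1⟩

variable {k : Type u} [Field k] [HasDerivedCategory.{w} (ShR k)] {i : ℤ}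

lemma cohomology_eq_zero_of_closedOn_self (hcd : c < d) (h : ClosedOn Z (Set.Ioo c d))
    (α : Cohomology (extObj k Z (-i)) (i + 1) (openInterval c d)) : α = 0 := by
  obtain ⟨m, hm, hm'⟩ := exists_between hcd
  exact cohomology_eq_zero_of_closedOn m hm hm' (fun x hx _ _ ↦ ⟨c, hm.trans_le hx, h⟩)
    (fun x _ hx _ ↦ ⟨d, hx.trans_lt hm', h⟩) α

/-- If `Z` agrees with `]a, b]` on `]c, d[`, the sections of `k_Z` near points of `Z` extend by
constants to the right, and there are none to the left of `a`. -/
lemma cohomology_eq_zero_of_subset_Ioc (hcd : c < d) (hZ : Z ⊆ Set.Ioc a b)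
    (h : ∀ y ∈ Set.Ioo c d, y ∈ Set.Ioc a b → y ∈ Z)
    (α : Cohomology (extObj k Z (-i)) (i + 1) (openInterval c d)) : α = 0 := by
  have hZ' : Z ⊆ Set.Icc a b := hZ.trans Set.Ioc_subset_Icc_self
  by_cases ha : a ∈ Set.Ioo c d
  · refine cohomology_eq_zero_of_closedOn a ha.1 ha.2 (fun x _ _ hxZ ↦ ⟨a, (hZ hxZ).1, ?_⟩)
      (fun x _ hx hxZ ↦ ((hZ hxZ).1.not_ge hx).elim) α
    exact closedOn_of_subset_Icc hZ' fun y hy hy' ↦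
      h y ⟨ha.1.trans hy.1, hy.2⟩ ⟨hy.1, hy'.2⟩
  · refine cohomology_eq_zero_of_closedOn_self hcd (closedOn_of_subset_Icc hZ' fun y hy hy' ↦
      h y hy ⟨lt_of_le_of_ne hy'.1 ?_, hy'.2⟩) α
    rintro rfl
    exact ha hy

/-- If `Z` agrees with `[a, b[` on `]c, d[`, the sections of `k_Z` near points of `Z` extend by
constants to the left, and there are none to the right of `b`. -/
lemma cohomology_eq_zero_of_subset_Ico (hcd : c < d) (hZ : Z ⊆ Set.Ico a b)
    (h : ∀ y ∈ Set.Ioo c d, y ∈ Set.Ico a b → y ∈ Z)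
    (α : Cohomology (extObj k Z (-i)) (i + 1) (openInterval c d)) : α = 0 := by
  have hZ' : Z ⊆ Set.Icc a b := hZ.trans Set.Ico_subset_Icc_self
  by_cases hb : b ∈ Set.Ioo c d
  · refine cohomology_eq_zero_of_closedOn b hb.1 hb.2
      (fun x hx _ hxZ ↦ ((hZ hxZ).2.not_ge hx).elim) (fun x _ _ hxZ ↦ ⟨b, (hZ hxZ).2, ?_⟩) α
    exact closedOn_of_subset_Icc hZ' fun y hy hy' ↦
      h y ⟨hy.1, hy.2.trans hb.2⟩ ⟨hy'.1, hy.2⟩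
  · refine cohomology_eq_zero_of_closedOn_self hcd (closedOn_of_subset_Icc hZ' fun y hy hy' ↦
      h y hy ⟨hy'.1, lt_of_le_of_ne hy'.2 ?_⟩) α
    rintro rfl
    exact hb hy

end Intervals

/-! ### The blocks of an interval -/

section Blocks

variable {a b : ℝ} {i : ℤ}

lemma mem_downRay_true {a x : ℝ} : x ∈ downRay a true ↔ x ≤ a := by
  rw [le_iff_lt_or_eq]
  exact or_congr_right (and_iff_right rfl)

lemma mem_upRay_false {a x : ℝ} : x ∈ upRay a false ↔ a < x :=
  or_iff_left fun h ↦ Bool.false_ne_true h.1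

lemma mem_segment_false_true {a b x : ℝ} :
    x ∈ segment a (b : WithTop ℝ) false true ↔ a < x ∧ x ≤ b := by
  refine and_congr mem_upRay_false ?_
  rw [WithTop.coe_lt_coe, WithTop.coe_inj, le_iff_lt_or_eq]
  exact or_congr_right (and_iff_right rfl)

lemma mem_single_self {B : Set (ℝ × ℝ)} {p : ℝ × ℝ} : p ∈ single i B i ↔ p ∈ B :=
  and_iff_right rfl

lemma notMem_single {B : Set (ℝ × ℝ)} {n : ℤ} (hn : n ≠ i) (p : ℝ × ℝ) : p ∉ single i B n :=
  fun h ↦ hn h.1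

lemma mem_double_self {B B' : Set (ℝ × ℝ)} {p : ℝ × ℝ} : p ∈ double i B B' i ↔ p ∈ B := by
  refine (or_iff_left ?_).trans (and_iff_right rfl)
  rintro ⟨h, -⟩
  omega

lemma mem_double_succ {B B' : Set (ℝ × ℝ)} {p : ℝ × ℝ} :
    p ∈ double i B B' (i + 1) ↔ p ∈ B' := by
  refine (or_iff_right ?_).trans (and_iff_right rfl)
  rintro ⟨h, -⟩
  omega

lemma deathBlock_family (hab : a < b) : (deathBlock a b true true).family i =
    double i (Block.death (-a) b true true).toSet (Block.birth (-a) b false false).toSet :=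
  if_pos (by linarith)

lemma birthBlock_family (hab : a ≤ b) : (birthBlock a b false false).family i =
    single i (Block.birth (-b) a false false).toSet :=
  if_pos (by linarith)

variable (k : Type u) [Field k] [HasDerivedCategory.{w} (ShR k)]

lemma neg_fst_lt_snd (p : DeltaPlus) : -p.1.1 < p.1.2 := neg_lt_iff_pos_add'.2 p.2

theorem nonempty_psi_iso_deathBlock (hab : a < b) :
    Nonempty (psi (extObj k (Set.Ioo a b) (-i)) ≅ (deathBlock a b true true).system k i) := by
  have hmem : ∀ p : DeltaPlus, p.1 ∈ (deathBlock a b true true).family i i ↔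
      p.1.1 ≤ -a ∧ p.1.2 ≤ b := fun p ↦ by
    rw [deathBlock_family hab, mem_double_self]
    exact and_congr mem_downRay_true mem_downRay_true
  have hmem' : ∀ p : DeltaPlus, p.1 ∈ (deathBlock a b true true).family i (i + 1) ↔
      -a < p.1.1 ∧ b < p.1.2 := fun p ↦ by
    rw [deathBlock_family hab, mem_double_succ]
    exact and_congr mem_upRay_false mem_upRay_false
  let p₀ : DeltaPlus := ⟨(-a, b), by change 0 < -a + b; linarith⟩
  refine MVSystem.nonempty_iso_of_corner (p₀ := p₀)
    ((deathBlock a b true true).isMVFamily i) hmem (fun p ↦ (hmem' p).trans ?_) ?_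
    (fun n hn hn' ↦ subsingleton_psi_obj hn hn') (fun p hp ↦ subsingleton_psiObj fun α ↦ ?_)
    (blockIso Set.ordConnected_Ioo i _ fun p ↦ ?_).symm
  · constructor
    · rintro ⟨h₁, h₂⟩
      refine ⟨⟨(⟨p.1.1 + a, by linarith⟩, ⟨p.1.2 - b, by linarith⟩), ?_, ?_⟩, ?_⟩
      · change 0 < p.1.1 + a
        linarith
      · change 0 < p.1.2 - b
        linarith
      · refine Subtype.ext (Prod.ext ?_ ?_)
        · change p.1.1 = -a + (p.1.1 + a)
          ring
        · change p.1.2 = b + (p.1.2 - b)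
          ring
    · rintro ⟨s, rfl⟩
      have h₁ : (0 : ℝ) < s.1.1 := s.2.1
      have h₂ : (0 : ℝ) < s.1.2 := s.2.2
      exact ⟨lt_add_of_pos_right _ h₁, lt_add_of_pos_right _ h₂⟩
  · intro n hn hn' p
    rw [deathBlock_family hab]
    rintro (h | h)
    · exact hn h.1
    · exact hn' h.1
  · -- One of the end points of `]a, b[` lies outside of the window.
    rw [hmem', not_and_or, not_lt, not_lt, le_neg] at hp
    rcases hp with h | h
    · exact cohomology_eq_zero_of_subset_Ico (neg_fst_lt_snd p) Set.Ioo_subset_Ico_self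
        (fun y hy hy' ↦ ⟨h.trans_lt hy.1, hy'.2⟩) α
    · exact cohomology_eq_zero_of_subset_Ioc (neg_fst_lt_snd p) Set.Ioo_subset_Ioc_self
        (fun y hy hy' ↦ ⟨hy'.1, hy.2.trans_le h⟩) α
  · rw [hmem, isFull_Ioo_iff hab (neg_fst_lt_snd p), le_neg]

theorem nonempty_psi_iso_verticalBlock (hab : a < b) :
    Nonempty (psi (extObj k (Set.Ioc a b) (-i)) ≅ (verticalBlock a b true false).system k i) := by
  refine nonempty_psi_iso_of_acyclic Set.ordConnected_Ioc i
    ((verticalBlock a b true false).isMVFamily i) (fun p ↦ ?_) (fun n hn ↦ notMem_single hn)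
    fun p ↦ cohomology_eq_zero_of_subset_Ioc (neg_fst_lt_snd p) subset_rfl fun _ _ h ↦ h
  rw [isFull_Ioc_iff hab (neg_fst_lt_snd p), le_neg, neg_lt, and_comm]
  exact mem_single_self.trans ((and_iff_left trivial).trans mem_segment_false_true)

theorem nonempty_psi_iso_horizontalBlock (hab : a < b) :
    Nonempty (psi (extObj k (Set.Ico a b) (-i)) ≅
      (horizontalBlock a b false true).system k i) := by
  refine nonempty_psi_iso_of_acyclic Set.ordConnected_Ico i
    ((horizontalBlock a b false true).isMVFamily i) (fun p ↦ ?_) (fun n hn ↦ notMem_single hn)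
    fun p ↦ cohomology_eq_zero_of_subset_Ico (neg_fst_lt_snd p) subset_rfl fun _ _ h ↦ h
  rw [isFull_Ico_iff hab (neg_fst_lt_snd p)]
  exact mem_single_self.trans ((and_iff_right trivial).trans mem_segment_false_true)

theorem nonempty_psi_iso_birthBlock (hab : a ≤ b) :
    Nonempty (psi (extObj k (Set.Icc a b) (-i)) ≅ (birthBlock a b false false).system k i) := by
  refine nonempty_psi_iso_of_acyclic Set.ordConnected_Icc i
    ((birthBlock a b false false).isMVFamily i) (fun p ↦ ?_) (fun n hn ↦ ?_)
    fun p ↦ cohomology_eq_zero_of_closedOn_self (neg_fst_lt_snd p)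
      (closedOn_of_subset_Icc subset_rfl fun _ _ h ↦ h)
  · rw [isFull_Icc_iff hab (neg_fst_lt_snd p), neg_lt, birthBlock_family hab]
    exact mem_single_self.trans (and_congr mem_upRay_false mem_upRay_false)
  · rw [birthBlock_family hab]
    exact notMem_single hn

end Blocks

end MayerVietoris

end

theorem propositionP (k : Type u) [Field k] [HasDerivedCategory.{w} (MayerVietoris.ShR k)]
    (a b : ℝ) (i : ℤ) :
    (a < b → Nonempty (MayerVietoris.psi (MayerVietoris.extObj k (Set.Ioo a b) (-i)) ≅
      (MayerVietoris.deathBlock a b true true).system k i)) ∧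
    (a < b → Nonempty (MayerVietoris.psi (MayerVietoris.extObj k (Set.Ioc a b) (-i)) ≅
      (MayerVietoris.verticalBlock a b true false).system k i)) ∧
    (a < b → Nonempty (MayerVietoris.psi (MayerVietoris.extObj k (Set.Ico a b) (-i)) ≅
      (MayerVietoris.horizontalBlock a b false true).system k i)) ∧
    (a ≤ b → Nonempty (MayerVietoris.psi (MayerVietoris.extObj k (Set.Icc a b) (-i)) ≅
      (MayerVietoris.birthBlock a b false false).system k i)) :=
  ⟨MayerVietoris.nonempty_psi_iso_deathBlock k, MayerVietoris.nonempty_psi_iso_verticalBlock k,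
    MayerVietoris.nonempty_psi_iso_horizontalBlock k, MayerVietoris.nonempty_psi_iso_birthBlock k⟩
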